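/- Let $d\ge 0$ be an integer, $\beta>0$, and $\mathcal C_\beta=C([0,\beta];\mathbb R^d)$ with uniform convergence and its Borel $\sigma$-algebra. Let $\mathbb P^\beta_{x,y}$ be the normalized law on $\mathcal C_\beta$ of the Brownian bridge from $x$ to $y$ on $[0,\beta]$ for Brownian motion with generator $\Delta$ (the Gaussian process with mean $x+\frac t\beta(y-x)$ and covariance $2(s\wedge t-\frac{st}{\beta})\,\mathrm{Id}$), and $\mathbb E^\beta_{x,y}$ its expectation. Let $W:\mathbb R^d\to[0,\infty]$ satisfy $W(x)\to\infty$ as $|x|\to\infty$, be continuous on $\{W<\infty\}$, and let $\{W<\infty\}$ be either $\mathbb R^d$ or a connected compact set; put $\tilde W(\omega)=\int_0^\beta W(\omega(s))\,ds$. Let $\mathfrak m$ be either a finite measure on $\mathbb R^d$ or a measure with a continuous bounded density with respect to Lebesgue measure. Let $g:\mathbb R^d\times\mathbb R^d\to(0,\infty)$ be continuous, bounded and symmetric. For a probability measure $\mu$ on $\mathcal C_\beta$ let $\mu_{0,\beta}$ be the joint law of $(\omega(0),\omega(\beta))$ and define the modified rate function $$\mathcal I(\mu)=I^{(\mathrm{sym})}_{\mathfrak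 m}(\mu)+\langle\tilde W,\mu\rangle-\langle\mu_{0,\beta},\log g\rangle,\qquad I^{(\mathrm{sym})}_{\mathfrak m}(\mu)=\inf_{q}\Big\{H(q\,|\,\overline q\otimes\mathfrak m)+I^{(q)}(\mu)\Big\},$$ $$I^{(q)}(\mu)=\sup_{F\in C_b(\mathcal C_\beta)}\Big\{\langle F,\mu\rangle-\int\!\!\int\log\mathbb E^\beta_{x,y}[e^{F}]\,q(dx,dy)\Big\},$$ where $q$ runs over the probability measures on $\mathbb R^d\times\mathbb R^d$ with equal marginals, $\overline q$ is the common marginal, and $H(q|r)=\int\log\frac{dq}{dr}\,dq$ if $q\ll r$ and $+\infty$ otherwise; integrals and sums are extended real numbers, with the convention $\infty-\infty=+\infty$. Consider the operator $$Tf(x)=\int_{\mathbb R^d}f(y)\,\mathbb E^\beta_{x,y}[e^{-\tilde W}]\,g(x,y)\,\mathfrak m(dy),$$ where an eigenfunction of $T$ is a nonzero $f\in L^2(\mathfrak m)$ for which $Tf(x)$ converges absolutely and equals a real multiple of $f(x)$ for $\mathfrak m$-a.e. $x$. Suppose that $T$ has a largest eigenvalue $\lambda_T$, that $\lambda_T>0$,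 and that $\varphi_T:\mathbb R^d\to[0,\infty)$ is an eigenfunction for $\lambda_T$ with $\int\varphi_T^2\,d\mathfrak m=1$. Then the following hold. (i) $\displaystyle\inf_{\mu}\mathcal I(\mu)=-\log\lambda_T$, the infimum being over all probability measures $\mu$ on $\mathcal C_\beta$. (ii) The measure $$\mu^*_T=\frac1{\lambda_T}\int_{\mathbb R^d}\int_{\mathbb R^d}\varphi_T(x)\varphi_T(y)\,e^{-\tilde W}\,\mathbb P^\beta_{x,y}\,g(x,y)\,\mathfrak m(dy)\,\mathfrak m(dx)$$ is a probability measure on $\mathcal C_\beta$. It is a minimizer of $\mathcal I$, provided, in the case $\mathfrak m(\{W<\infty\})=\infty$, that $H(q^*|\overline{q^*}\otimes\mathfrak m)$ is finite for $q^*=(\mu^*_T)_{0,\beta}$. No other probability measure is a minimizer of $\mathcal I$, provided, in the case that $W$ takes the value $\infty$, that the eigenvalue $\lambda_T$ is simple. -/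

import Mathlib

open MeasureTheory ProbabilityTheory Filter Topology
open scoped ENNReal BoundedContinuousFunction

noncomputable section

namespace BridgeLDP

/-- The state space `ℝ^d` with its Euclidean norm. -/
abbrev Space (d : ℕ) : Type := EuclideanSpace ℝ (Fin d)

/-- The path space `C([0, β]; ℝ^d)`; its topology is that of uniform convergence. -/
abbrev Path (d : ℕ) (β : ℝ) : Type := C(Set.Icc (0 : ℝ) β, Space d)

instance (d : ℕ) (β : ℝ) : MeasurableSpace (Path d β) := borel _

instance (d : ℕ) (β : ℝ) : BorelSpace (Path d β) := ⟨rfl⟩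

/-! ### Extended-real conventions: sums and integrals with `∞ - ∞ = +∞` -/

/-- Addition of extended reals with the convention `(+∞) + (-∞) = +∞`
(Mathlib's own addition has `(+∞) + (-∞) = -∞`). -/
def addTop (a b : EReal) : EReal := -(-a + -b)

/-- The integral of a real function as an extended real: the integral of the positive part minus
the integral of the negative part, equal to `+∞` if both are infinite. -/
def extIntegral {X : Type*} [MeasurableSpace X] (q : Measure X) (f : X → ℝ) : EReal :=
  addTop ((∫⁻ x, ENNReal.ofReal (f x) ∂q : ℝ≥0∞) : EReal)
    (-((∫⁻ x, ENNReal.ofReal (-f x) ∂q : ℝ≥0∞) : EReal))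

open scoped Classical in
/-- Relative entropy `H(q | r) = ∫ log (dq/dr) dq`, equal to `+∞` if `q` is not absolutely
continuous with respect to `r`. The reference measure `r` need not be finite. -/
def relEntropy {X : Type*} [MeasurableSpace X] (q r : Measure X) : EReal :=
  if q ≪ r then extIntegral q (llr q r) else ⊤

/-! ### The Brownian bridge for the generator `Δ` -/

/-- `P` is the law on path space of the Brownian bridge (for Brownian motion with generator `Δ`,
that is, with variance `2 t` in each coordinate) from `x` at time `0` to `y` at time `β`: a
Gaussian process with mean `x + (t / β) (y - x)` and covariance matrices
`2 (min s t - s t / β) Id`. -/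
structure IsBrownianBridgeLaw {d : ℕ} {β : ℝ} (x y : Space d) (P : Measure (Path d β)) : Prop where
  isProbabilityMeasure : IsProbabilityMeasure P
  map_linear : ∀ (S : Finset (Set.Icc (0 : ℝ) β)) (u : Set.Icc (0 : ℝ) β → Space d),
    P.map (fun ω => ∑ t ∈ S, inner ℝ (u t) (ω t)) =
      gaussianReal (∑ t ∈ S, inner ℝ (u t) (x + ((t : ℝ) / β) • (y - x)))
        (∑ s ∈ S, ∑ t ∈ S,
          2 * (min (s : ℝ) (t : ℝ) - (s : ℝ) * (t : ℝ) / β) * inner ℝ (u s) (u t)).toNNReal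

open scoped Classical in
/-- The normalized Brownian bridge measure `P^β_{x,y}` on `C([0, β]; ℝ^d)`. -/
def bridge {d : ℕ} (β : ℝ) (x y : Space d) : Measure (Path d β) :=
  if h : ∃ P : Measure (Path d β), IsBrownianBridgeLaw x y P then h.choose else 0

/-! ### Trap potentials and weights -/

/-- A trap potential `W : ℝ^d → [0, ∞]`: it tends to `∞` at infinity, the set where it is finite is
either the whole space or a connected compact set, and it is continuous on that set. -/
structure IsTrap {d : ℕ} (W : Space d → ℝ≥0∞) : Prop where
  tendsto_top : Tendsto W (cocompact (Space d)) (𝓝 ⊤)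
  continuousOn : ContinuousOn W {x | W x ≠ ⊤}
  domain : {x | W x ≠ ⊤} = Set.univ ∨ (IsCompact {x | W x ≠ ⊤} ∧ IsConnected {x | W x ≠ ⊤})

/-- The admissible reference measures: finite measures, and measures with a bounded continuous
density with respect to Lebesgue measure. -/
def IsAdmissible {d : ℕ} (m : Measure (Space d)) : Prop :=
  IsFiniteMeasure m ∨
    ∃ ψ : Space d →ᵇ ℝ, (∀ x, 0 ≤ ψ x) ∧ m = volume.withDensity (fun x => ENNReal.ofReal (ψ x))

/-- `W̃(ω) = ∫_0^β W(ω(s)) ds`. -/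
def action {d : ℕ} {β : ℝ} (W : Space d → ℝ≥0∞) (ω : Path d β) : ℝ≥0∞ :=
  ∫⁻ s, W (ω s) ∂(Measure.comap ((↑) : Set.Icc (0 : ℝ) β → ℝ) volume)

/-- `e^{-W̃(ω)}`, with `e^{-∞} = 0`. -/
def weight {d : ℕ} {β : ℝ} (W : Space d → ℝ≥0∞) (ω : Path d β) : ℝ≥0∞ :=
  EReal.exp (-(action W ω : EReal))

/-- `E^β_{x,y}[e^{-W̃}]`. -/
def bridgeWeight {d : ℕ} (β : ℝ) (W : Space d → ℝ≥0∞) (x y : Space d) : ℝ≥0∞ :=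
  ∫⁻ ω, weight W ω ∂(bridge β x y)

/-! ### The operator `T` -/

/-- The integrand `f(y) E^β_{x,y}[e^{-W̃}] g(x, y)` of `T f(x)`. -/
def opIntegrand {d : ℕ} (β : ℝ) (W : Space d → ℝ≥0∞) (g : Space d → Space d → ℝ)
    (f : Space d → ℝ) (x y : Space d) : ℝ :=
  f y * (bridgeWeight β W x y).toReal * g x y

/-- `f ∈ L²(m)`, `f ≠ 0`, is an eigenfunction of
`T f(x) = ∫ f(y) E^β_{x,y}[e^{-W̃}] g(x, y) m(dy)` with eigenvalue `lam`. -/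
structure IsEigenfunction {d : ℕ} (β : ℝ) (m : Measure (Space d)) (W : Space d → ℝ≥0∞)
    (g : Space d → Space d → ℝ) (lam : ℝ) (f : Space d → ℝ) : Prop where
  memLp : MemLp f 2 m
  ne_zero : ¬ f =ᵐ[m] 0
  eigen : ∀ᵐ x ∂m, Integrable (opIntegrand β W g f x) m ∧
    ∫ y, opIntegrand β W g f x y ∂m = lam * f x

/-- `lam` is the largest (principal) eigenvalue of `T`. -/
def IsPrincipalEigenvalue {d : ℕ} (β : ℝ) (m : Measure (Space d)) (W : Space d → ℝ≥0∞)
    (g : Space d → Space d → ℝ) (lam : ℝ) : Prop :=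
  IsGreatest {a : ℝ | ∃ f, IsEigenfunction β m W g a f} lam

/-! ### The rate function -/

/-- `(ω(0), ω(β))`. -/
def endpoints {d : ℕ} {β : ℝ} [hβ : Fact (0 < β)] (ω : Path d β) : Space d × Space d :=
  (ω ⟨0, le_refl 0, hβ.out.le⟩, ω ⟨β, hβ.out.le, le_refl β⟩)

/-- `μ_{0,β}`, the joint law of the initial and the terminal point of the path under `μ`. -/
def endpointLaw {d : ℕ} {β : ℝ} [Fact (0 < β)] (μ : Measure (Path d β)) :
    Measure (Space d × Space d) :=
  μ.map endpoints

/-- `I^{(q)}(μ) = sup_F { ⟨F, μ⟩ - ∫∫ log E^β_{x,y}[e^F] q(dx, dy) }`, the supremum being over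
bounded continuous `F` on path space. -/
def pairRate {d : ℕ} {β : ℝ} (q : Measure (Space d × Space d)) (μ : Measure (Path d β)) : EReal :=
  ⨆ F : Path d β →ᵇ ℝ,
    (((∫ ω, F ω ∂μ) -
      ∫ z, Real.log (∫ ω, Real.exp (F ω) ∂(bridge β z.1 z.2)) ∂q : ℝ) : EReal)

/-- `I^{(sym)}_m(μ) = inf_q { H(q | q̄ ⊗ m) + I^{(q)}(μ) }`, the infimum being over the probability
measures `q` on `ℝ^d × ℝ^d` whose two marginals coincide; `q̄` is the common marginal. -/
def symRate {d : ℕ} {β : ℝ} (m : Measure (Space d)) (μ : Measure (Path d β)) : EReal :=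
  ⨅ (q : Measure (Space d × Space d)) (_ : IsProbabilityMeasure q) (_ : q.fst = q.snd),
    addTop (relEntropy q (q.fst.prod m)) (pairRate q μ)

/-- The modified (non-normalized) rate function
`μ ↦ I^{(sym)}_m(μ) + ⟨W̃, μ⟩ - ⟨μ_{0,β}, log g⟩`. -/
def modifiedRate {d : ℕ} {β : ℝ} [Fact (0 < β)] (m : Measure (Space d)) (W : Space d → ℝ≥0∞)
    (g : Space d → Space d → ℝ) (μ : Measure (Path d β)) : EReal :=
  addTop (addTop (symRate m μ) ((∫⁻ ω, action W ω ∂μ : ℝ≥0∞) : EReal))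
    (extIntegral (endpointLaw μ) (fun z => -Real.log (g z.1 z.2)))

/-- `μ` is a minimizer of the modified rate function over all probability measures on paths. -/
def IsMinimizer {d : ℕ} {β : ℝ} [Fact (0 < β)] (m : Measure (Space d)) (W : Space d → ℝ≥0∞)
    (g : Space d → Space d → ℝ) (μ : Measure (Path d β)) : Prop :=
  IsProbabilityMeasure μ ∧
    ∀ ν : Measure (Path d β), IsProbabilityMeasure ν → modifiedRate m W g μ ≤ modifiedRate m W g ν

/-- The measure `(1 / lam) ∫∫ φ(x) φ(y) e^{-W̃} P^β_{x,y} g(x, y) m(dy) m(dx)` on path space. -/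
def mixture {d : ℕ} (β : ℝ) (m : Measure (Space d)) (W : Space d → ℝ≥0∞)
    (g : Space d → Space d → ℝ) (lam : ℝ) (φ : Space d → ℝ) : Measure (Path d β) :=
  (m.prod m).bind fun z =>
    ENNReal.ofReal (lam⁻¹ * (φ z.1 * φ z.2 * g z.1 z.2)) •
      (bridge β z.1 z.2).withDensity (weight W)

end BridgeLDP

end

noncomputable section

namespace BridgeLDP

/-! ### Laws on path space -/

variable {d : ℕ} {β : ℝ}

/-! The rate function is a relative entropy in disguise. Write `K` for the kernel `g(x,y)
E_{x,y}[e^{-W̃}]`. If `I^{(q)}(μ)` is finite, testing with functions of the endpoints forces `q =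
μ_{0,β}` (`endpointLaw_eq_of_pairRate_ne_top`), and then `I^{(q)}(μ) = H(μ | P)`, where `P` is the
`q`-mixture of bridges (`integral_llr_le_pairRate`, `pairRate_le_integral_llr`).

Lower bound. Let `r` be the density of the common marginal, `f = √r`, `c = ⟨f, K f⟩`, and let `N` be
the mixture of weighted bridges with weight `f(x) f(y) g(x,y) / c`. By the chain rule (`llr_mix`),
`log dμ/dN` is the sum of the integrands of the rate function, of `log c`, and of `(log r(x) - log
r(y)) / 2`. The last term has mean zero because the marginals agree (`stationary_difference`). Thus
the rate is at least `H(μ | N) - log c` (`rate_lower_bound`). Since `f` is a unit vector of `L²(m)`,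
what remains is `c ≤ λ`. Equality in the end requires `μ = N` and `c = λ`, and then `f = φ`.

The bound `c ≤ λ` (`form_le`) has two proofs. If `W` is finite everywhere, `K` is strictly positive
and Schur's test with weight `φ` applies; it also shows that only `φ` attains the bound
(`schur_test`). Otherwise `K` lives on a compact set of finite mass. There the bounded kernel has a
quadratic form whose maximum on the unit ball is attained at an eigenfunction
(`IsBoundedKernel.exists_max`), so the maximum is at most `λ`; any unit maximizer is an
eigenfunction, and simplicity identifies it with `φ`.

Upper bound. The mixture built from a general `f` has rate at most `-∫ log (K f / f)` under its
marginal (`rate_mix_le`), which is `-log λ` for `f = φ`. This needs the negative part of the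
log-density of the endpoint law to be integrable, which may fail if the domain of `W` has infinite
mass. For the infimum, `φ` is therefore cut off to balls, where the condition is automatic, and the
radius tends to infinity. -/

lemma measurable_eval_path (t : Set.Icc (0 : ℝ) β) : Measurable fun ω : Path d β => ω t :=
  (continuous_eval_const t).measurable

lemma measurable_linear_path (S : Finset (Set.Icc (0 : ℝ) β)) (u : Set.Icc (0 : ℝ) β → Space d) :
    Measurable fun ω : Path d β => ∑ t ∈ S, inner ℝ (u t) (ω t) := by
  have : Continuous fun ω : Path d β => ∑ t ∈ S, inner ℝ (u t) (ω t) := by fun_prop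
  exact this.measurable

/-- A finite measure on path space is determined by the laws of the linear functionals of finitely
many path values. -/
lemma path_measure_ext {P Q : Measure (Path d β)} [IsFiniteMeasure P] [IsFiniteMeasure Q]
    (h : ∀ (S : Finset (Set.Icc (0 : ℝ) β)) (u : Set.Icc (0 : ℝ) β → Space d),
      P.map (fun ω => ∑ t ∈ S, inner ℝ (u t) (ω t)) =
        Q.map (fun ω => ∑ t ∈ S, inner ℝ (u t) (ω t))) : P = Q := by
  classical
  -- Continuous paths are determined by a countable dense set of times, so restriction to it is
  -- injective; between standard Borel spaces it is then a measurable embedding, and the comparison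
  -- reduces to a countable product.
  obtain ⟨D, hDc, hDd⟩ := TopologicalSpace.exists_countable_dense (Set.Icc (0 : ℝ) β)
  have : Countable D := hDc.to_subtype
  let e : Path d β → (D → Space d) := fun ω t => ω t
  have he : Measurable e := measurable_pi_lambda _ fun t => measurable_eval_path (t : Set.Icc 0 β)
  have hinj : Function.Injective e := by
    intro ω ω' hω
    apply ContinuousMap.coe_injective
    apply Continuous.ext_on hDd ω.continuous ω'.continuous
    intro t ht
    exact congrFun hω ⟨t, ht⟩
  have hemb : MeasurableEmbedding e := he.measurableEmbedding hinj
  suffices hmap : P.map e = Q.map e by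
    ext s hs
    rw [← hinj.preimage_image s, ← Measure.map_apply he (hemb.measurableSet_image.2 hs),
      ← Measure.map_apply he (hemb.measurableSet_image.2 hs), hmap]
  have key : ∀ J : Finset D, (P.map e).map J.restrict = (Q.map e).map J.restrict := by
    intro J
    have hr : Measurable (J.restrict (π := fun _ : D => Space d)) := Finset.measurable_restrict J
    have : IsFiniteMeasure ((P.map e).map J.restrict) := inferInstance
    apply Measure.ext_of_charFunDual
    funext L
    rw [charFunDual_eq_charFun_map_one, charFunDual_eq_charFun_map_one]
    have hL : Measurable L := L.continuous.measurable
    congr 1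
    rw [Measure.map_map hL hr, Measure.map_map (hL.comp hr) he, Measure.map_map hL hr,
      Measure.map_map (hL.comp hr) he]
    let u : J → Space d := fun t =>
      (InnerProductSpace.toDual ℝ (Space d)).symm
        (L.comp (ContinuousLinearMap.single ℝ (fun _ : J => Space d) t))
    -- A functional on finitely many coordinates is represented by vectors, extended by zero to all
    -- times.
    let u' : Set.Icc (0 : ℝ) β → Space d := fun t =>
      if ht : ∃ h : t ∈ D, (⟨t, h⟩ : D) ∈ J then u ⟨⟨t, ht.1⟩, ht.2⟩ else 0
    have hfun : (⇑L ∘ J.restrict) ∘ e =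
        fun ω => ∑ t ∈ J.map ⟨Subtype.val, Subtype.val_injective⟩, inner ℝ (u' t) (ω t) := by
      funext ω
      rw [Finset.sum_map, ← Finset.sum_coe_sort J]
      have h1 : J.restrict (e ω) = ∑ t : J, ContinuousLinearMap.single ℝ (fun _ : J => Space d) t
          (J.restrict (e ω) t) := by
        simp only [ContinuousLinearMap.single_apply]
        exact (Finset.univ_sum_single _).symm
      simp only [Function.comp_apply]
      rw [h1, map_sum]
      refine Finset.sum_congr rfl fun t _ => ?_
      have h2 : u' ((t : D) : Set.Icc (0 : ℝ) β) = u t := by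
        have : ∃ h : ((t : D) : Set.Icc (0 : ℝ) β) ∈ D, (⟨_, h⟩ : D) ∈ J := ⟨t.1.2, t.2⟩
        simp only [u', dif_pos this]
      simp only [Function.Embedding.coeFn_mk]
      rw [h2]
      simp only [u, InnerProductSpace.toDual_symm_apply]
      rfl
    rw [hfun]
    exact h _ _
  exact IsProjectiveLimit.unique (P := fun J => (P.map e).map J.restrict) (fun J => rfl)
    (fun J => (key J).symm)

lemma IsBrownianBridgeLaw.unique {x y : Space d} {P Q : Measure (Path d β)}
    (hP : IsBrownianBridgeLaw x y P) (hQ : IsBrownianBridgeLaw x y Q) : P = Q := by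
  have := hP.isProbabilityMeasure
  have := hQ.isProbabilityMeasure
  exact path_measure_ext fun S u => by rw [hP.map_linear, hQ.map_linear]

/-- The affine path from `x` to `y`. -/
def line (β : ℝ) (x y : Space d) : Path d β :=
  ⟨fun t => x + ((t : ℝ) / β) • (y - x), by fun_prop⟩

lemma line_apply (x y : Space d) (t : Set.Icc (0 : ℝ) β) :
    line β x y t = x + ((t : ℝ) / β) • (y - x) := rfl

/-- Adding an affine path shifts the mean and leaves the covariance alone. All bridges are therefore
translates of a single one, which yields their existence from that of one bridge and their
measurability in the endpoints. -/
lemma IsBrownianBridgeLaw.add_line {x y : Space d} {P : Measure (Path d β)}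
    (hP : IsBrownianBridgeLaw x y P) (v w : Space d) :
    IsBrownianBridgeLaw (x + v) (y + w) (P.map fun ω => ω + line β v w) := by
  have hm : Measurable fun ω : Path d β => ω + line β v w := (continuous_add_const _).measurable
  have := hP.isProbabilityMeasure
  refine ⟨Measure.isProbabilityMeasure_map hm.aemeasurable, fun S u => ?_⟩
  rw [Measure.map_map (measurable_linear_path S u) hm]
  have : (fun ω : Path d β => ∑ t ∈ S, inner ℝ (u t) (ω t)) ∘ (fun ω => ω + line β v w) =
      (fun a : ℝ => a + ∑ t ∈ S, inner ℝ (u t) (line β v w t)) ∘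
        fun ω => ∑ t ∈ S, inner ℝ (u t) (ω t) := by
    funext ω
    simp [inner_add_right, Finset.sum_add_distrib]
  rw [this, ← Measure.map_map (by fun_prop) (measurable_linear_path S u), hP.map_linear,
    gaussianReal_map_add_const]
  congr 1
  rw [← Finset.sum_add_distrib]
  refine Finset.sum_congr rfl fun t _ => ?_
  rw [← inner_add_right, line_apply, add_add_add_comm, ← smul_add, add_sub_add_comm]

/-- Time reversal of `[0, β]`. -/
def reflectTime (β : ℝ) : Set.Icc (0 : ℝ) β ≃ Set.Icc (0 : ℝ) β where
  toFun t := ⟨β - t, by have := t.2.1; have := t.2.2; constructor <;> linarith⟩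
  invFun t := ⟨β - t, by have := t.2.1; have := t.2.2; constructor <;> linarith⟩
  left_inv t := by ext; simp
  right_inv t := by ext; simp

lemma coe_reflectTime (t : Set.Icc (0 : ℝ) β) : (reflectTime β t : ℝ) = β - t := rfl

lemma reflectTime_reflectTime (t : Set.Icc (0 : ℝ) β) : reflectTime β (reflectTime β t) = t := by
  ext; simp [coe_reflectTime]

lemma continuous_reflectTime : Continuous (reflectTime β) := by
  apply Continuous.subtype_mk
  fun_prop

/-- Time reversal of paths. -/
def reversePath (ω : Path d β) : Path d β := ω.comp ⟨reflectTime β, continuous_reflectTime⟩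

lemma reversePath_apply (ω : Path d β) (t : Set.Icc (0 : ℝ) β) :
    reversePath ω t = ω (reflectTime β t) := rfl

lemma measurable_reversePath : Measurable (reversePath : Path d β → Path d β) :=
  (ContinuousMap.continuous_precomp _).measurable

/-- The covariance `min s t - s t / β` is invariant under `s, t ↦ β - s, β - t`. This is the source
of the symmetry of `T`. -/
lemma IsBrownianBridgeLaw.reverse (hβ : 0 < β) {x y : Space d} {P : Measure (Path d β)}
    (hP : IsBrownianBridgeLaw x y P) : IsBrownianBridgeLaw y x (P.map reversePath) := by
  have := hP.isProbabilityMeasure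
  refine ⟨Measure.isProbabilityMeasure_map measurable_reversePath.aemeasurable, fun S u => ?_⟩
  rw [Measure.map_map (measurable_linear_path S u) measurable_reversePath]
  have : (fun ω : Path d β => ∑ t ∈ S, inner ℝ (u t) (ω t)) ∘ reversePath =
      fun ω => ∑ t ∈ S.map (reflectTime β).toEmbedding,
        inner ℝ (u (reflectTime β t)) (ω t) := by
    funext ω
    simp [Finset.sum_map, reflectTime_reflectTime, reversePath_apply]
  rw [this, hP.map_linear]
  simp only [Finset.sum_map, Equiv.coe_toEmbedding, reflectTime_reflectTime, coe_reflectTime]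
  congr 1
  · refine Finset.sum_congr rfl fun t _ => ?_
    have h1 : (β - (t : ℝ)) / β = 1 - t / β := by field_simp
    have h2 : x + ((β - (t : ℝ)) / β) • (y - x) = y + ((t : ℝ) / β) • (x - y) := by
      rw [h1]
      module
    rw [h2]
  · refine congrArg Real.toNNReal
      (Finset.sum_congr rfl fun s _ => Finset.sum_congr rfl fun t _ => ?_)
    congr 2
    rw [min_sub_sub_left]
    have : max (s : ℝ) t = s + t - min (s : ℝ) t := by linarith [min_add_max (s : ℝ) (t : ℝ)]
    rw [this]
    field_simp
    ring

/-! ### The bridge kernel -/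

variable (d β) in
/-- The Brownian bridge exists. -/
def BridgeExists : Prop := ∃ (x y : Space d) (P : Measure (Path d β)), IsBrownianBridgeLaw x y P

lemma isBrownianBridgeLaw_bridge (hex : BridgeExists d β) (x y : Space d) :
    IsBrownianBridgeLaw x y (bridge β x y) := by
  have h : ∃ P : Measure (Path d β), IsBrownianBridgeLaw x y P := by
    obtain ⟨x₀, y₀, P, hP⟩ := hex
    have := hP.add_line (x - x₀) (y - y₀)
    exact ⟨_, by simpa using this⟩
  rw [bridge, dif_pos h]
  exact h.choose_spec

lemma bridge_eq_zero (hex : ¬ BridgeExists d β) (x y : Space d) : bridge β x y = 0 := by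
  rw [bridge, dif_neg]
  rintro ⟨P, hP⟩
  exact hex ⟨x, y, P, hP⟩

lemma bridge_eq_map (hex : BridgeExists d β) (x y : Space d) :
    bridge β x y = (bridge β 0 0).map fun ω => ω + line β x y := by
  refine (isBrownianBridgeLaw_bridge hex x y).unique ?_
  simpa using (isBrownianBridgeLaw_bridge hex 0 0).add_line x y

lemma continuous_line : Continuous fun z : Space d × Space d => line β z.1 z.2 := by
  apply ContinuousMap.continuous_of_continuous_uncurry
  simp only [Function.uncurry_def, line_apply]
  fun_prop

/-- As translates of the bridge from `0` to `0`, the bridges give an event the mass of a section of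
a measurable set in the product space. -/
lemma measurable_bridge : Measurable fun z : Space d × Space d => bridge β z.1 z.2 := by
  by_cases hex : BridgeExists d β
  · have := (isBrownianBridgeLaw_bridge (β := β) hex 0 0).isProbabilityMeasure
    have hadd : Measurable fun p : (Space d × Space d) × Path d β => p.2 + line β p.1.1 p.1.2 := by
      have : Continuous fun p : (Space d × Space d) × Path d β => p.2 + line β p.1.1 p.1.2 :=
        continuous_snd.add (continuous_line.comp continuous_fst)
      exact this.measurable
    refine Measure.measurable_of_measurable_coe _ fun s hs => ?_
    have : (fun z : Space d × Space d => bridge β z.1 z.2 s) = fun z => bridge (d := d) β 0 0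
        (Prod.mk z ⁻¹' ((fun p : (Space d × Space d) × Path d β =>
          p.2 + line β p.1.1 p.1.2) ⁻¹' s)) := by
      funext z
      rw [bridge_eq_map hex, Measure.map_apply (continuous_add_const _).measurable hs]
      rfl
    rw [this]
    exact measurable_measure_prodMk_left (hadd hs)
  · simp only [bridge_eq_zero hex]
    exact measurable_const

variable (d β) in
/-- The Brownian bridge as a kernel. -/
def bridgeKernel : Kernel (Space d × Space d) (Path d β) :=
  ⟨fun z => bridge β z.1 z.2, measurable_bridge⟩

lemma bridgeKernel_apply (z : Space d × Space d) : bridgeKernel d β z = bridge β z.1 z.2 := rfl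

lemma isMarkovKernel_bridgeKernel (hex : BridgeExists d β) :
    IsMarkovKernel (bridgeKernel d β) :=
  ⟨fun z => (isBrownianBridgeLaw_bridge hex z.1 z.2).isProbabilityMeasure⟩

lemma measurable_endpoints [Fact (0 < β)] : Measurable (endpoints : Path d β → _) :=
  (measurable_eval_path _).prodMk (measurable_eval_path _)

lemma continuous_endpoints [Fact (0 < β)] : Continuous (endpoints : Path d β → _) :=
  (continuous_eval_const _).prodMk (continuous_eval_const _)

/-- Where the variance vanishes, that is at times `0` and `β`, each coordinate is a degenerate
Gaussian, hence a Dirac mass at its mean. -/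
lemma IsBrownianBridgeLaw.ae_eval_eq {x y : Space d} {P : Measure (Path d β)}
    (hP : IsBrownianBridgeLaw x y P) (t : Set.Icc (0 : ℝ) β)
    (ht : (t : ℝ) - t * t / β = 0) : ∀ᵐ ω ∂P, ω t = x + ((t : ℝ) / β) • (y - x) := by
  have key : ∀ i : Fin d, ∀ᵐ ω ∂P, ω t i = (x + ((t : ℝ) / β) • (y - x)) i := by
    intro i
    have h := hP.map_linear {t} fun _ => EuclideanSpace.single i 1
    simp only [Finset.sum_singleton, min_self, ht, mul_zero, zero_mul, Real.toNNReal_zero,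
      gaussianReal_zero_var] at h
    have hm : Measurable fun ω : Path d β => inner ℝ (EuclideanSpace.single i (1 : ℝ)) (ω t) := by
      have : Continuous fun ω : Path d β =>
        inner ℝ (EuclideanSpace.single i (1 : ℝ)) (ω t) := by fun_prop
      exact this.measurable
    have h2 : ∀ᵐ a ∂(P.map fun ω : Path d β => inner ℝ (EuclideanSpace.single i (1 : ℝ)) (ω t)),
        a = inner ℝ (EuclideanSpace.single i (1 : ℝ)) (x + ((t : ℝ) / β) • (y - x)) := by
      rw [h, ae_dirac_eq]
      exact rfl
    have h3 := ae_of_ae_map hm.aemeasurable h2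
    filter_upwards [h3] with ω hω
    simpa [EuclideanSpace.inner_single_left] using hω
  filter_upwards [ae_all_iff.2 key] with ω hω
  ext i
  exact hω i

lemma ae_endpoints_eq [hβ : Fact (0 < β)] (hex : BridgeExists d β) (z : Space d × Space d) :
    ∀ᵐ ω ∂(bridgeKernel d β z), endpoints ω = z := by
  have hP := isBrownianBridgeLaw_bridge (β := β) hex z.1 z.2
  have hβ' := hβ.out.ne'
  filter_upwards [hP.ae_eval_eq ⟨0, le_refl 0, hβ.out.le⟩ (by simp),
    hP.ae_eval_eq ⟨β, hβ.out.le, le_refl β⟩ (by field_simp; simp)] with ω h0 h1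
  rw [endpoints, h0, h1]
  ext1 <;> simp [hβ']

/-! ### The action of a trap potential -/

lemma IsTrap.isClosed_domain {W : Space d → ℝ≥0∞} (hW : IsTrap W) : IsClosed {x | W x ≠ ⊤} := by
  rcases hW.domain with h | h
  · rw [h]; exact isClosed_univ
  · exact h.1.isClosed

lemma IsTrap.measurable {W : Space d → ℝ≥0∞} (hW : IsTrap W) : Measurable W := by
  classical
  have hD := hW.isClosed_domain.measurableSet
  refine measurable_of_restrict_of_restrict_compl hD hW.continuousOn.domRestrict.measurable ?_
  have : Set.domRestrict {x | W x ≠ ⊤}ᶜ W = fun _ => ⊤ := by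
    funext x
    exact not_not.1 x.2
  rw [this]
  exact measurable_const

variable (β) in
/-- Lebesgue measure on the time interval. -/
abbrev timeMeasure : Measure (Set.Icc (0 : ℝ) β) :=
  Measure.comap ((↑) : Set.Icc (0 : ℝ) β → ℝ) volume

instance : IsFiniteMeasure (timeMeasure β) := by
  refine ⟨?_⟩
  rw [(MeasurableEmbedding.subtype_coe measurableSet_Icc).comap_apply,
    Set.image_univ, Subtype.range_coe]
  exact measure_Icc_lt_top

lemma measurable_action {W : Space d → ℝ≥0∞} (hW : Measurable W) :
    Measurable (action W : Path d β → ℝ≥0∞) := by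
  have h : Measurable fun p : Path d β × Set.Icc (0 : ℝ) β => W (p.1 p.2) :=
    hW.comp (continuous_eval : Continuous fun p : Path d β × Set.Icc (0 : ℝ) β => p.1 p.2).measurable
  exact h.lintegral_prod_right' (ν := (timeMeasure β))

lemma weight_eq (W : Space d → ℝ≥0∞) (ω : Path d β) (h : action W ω ≠ ⊤) :
    weight W ω = ENNReal.ofReal (Real.exp (-(action W ω).toReal)) := by
  rw [weight, ← EReal.coe_ennreal_toReal h, ← EReal.coe_neg, EReal.exp_coe]

lemma weight_eq_zero_iff {W : Space d → ℝ≥0∞} {ω : Path d β} :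
    weight W ω = 0 ↔ action W ω = ⊤ := by
  constructor
  · intro h
    by_contra h'
    rw [weight_eq W ω h'] at h
    exact absurd h (by simpa using Real.exp_pos _)
  · intro h
    simp [weight, h]

lemma weight_le_one (W : Space d → ℝ≥0∞) (ω : Path d β) : weight W ω ≤ 1 := by
  by_cases h : action W ω = ⊤
  · simp [weight_eq_zero_iff.2 h]
  · rw [weight_eq W ω h, ENNReal.ofReal_le_one]
    exact Real.exp_le_one_iff.2 (by simp)

lemma measurable_weight {W : Space d → ℝ≥0∞} (hW : Measurable W) :
    Measurable (weight W : Path d β → ℝ≥0∞) := by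
  unfold weight
  have : Measurable EReal.exp := ENNReal.continuous_exp.measurable
  exact this.comp (measurable_action hW).coe_ereal_ennreal.neg

lemma action_reversePath {W : Space d → ℝ≥0∞} (hW : Measurable W) (ω : Path d β) :
    action W (reversePath ω) = action W ω := by
  have hpre : MeasurePreserving (reflectTime β)
      (timeMeasure β) (timeMeasure β) := by
    refine ⟨continuous_reflectTime.measurable, ?_⟩
    have hemb : MeasurableEmbedding ((↑) : Set.Icc (0 : ℝ) β → ℝ) :=
      MeasurableEmbedding.subtype_coe measurableSet_Icc
    ext s hs
    rw [Measure.map_apply continuous_reflectTime.measurable hs, hemb.comap_apply,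
      hemb.comap_apply]
    have : ((↑) : Set.Icc (0 : ℝ) β → ℝ) '' (reflectTime β ⁻¹' s) =
        (fun x : ℝ => β - x) ⁻¹' (((↑) : Set.Icc (0 : ℝ) β → ℝ) '' s) := by
      ext a
      constructor
      · rintro ⟨t, ht, rfl⟩
        exact ⟨_, ht, rfl⟩
      · rintro ⟨t, ht, hta⟩
        refine ⟨reflectTime β t, ?_, ?_⟩
        · simpa [reflectTime_reflectTime] using ht
        · rw [coe_reflectTime, hta]; ring
    rw [this, (Measure.measurePreserving_sub_left volume β).measure_preimage
      (hemb.measurableSet_image.2 hs).nullMeasurableSet]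
  unfold action
  have h : Measurable fun s : Set.Icc (0 : ℝ) β => W (ω s) := hW.comp ω.continuous.measurable
  rw [← hpre.lintegral_comp h]
  rfl

lemma bridgeWeight_symm [hβ : Fact (0 < β)] {W : Space d → ℝ≥0∞} (hW : Measurable W)
    (x y : Space d) : bridgeWeight β W x y = bridgeWeight β W y x := by
  by_cases hex : BridgeExists d β
  · have h := ((isBrownianBridgeLaw_bridge hex y x).reverse hβ.out).unique
      (isBrownianBridgeLaw_bridge hex x y)
    rw [bridgeWeight, ← h, lintegral_map (measurable_weight hW) measurable_reversePath]
    simp only [weight, action_reversePath hW]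
    rfl
  · simp [bridgeWeight, bridge_eq_zero hex]

lemma bridgeWeight_le_one (hex : BridgeExists d β) (W : Space d → ℝ≥0∞) (x y : Space d) :
    bridgeWeight β W x y ≤ 1 := by
  have := (isBrownianBridgeLaw_bridge hex x y).isProbabilityMeasure
  calc bridgeWeight β W x y ≤ ∫⁻ _, 1 ∂(bridge β x y) := lintegral_mono fun ω => weight_le_one W ω
    _ = 1 := by simp

lemma measurable_bridgeWeight {W : Space d → ℝ≥0∞} (hW : Measurable W) :
    Measurable fun z : Space d × Space d => bridgeWeight β W z.1 z.2 :=
  (measurable_weight hW).lintegral_kernel (κ := bridgeKernel d β)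

lemma action_ne_top {W : Space d → ℝ≥0∞} (hW : Continuous W) (hfin : ∀ x, W x ≠ ⊤)
    (ω : Path d β) : action W ω ≠ ⊤ := by
  have hK : IsCompact (Set.range fun s => W (ω s)) :=
    isCompact_range (hW.comp ω.continuous)
  unfold action
  by_cases hne : Nonempty (Set.Icc (0 : ℝ) β)
  · obtain ⟨b, hb⟩ := hK.exists_isGreatest (Set.range_nonempty _)
    obtain ⟨s, hs⟩ := hb.1
    have h1 : ∫⁻ s, W (ω s) ∂(timeMeasure β) ≤
        ∫⁻ _, b ∂(timeMeasure β) :=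
      lintegral_mono fun s => hb.2 ⟨s, rfl⟩
    refine ne_top_of_le_ne_top ?_ h1
    rw [lintegral_const]
    exact ENNReal.mul_ne_top (hs ▸ hfin _) (measure_ne_top _ _)
  · have := not_nonempty_iff.1 hne
    simp

/-- A finite continuous potential is bounded along each path, so the weight vanishes nowhere. This
strict positivity replaces irreducibility in Schur's test. -/
lemma bridgeWeight_pos (hex : BridgeExists d β) {W : Space d → ℝ≥0∞} (hW : Continuous W)
    (hfin : ∀ x, W x ≠ ⊤) (x y : Space d) : 0 < bridgeWeight β W x y := by
  have := (isBrownianBridgeLaw_bridge hex x y).isProbabilityMeasure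
  rw [bridgeWeight, lintegral_pos_iff_support (measurable_weight hW.measurable)]
  have : Function.support (weight W : Path d β → ℝ≥0∞) = Set.univ := by
    ext ω
    simp [weight_eq_zero_iff, action_ne_top hW hfin ω]
  rw [this]
  simp

/-- Paths with finite action stay in the domain of the potential. -/
lemma mem_domain_of_action_ne_top [hβ : Fact (0 < β)] {W : Space d → ℝ≥0∞} (hW : IsTrap W)
    {ω : Path d β} (h : action W ω ≠ ⊤) (t : Set.Icc (0 : ℝ) β) : W (ω t) ≠ ⊤ := by
  have hm : Measurable fun s : Set.Icc (0 : ℝ) β => W (ω s) :=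
    hW.measurable.comp ω.continuous.measurable
  have hae : ∀ᵐ s ∂(timeMeasure β), W (ω s) < ⊤ := ae_lt_top hm h
  -- Time measure charges nonempty open sets, so finiteness at almost every time is finiteness on a
  -- dense set of times; closedness of the domain then gives all times, the endpoints included.
  have : Measure.IsOpenPosMeasure (timeMeasure β) := by
    refine ⟨fun U hU hne hU0 => ?_⟩
    obtain ⟨s, hs⟩ := hne
    obtain ⟨ε, hε, hball⟩ := Metric.isOpen_iff.1 hU s hs
    have hsub : (Set.Ioo (max 0 ((s : ℝ) - ε)) (min β (s + ε))) ⊆ (↑) '' U := by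
      intro a ha
      have h1 := ha.1
      have h2 := ha.2
      rw [max_lt_iff] at h1
      rw [lt_min_iff] at h2
      refine ⟨⟨a, h1.1.le, h2.1.le⟩, hball ?_, rfl⟩
      rw [Metric.mem_ball, Subtype.dist_eq, Real.dist_eq, abs_lt]
      constructor <;> simp only <;> linarith
    have h0 : volume (((↑) : Set.Icc (0 : ℝ) β → ℝ) '' U) = 0 := by
      rw [← (MeasurableEmbedding.subtype_coe measurableSet_Icc).comap_apply]
      exact hU0
    have h3 := measure_mono_null hsub h0
    rw [Real.volume_Ioo, ENNReal.ofReal_eq_zero] at h3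
    have h4 := s.2.1
    have h5 := s.2.2
    have h6 := hβ.out
    have : max 0 ((s : ℝ) - ε) < min β (s + ε) := by
      rw [max_lt_iff, lt_min_iff, lt_min_iff]
      refine ⟨⟨h6, by linarith⟩, by linarith, by linarith⟩
    linarith
  have hd := Measure.dense_of_ae hae
  have hcl : IsClosed {s : Set.Icc (0 : ℝ) β | W (ω s) ≠ ⊤} :=
    hW.isClosed_domain.preimage ω.continuous
  have : {s : Set.Icc (0 : ℝ) β | W (ω s) ≠ ⊤} = Set.univ := by
    refine hcl.closure_eq.symm.trans ?_
    refine Dense.closure_eq (hd.mono ?_)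
    intro s hs
    exact ne_of_lt hs
  exact this.ge (Set.mem_univ t)

/-- A bridge starting or ending outside the domain has infinite action. Hence the kernel lives on
the square of the domain, even though a single instant is null for the action. -/
lemma bridgeWeight_eq_zero [hβ : Fact (0 < β)] (hex : BridgeExists d β) {W : Space d → ℝ≥0∞}
    (hW : IsTrap W) {x y : Space d} (h : W x = ⊤ ∨ W y = ⊤) : bridgeWeight β W x y = 0 := by
  rw [bridgeWeight, lintegral_eq_zero_iff (measurable_weight hW.measurable)]
  filter_upwards [ae_endpoints_eq hex (x, y)] with ω hω
  rw [Pi.zero_apply, weight_eq_zero_iff]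
  by_contra hne
  have h1 := mem_domain_of_action_ne_top hW hne ⟨0, le_refl 0, hβ.out.le⟩
  have h2 := mem_domain_of_action_ne_top hW hne ⟨β, hβ.out.le, le_refl β⟩
  rw [endpoints, Prod.mk.injEq] at hω
  rw [hω.1] at h1
  rw [hω.2] at h2
  tauto

/-! ### Extended-real conventions -/

lemma addTop_top_left (b : EReal) : addTop ⊤ b = ⊤ := by simp [addTop]

lemma addTop_top_right (a : EReal) : addTop a ⊤ = ⊤ := by simp [addTop]

lemma ne_top_of_addTop_ne_top {a b : EReal} (h : addTop a b ≠ ⊤) : a ≠ ⊤ ∧ b ≠ ⊤ :=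
  ⟨fun ha => h (by rw [ha, addTop_top_left]), fun hb => h (by rw [hb, addTop_top_right])⟩

lemma addTop_coe (a b : ℝ) : addTop a b = ((a + b : ℝ) : EReal) := by
  rw [addTop, ← EReal.coe_neg, ← EReal.coe_neg, ← EReal.coe_add, ← EReal.coe_neg]
  congr 1
  ring

lemma addTop_mono {a a' b b' : EReal} (ha : a ≤ a') (hb : b ≤ b') : addTop a b ≤ addTop a' b' :=
  EReal.neg_le_neg_iff.2 (add_le_add (EReal.neg_le_neg_iff.2 ha) (EReal.neg_le_neg_iff.2 hb))

/-! ### Functions with integrable negative part -/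

section Integrals

variable {X : Type*} [MeasurableSpace X] {q : Measure X} {f g : X → ℝ}

/-- The negative part of `f` is integrable. -/
def NegInt (q : Measure X) (f : X → ℝ) : Prop := ∫⁻ x, ENNReal.ofReal (-f x) ∂q ≠ ⊤

lemma NegInt.mono (hf : NegInt q f) (h : ∀ᵐ x ∂q, f x ≤ g x) : NegInt q g := by
  refine ne_top_of_le_ne_top hf (lintegral_mono_ae ?_)
  filter_upwards [h] with x hx
  exact ENNReal.ofReal_le_ofReal (by linarith)

lemma NegInt.add (hf : NegInt q f) (hg : NegInt q g) (hfm : AEMeasurable f q) :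
    NegInt q (fun x => f x + g x) := by
  refine ne_top_of_le_ne_top (ENNReal.add_ne_top.2 ⟨hf, hg⟩) ?_
  rw [← lintegral_add_left' (by fun_prop)]
  refine lintegral_mono fun x => ?_
  rw [neg_add]
  exact ENNReal.ofReal_add_le

lemma _root_.MeasureTheory.Integrable.negInt (hf : Integrable f q) : NegInt q f :=
  (Integrable.lintegral_lt_top hf.neg).ne

lemma integrable_of_negInt (hfm : AEMeasurable f q) (h1 : NegInt q f)
    (h2 : NegInt q fun x => -f x) : Integrable f q := by
  refine ⟨hfm.aestronglyMeasurable, ?_⟩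
  unfold HasFiniteIntegral
  have h : ∀ x, ‖f x‖ₑ ≤ ENNReal.ofReal (-f x) + ENNReal.ofReal (- -f x) := by
    intro x
    rw [← ofReal_norm, Real.norm_eq_abs]
    rcases abs_cases (f x) with ⟨h, _⟩ | ⟨h, _⟩
    · rw [h, neg_neg]; exact le_add_self
    · rw [h]; exact le_self_add
  refine lt_of_le_of_lt (lintegral_mono h) ?_
  rw [lintegral_add_left' (by fun_prop)]
  exact ENNReal.add_lt_top.2 ⟨h1.lt_top, h2.lt_top⟩

lemma negInt_const [IsFiniteMeasure q] (c : ℝ) : NegInt q fun _ => c :=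
  (integrable_const c).negInt

lemma negInt_of_nonneg (h : ∀ᵐ x ∂q, 0 ≤ f x) : NegInt q f := by
  have : NegInt q fun _ => (0 : ℝ) := by simp [NegInt]
  exact this.mono h

lemma extIntegral_of_integrable (hf : Integrable f q) :
    extIntegral q f = ((∫ x, f x ∂q : ℝ) : EReal) := by
  have h1 : ∫⁻ x, ENNReal.ofReal (f x) ∂q ≠ ⊤ := (Integrable.lintegral_lt_top hf).ne
  have h2 : ∫⁻ x, ENNReal.ofReal (-f x) ∂q ≠ ⊤ := hf.negInt
  rw [extIntegral, integral_eq_lintegral_pos_part_sub_lintegral_neg_part hf,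
    ← EReal.coe_ennreal_toReal h1, ← EReal.coe_ennreal_toReal h2, ← EReal.coe_neg, addTop_coe,
    sub_eq_add_neg]

lemma negInt_neg_of_extIntegral_ne_top (h : extIntegral q f ≠ ⊤) : NegInt q fun x => -f x := by
  intro h'
  simp only [neg_neg] at h'
  apply h
  rw [extIntegral, h', EReal.coe_ennreal_top, addTop_top_left]

lemma negInt_of_extIntegral_eq_coe {a : ℝ} (h : extIntegral q f = a) : NegInt q f := by
  intro h'
  have h1 : extIntegral q f ≠ ⊤ := by rw [h]; exact EReal.coe_ne_top a
  have h2 := negInt_neg_of_extIntegral_ne_top h1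
  simp only [NegInt, neg_neg] at h2
  rw [extIntegral, h', ← EReal.coe_ennreal_toReal h2] at h
  simp [addTop] at h

/-- If integrable `D n` converge to `f` between `min f 0` and `max f 0`, then integrability of the
negative part of `f` and an upper bound for the integrals of the `D n` make `f` integrable. -/
lemma integrable_of_approx {D : ℕ → X → ℝ} {K : ℝ} (hf : AEMeasurable f q) (hneg : NegInt q f)
    (hD : ∀ n, Integrable (D n) q) (hDneg : ∀ n, ∀ᵐ x ∂q, -D n x ≤ max (-f x) 0)
    (hDpos : ∀ n, ∀ᵐ x ∂q, D n x ≤ max (f x) 0)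
    (hlim : ∀ᵐ x ∂q, Tendsto (fun n => D n x) atTop (𝓝 (f x))) (hK : ∀ n, ∫ x, D n x ∂q ≤ K) :
    Integrable f q ∧ Tendsto (fun n => ∫ x, D n x ∂q) atTop (𝓝 (∫ x, f x ∂q)) := by
  have hbound : ∀ n, ∫⁻ x, ENNReal.ofReal (D n x) ∂q ≤
      ENNReal.ofReal K + ∫⁻ x, ENNReal.ofReal (-f x) ∂q := by
    intro n
    have h1 := integral_eq_lintegral_pos_part_sub_lintegral_neg_part (hD n)
    have h2 : ∫⁻ x, ENNReal.ofReal (D n x) ∂q ≠ ⊤ := (Integrable.lintegral_lt_top (hD n)).ne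
    have h3 : ∫⁻ x, ENNReal.ofReal (-D n x) ∂q ≠ ⊤ := (hD n).negInt
    have h4 : ∫⁻ x, ENNReal.ofReal (-D n x) ∂q ≤ ∫⁻ x, ENNReal.ofReal (-f x) ∂q := by
      refine lintegral_mono_ae ?_
      filter_upwards [hDneg n] with x hx
      refine (ENNReal.ofReal_le_ofReal hx).trans ?_
      rw [ENNReal.ofReal_max]
      simp
    rw [← ENNReal.ofReal_toReal h2]
    have h5 : (∫⁻ x, ENNReal.ofReal (D n x) ∂q).toReal =
        (∫ x, D n x ∂q) + (∫⁻ x, ENNReal.ofReal (-D n x) ∂q).toReal := by linarith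
    rw [h5]
    refine ENNReal.ofReal_add_le.trans (add_le_add (ENNReal.ofReal_le_ofReal (hK n)) ?_)
    rwa [ENNReal.ofReal_toReal h3]
  -- Fatou's lemma bounds the positive part; dominated convergence with majorant `|f|` then gives
  -- the limit.
  have hpos : ∫⁻ x, ENNReal.ofReal (f x) ∂q ≠ ⊤ := by
    have hfatou : ∫⁻ x, liminf (fun n => ENNReal.ofReal (D n x)) atTop ∂q ≤
        liminf (fun n => ∫⁻ x, ENNReal.ofReal (D n x) ∂q) atTop :=
      lintegral_liminf_le' fun n => (hD n).aemeasurable.ennreal_ofReal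
    have heq : ∫⁻ x, liminf (fun n => ENNReal.ofReal (D n x)) atTop ∂q =
        ∫⁻ x, ENNReal.ofReal (f x) ∂q := by
      refine lintegral_congr_ae ?_
      filter_upwards [hlim] with x hx
      exact ((ENNReal.continuous_ofReal.tendsto _).comp hx).liminf_eq
    rw [heq] at hfatou
    refine ne_top_of_le_ne_top (b := ENNReal.ofReal K + ∫⁻ x, ENNReal.ofReal (-f x) ∂q)
      (ENNReal.add_ne_top.2 ⟨ENNReal.ofReal_ne_top, hneg⟩) (hfatou.trans ?_)
    exact liminf_le_of_le (by isBoundedDefault) fun b hb => by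
      obtain ⟨n, hn⟩ := hb.exists
      exact hn.trans (hbound n)
  have hfi : Integrable f q := integrable_of_negInt hf hneg (by simpa [NegInt] using hpos)
  refine ⟨hfi, tendsto_integral_of_dominated_convergence (fun x => |f x|)
    (fun n => (hD n).aestronglyMeasurable) hfi.abs (fun n => ?_) hlim⟩
  filter_upwards [hDneg n, hDpos n] with x h1 h2
  rw [Real.norm_eq_abs, abs_le]
  constructor
  · have : max (-f x) 0 ≤ |f x| := max_le (neg_le_abs _) (abs_nonneg _)
    linarith
  · exact h2.trans (max_le (le_abs_self _) (abs_nonneg _))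

/-- Truncation at levels `±n`. -/
def clamp (n : ℕ) (a : ℝ) : ℝ := max (-n) (min a n)

lemma abs_clamp_le (n : ℕ) (a : ℝ) : |clamp n a| ≤ n := by
  have h : (0 : ℝ) ≤ n := n.cast_nonneg
  rw [clamp, abs_le]
  exact ⟨le_max_left _ _, max_le (by linarith) (min_le_right _ _)⟩

lemma measurable_clamp (n : ℕ) : Measurable (clamp n) := by unfold clamp; fun_prop

lemma clamp_sub_le (n : ℕ) (a b : ℝ) : clamp n a - clamp n b ≤ max (a - b) 0 := by
  unfold clamp
  grind

lemma clamp_le (n : ℕ) (a : ℝ) : clamp n a ≤ max a 0 := by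
  have h : (0 : ℝ) ≤ n := n.cast_nonneg
  unfold clamp
  grind

lemma neg_clamp_le (n : ℕ) (a : ℝ) : -clamp n a ≤ max (-a) 0 := by
  have h : (0 : ℝ) ≤ n := n.cast_nonneg
  unfold clamp
  grind

lemma tendsto_clamp (a : ℝ) : Tendsto (fun n => clamp n a) atTop (𝓝 a) := by
  obtain ⟨N, hN⟩ := exists_nat_ge |a|
  refine tendsto_const_nhds.congr' ?_
  filter_upwards [eventually_ge_atTop N] with n hn
  have h : |a| ≤ n := hN.trans (by exact_mod_cast hn)
  rw [abs_le] at h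
  rw [clamp, min_eq_left h.2, max_eq_right h.1]

lemma integrable_clamp [IsFiniteMeasure q] (n : ℕ) (hf : AEMeasurable f q) :
    Integrable (fun x => clamp n (f x)) q :=
  Integrable.of_bound ((measurable_clamp n).comp_aemeasurable hf).aestronglyMeasurable n
    (ae_of_all _ fun x => by simpa using abs_clamp_le n (f x))

/-- For a pair with equal marginal laws, `h(x) - h(y)` has mean zero as soon as its negative part
is integrable. -/
lemma stationary_difference {q : Measure (X × X)} [IsProbabilityMeasure q] (hq : q.fst = q.snd)
    {h : X → ℝ} (hm : Measurable h) (hneg : NegInt q fun z => h z.1 - h z.2) :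
    Integrable (fun z => h z.1 - h z.2) q ∧ ∫ z, h z.1 - h z.2 ∂q = 0 := by
  have hm1 : Measurable fun z : X × X => h z.1 := by fun_prop
  have hm2 : Measurable fun z : X × X => h z.2 := by fun_prop
  -- Truncations of `h` are integrable even if `h` is not, so equality of the marginals applies to
  -- them; `integrable_of_approx` removes the truncation.
  have hzero : ∀ n, ∫ z, clamp n (h z.1) - clamp n (h z.2) ∂q = 0 := by
    intro n
    have hc : Measurable fun x => clamp n (h x) := (measurable_clamp n).comp hm
    rw [integral_sub (integrable_clamp n hm1.aemeasurable) (integrable_clamp n hm2.aemeasurable)]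
    have e1 : ∫ z, clamp n (h z.1) ∂q = ∫ x, clamp n (h x) ∂q.fst :=
      (integral_map measurable_fst.aemeasurable hc.aestronglyMeasurable).symm
    have e2 : ∫ z, clamp n (h z.2) ∂q = ∫ x, clamp n (h x) ∂q.snd :=
      (integral_map measurable_snd.aemeasurable hc.aestronglyMeasurable).symm
    rw [e1, e2, hq, sub_self]
  obtain ⟨hint, hlim⟩ := integrable_of_approx (K := 0)
    (D := fun n z => clamp n (h z.1) - clamp n (h z.2)) (hm1.sub hm2).aemeasurable hneg
    (fun n => (integrable_clamp n hm1.aemeasurable).sub (integrable_clamp n hm2.aemeasurable))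
    (fun n => ae_of_all _ fun z => by
      simpa only [neg_sub, Pi.sub_apply] using clamp_sub_le n (h z.2) (h z.1))
    (fun n => ae_of_all _ fun z => clamp_sub_le n _ _)
    (ae_of_all _ fun z => (tendsto_clamp _).sub (tendsto_clamp _))
    (fun n => (hzero n).le)
  refine ⟨hint, tendsto_nhds_unique hlim ?_⟩
  simp only [hzero]
  exact tendsto_const_nhds

/-! ### Relative entropy -/

lemma mul_neg_log_le_one {t : ℝ} (ht : 0 ≤ t) : t * -Real.log t ≤ 1 := by
  rcases ht.eq_or_lt with rfl | ht
  · simp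
  · have := Real.one_sub_inv_le_log_of_pos ht
    have h2 : t * (1 - t⁻¹) ≤ t * Real.log t := mul_le_mul_of_nonneg_left this ht.le
    rw [mul_sub, mul_inv_cancel₀ ht.ne'] at h2
    linarith

/-- With `t = dμ/dν`, the negative part integrates to `∫ t (-log t)⁺ dν`. Its integrand is at most
`1` on `S` and vanishes off `S`, so the bound is `ν S`. An infinite `ν` is allowed as long as `μ`
sits on a set of finite `ν`-mass. -/
lemma negInt_llr {μ ν : Measure X} [SigmaFinite μ] [SigmaFinite ν] (h : μ ≪ ν) {S : Set X}
    (hS : MeasurableSet S) (hμ : μ Sᶜ = 0) (hν : ν S ≠ ⊤) : NegInt μ (llr μ ν) := by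
  refine ne_top_of_le_ne_top hν ?_
  have hm : Measurable fun x => ENNReal.ofReal (-llr μ ν x) :=
    (measurable_llr μ ν).neg.ennreal_ofReal
  rw [← lintegral_rnDeriv_mul h hm.aemeasurable, ← lintegral_indicator_one hS]
  refine lintegral_mono_ae ?_
  have h0 : ∀ᵐ x ∂ν, x ∈ Sᶜ → μ.rnDeriv ν x = 0 := by
    have : ∫⁻ x in Sᶜ, μ.rnDeriv ν x ∂ν = 0 := by
      rw [Measure.setLIntegral_rnDeriv h, hμ]
    rw [lintegral_eq_zero_iff (Measure.measurable_rnDeriv _ _)] at this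
    exact (ae_restrict_iff' hS.compl).1 this
  filter_upwards [h0, Measure.rnDeriv_lt_top μ ν] with x hx hfin
  by_cases hxS : x ∈ S
  · rw [Set.indicator_of_mem hxS, Pi.one_apply]
    conv_lhs => rw [← ENNReal.ofReal_toReal hfin.ne]
    rw [← ENNReal.ofReal_mul ENNReal.toReal_nonneg, ← ENNReal.ofReal_one]
    exact ENNReal.ofReal_le_ofReal (mul_neg_log_le_one ENNReal.toReal_nonneg)
  · rw [hx hxS, zero_mul]
    exact zero_le

/-- This is nonnegativity of the relative entropy of `μ` with respect to `P` tilted by `G`; the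
logarithm of the normalizing constant is at most `0` by assumption. -/
lemma integral_le_integral_llr {μ P : Measure X} [IsProbabilityMeasure μ]
    [IsProbabilityMeasure P] (h : μ ≪ P) (hint : Integrable (llr μ P) μ) {G : X → ℝ}
    (hG : Measurable G) {M : ℝ} (hM : ∀ x, |G x| ≤ M) (hexp : ∫ x, Real.exp (G x) ∂P ≤ 1) :
    ∫ x, G x ∂μ ≤ ∫ x, llr μ P x ∂μ := by
  have hGi : ∀ (ν : Measure X) [IsFiniteMeasure ν], Integrable G ν := fun ν _ =>
    Integrable.of_bound hG.aestronglyMeasurable M (ae_of_all _ fun x => by simpa using hM x)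
  have hexpi : Integrable (fun x => Real.exp (G x)) P :=
    Integrable.of_bound (by fun_prop) (Real.exp M) (ae_of_all _ fun x => by
      rw [Real.norm_eq_abs, Real.abs_exp]
      exact Real.exp_le_exp.2 ((le_abs_self _).trans (hM x)))
  have h1 := integral_llr_tilted_right h (hGi μ) hexpi hint
  have := isProbabilityMeasure_tilted hexpi
  have h2 := InformationTheory.integral_llr_add_sub_measure_univ_nonneg
    (h.trans (absolutelyContinuous_tilted hexpi))
    (integrable_llr_tilted_right h (hGi μ) hint hexpi)
  simp only [probReal_univ] at h2
  have h3 : Real.log (∫ x, Real.exp (G x) ∂P) ≤ 0 :=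
    Real.log_nonpos (integral_nonneg fun x => (Real.exp_pos _).le) hexp
  linarith

lemma abs_exp_sub_exp_le {a b M : ℝ} (ha : a ≤ M) (hb : b ≤ M) :
    |Real.exp a - Real.exp b| ≤ Real.exp M * |a - b| := by
  wlog hab : b ≤ a generalizing a b
  · rw [abs_sub_comm, abs_sub_comm a]
    exact this hb ha (le_of_not_ge hab)
  rw [abs_of_nonneg (sub_nonneg.2 (Real.exp_le_exp.2 hab)), abs_of_nonneg (sub_nonneg.2 hab)]
  have h1 := Real.add_one_le_exp (b - a)
  have h2 : Real.exp b = Real.exp a * Real.exp (b - a) := by rw [← Real.exp_add]; ring_nf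
  have h3 : Real.exp a ≤ Real.exp M := Real.exp_le_exp.2 ha
  have h4 := Real.exp_pos a
  rw [h2]
  nlinarith [mul_le_mul_of_nonneg_left h1 h4.le, mul_le_mul_of_nonneg_right h3 (sub_nonneg.2 hab)]

/-! ### Donsker-Varadhan duality: from bounded continuous test functions to relative entropy -/

section DonskerVaradhan

variable [TopologicalSpace X] [NormalSpace X] [BorelSpace X] {μ P : Measure X}
  [IsProbabilityMeasure μ] [IsProbabilityMeasure P] {C : ℝ}

/-- Bounded continuous functions are dense in `L¹(μ + P)`, which controls both integrals at once.
Clipping the approximants at `±M` costs nothing and makes the exponential Lipschitz on their range.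
-/
lemma donskerVaradhan_of_measurable [(μ + P).WeaklyRegular]
    (h : ∀ F : X →ᵇ ℝ, ∫ x, F x ∂μ - Real.log (∫ x, Real.exp (F x) ∂P) ≤ C)
    {F : X → ℝ} (hF : Measurable F) {M : ℝ} (hM : ∀ x, |F x| ≤ M) :
    ∫ x, F x ∂μ - Real.log (∫ x, Real.exp (F x) ∂P) ≤ C := by
  have hFi : ∀ (ν : Measure X) [IsFiniteMeasure ν], Integrable F ν := fun ν _ =>
    Integrable.of_bound hF.aestronglyMeasurable M (ae_of_all _ fun x => by simpa using hM x)
  have hex : ∀ n : ℕ, ∃ H : X →ᵇ ℝ, (∀ x, |H x| ≤ M) ∧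
      ∫ x, |F x - H x| ∂(μ + P) ≤ 1 / ((n : ℝ) + 1) := by
    intro n
    obtain ⟨G, hG, hGi⟩ := (hFi (μ + P)).exists_boundedContinuous_integral_sub_le
      (ε := 1 / ((n : ℝ) + 1)) (by positivity)
    have hb : ∀ x, |max (-M) (min (G x) M)| ≤ M := by
      intro x
      have h1 := (abs_nonneg _).trans (hM x)
      rw [abs_le]
      exact ⟨le_max_left _ _, max_le (by linarith) (min_le_right _ _)⟩
    let H : X →ᵇ ℝ := BoundedContinuousFunction.ofNormedAddCommGroup
      (fun x => max (-M) (min (G x) M)) (by fun_prop) M hb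
    refine ⟨H, hb, le_trans ?_ hG⟩
    refine integral_mono ((hFi _).sub (H.integrable _)).abs ((hFi _).sub hGi).norm fun x => ?_
    have h1 := abs_le.1 (hM x)
    change |F x - max (-M) (min (G x) M)| ≤ |F x - G x|
    grind
  choose H hHM hH using hex
  have hsplit : ∀ n, ∫ x, |F x - H n x| ∂μ ≤ 1 / ((n : ℝ) + 1) ∧
      ∫ x, |F x - H n x| ∂P ≤ 1 / ((n : ℝ) + 1) := by
    intro n
    have h1 := hH n
    have hi : ∀ (ν : Measure X) [IsFiniteMeasure ν], Integrable (fun x => |F x - H n x|) ν :=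
      fun ν _ => ((hFi ν).sub ((H n).integrable ν)).abs
    rw [integral_add_measure (hi μ) (hi P)] at h1
    have h2 : 0 ≤ ∫ x, |F x - H n x| ∂μ := integral_nonneg fun x => abs_nonneg _
    have h3 : 0 ≤ ∫ x, |F x - H n x| ∂P := integral_nonneg fun x => abs_nonneg _
    constructor <;> linarith
  have hexpi : ∀ (G : X → ℝ), Measurable G → (∀ x, |G x| ≤ M) →
      Integrable (fun x => Real.exp (G x)) P := fun G hGm hGM =>
    Integrable.of_bound (by fun_prop) (Real.exp M) (ae_of_all _ fun x => by
      rw [Real.norm_eq_abs, Real.abs_exp]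
      exact Real.exp_le_exp.2 ((le_abs_self _).trans (hGM x)))
  have hlim0 := tendsto_one_div_add_atTop_nhds_zero_nat (𝕜 := ℝ)
  have hl1 : Tendsto (fun n => ∫ x, H n x ∂μ) atTop (𝓝 (∫ x, F x ∂μ)) := by
    rw [tendsto_iff_dist_tendsto_zero]
    refine squeeze_zero (fun n => dist_nonneg) (fun n => ?_) hlim0
    rw [dist_comm, Real.dist_eq, ← integral_sub (hFi μ) ((H n).integrable μ)]
    exact abs_integral_le_integral_abs.trans (hsplit n).1
  have hl2 : Tendsto (fun n => ∫ x, Real.exp (H n x) ∂P) atTop (𝓝 (∫ x, Real.exp (F x) ∂P)) := by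
    rw [tendsto_iff_dist_tendsto_zero]
    have hlim1 := hlim0.const_mul (Real.exp M)
    rw [mul_zero] at hlim1
    refine squeeze_zero (fun n => dist_nonneg) (fun n => ?_) hlim1
    have hi1 := hexpi F hF hM
    have hi2 := hexpi (H n) (H n).continuous.measurable (hHM n)
    rw [dist_comm, Real.dist_eq, ← integral_sub hi1 hi2]
    refine abs_integral_le_integral_abs.trans ?_
    refine le_trans ?_ (mul_le_mul_of_nonneg_left (hsplit n).2 (Real.exp_pos M).le)
    rw [← integral_const_mul]
    refine integral_mono (hi1.sub hi2).abs
      (((hFi P).sub ((H n).integrable P)).abs.const_mul _) fun x => ?_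
    exact abs_exp_sub_exp_le ((le_abs_self _).trans (hM x)) ((le_abs_self _).trans (hHM n x))
  have hpos : 0 < ∫ x, Real.exp (F x) ∂P := integral_exp_pos (hexpi F hF hM)
  exact le_of_tendsto (hl1.sub (hl2.log hpos.ne')) (Eventually.of_forall fun n => h (H n))

/-- If the Donsker-Varadhan functional is bounded on bounded continuous functions, then the
relative entropy is finite and satisfies the same bound. -/
lemma integral_llr_le_of_donskerVaradhan [(μ + P).WeaklyRegular]
    (h : ∀ F : X →ᵇ ℝ, ∫ x, F x ∂μ - Real.log (∫ x, Real.exp (F x) ∂P) ≤ C) :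
    μ ≪ P ∧ Integrable (llr μ P) μ ∧ ∫ x, llr μ P x ∂μ ≤ C := by
  have hac : μ ≪ P := by
    refine Measure.AbsolutelyContinuous.mk fun s hs hPs => ?_
    -- Testing with `n` times the indicator of a `P`-null set: the exponential moment stays `1`, so
    -- the bound `n μ(s) ≤ C` for all `n` forces `μ(s) = 0`.
    have hn : ∀ n : ℕ, (n : ℝ) * μ.real s ≤ C := by
      intro n
      have h1 := donskerVaradhan_of_measurable h
        (F := s.indicator fun _ => (n : ℝ)) (measurable_const.indicator hs) (M := n) (fun x => by
          by_cases hx : x ∈ s <;> simp [hx])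
      have h2 : ∫ x, Real.exp (s.indicator (fun _ => (n : ℝ)) x) ∂P = 1 := by
        have : (fun x => Real.exp (s.indicator (fun _ => (n : ℝ)) x)) =ᵐ[P] fun _ => 1 := by
          filter_upwards [measure_eq_zero_iff_ae_notMem.1 hPs] with x hx
          simp [hx]
        rw [integral_congr_ae this]
        simp
      rw [h2, Real.log_one, sub_zero, integral_indicator_const _ hs, smul_eq_mul, mul_comm] at h1
      exact h1
    have h0 : μ.real s = 0 := by
      by_contra hne
      have hpos : 0 < μ.real s := lt_of_le_of_ne measureReal_nonneg (Ne.symm hne)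
      obtain ⟨n, hn'⟩ := exists_nat_gt (C / μ.real s)
      rw [div_lt_iff₀ hpos] at hn'
      exact absurd (hn n) (not_le.2 hn')
    exact (measureReal_eq_zero_iff).1 h0
  have hneg : NegInt μ (llr μ P) :=
    negInt_llr hac MeasurableSet.univ (by simp) (measure_ne_top _ _)
  have hm := measurable_llr μ P
  have hbound : ∀ n : ℕ, ∫ x, clamp n (llr μ P x) ∂μ ≤ C + Real.exp (-n) := by
    intro n
    classical
    -- Where the density vanishes, `Real.log 0 = 0` would make the exponential equal to `1`; the
    -- value `-n` on this `μ`-null set gives `exp F ≤ dμ/dP + e^{-n}` instead.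
    let F : X → ℝ := fun x => if μ.rnDeriv P x = 0 then -n else clamp n (llr μ P x)
    have hFm : Measurable F := Measurable.ite
      (Measure.measurable_rnDeriv μ P (measurableSet_singleton 0)) measurable_const
      ((measurable_clamp n).comp hm)
    have h1 := donskerVaradhan_of_measurable h hFm (M := n) (fun x => by
      simp only [F]
      split_ifs
      · simp
      · exact abs_clamp_le n _)
    have h2 : ∫ x, F x ∂μ = ∫ x, clamp n (llr μ P x) ∂μ := by
      refine integral_congr_ae ?_
      filter_upwards [Measure.rnDeriv_pos hac] with x hx
      simp [F, hx.ne']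
    have hexpi : Integrable (fun x => Real.exp (F x)) P :=
      Integrable.of_bound (by fun_prop) (Real.exp n) (ae_of_all _ fun x => by
        rw [Real.norm_eq_abs, Real.abs_exp]
        refine Real.exp_le_exp.2 ((le_abs_self _).trans ?_)
        simp only [F]
        split_ifs
        · simp
        · exact abs_clamp_le n _)
    have h3 : ∫ x, Real.exp (F x) ∂P ≤ 1 + Real.exp (-n) := by
      have hrn : ∫ x, (μ.rnDeriv P x).toReal ∂P = 1 := by
        rw [Measure.integral_toReal_rnDeriv hac]; simp
      have : ∫ x, ((μ.rnDeriv P x).toReal + Real.exp (-n)) ∂P = 1 + Real.exp (-n) := by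
        rw [integral_add Measure.integrable_toReal_rnDeriv (integrable_const _), hrn]
        simp
      rw [← this]
      refine integral_mono_ae hexpi
        (Measure.integrable_toReal_rnDeriv.add (integrable_const _)) ?_
      filter_upwards [Measure.rnDeriv_lt_top μ P] with x hx
      by_cases h0 : μ.rnDeriv P x = 0
      · simp [F, h0]
      · simp only [F, h0, if_false]
        have hp : 0 < (μ.rnDeriv P x).toReal := ENNReal.toReal_pos h0 hx.ne
        have : clamp n (llr μ P x) ≤ max (-(n : ℝ)) (llr μ P x) := by unfold clamp; grind
        refine (Real.exp_le_exp.2 this).trans ?_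
        rcases max_cases (-(n : ℝ)) (llr μ P x) with ⟨h, _⟩ | ⟨h, _⟩
        · rw [h]; linarith
        · rw [h, llr_def, Real.exp_log hp]; linarith [Real.exp_pos (-(n : ℝ))]
    have h4 : Real.log (∫ x, Real.exp (F x) ∂P) ≤ Real.exp (-n) := by
      have := Real.log_le_sub_one_of_pos (integral_exp_pos hexpi)
      linarith
    linarith
  obtain ⟨hint, hlim⟩ := integrable_of_approx (K := C + 1)
    (D := fun n x => clamp n (llr μ P x)) hm.aemeasurable hneg
    (fun n => integrable_clamp n hm.aemeasurable)
    (fun n => ae_of_all _ fun x => neg_clamp_le n _)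
    (fun n => ae_of_all _ fun x => clamp_le n _)
    (ae_of_all _ fun x => tendsto_clamp _)
    (fun n => (hbound n).trans (by
      have : Real.exp (-(n : ℝ)) ≤ 1 := Real.exp_le_one_iff.2 (by simp)
      linarith))
  refine ⟨hac, hint, ?_⟩
  have hl2 : Tendsto (fun n : ℕ => C + Real.exp (-(n : ℝ))) atTop (𝓝 (C + 0)) :=
    tendsto_const_nhds.add
      (Real.tendsto_exp_neg_atTop_nhds_zero.comp tendsto_natCast_atTop_atTop)
  rw [add_zero] at hl2
  exact le_of_tendsto_of_tendsto' hlim hl2 hbound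

end DonskerVaradhan

end Integrals

/-! ### Densities -/

section Densities

variable {X : Type*} [MeasurableSpace X]

/-- Off the set where `b` is nonzero and finite, `a` vanishes `B`-almost everywhere, so `a = b · (a
/ b)` almost everywhere. Only `N` has to be σ-finite, not the common base `B`. -/
lemma rnDeriv_of_withDensity {B μ N : Measure X} [SigmaFinite N] {a b : X → ℝ≥0∞}
    (ha : Measurable a) (hb : Measurable b) (hμ : μ = B.withDensity a) (hN : N = B.withDensity b)
    (h : ∀ᵐ x ∂μ, b x ≠ 0 ∧ b x ≠ ⊤) : μ ≪ N ∧ μ.rnDeriv N =ᵐ[μ] fun x => a x / b x := by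
  have hab : Measurable fun x => a x / b x := ha.div hb
  have hS : MeasurableSet {x | b x ≠ 0 ∧ b x ≠ ⊤} :=
    ((hb (measurableSet_singleton 0)).compl).inter ((hb (measurableSet_singleton ⊤)).compl)
  have h0 : ∀ᵐ x ∂B, ¬(b x ≠ 0 ∧ b x ≠ ⊤) → a x = 0 := by
    have h1 : ∫⁻ x in {x | b x ≠ 0 ∧ b x ≠ ⊤}ᶜ, a x ∂B = 0 := by
      rw [← withDensity_apply a hS.compl, ← hμ]
      exact h
    rw [lintegral_eq_zero_iff ha] at h1
    exact (ae_restrict_iff' hS.compl).1 h1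
  have hμN : μ = N.withDensity fun x => a x / b x := by
    rw [hN, ← withDensity_mul B hb hab, hμ]
    refine withDensity_congr_ae ?_
    filter_upwards [h0] with x hx
    by_cases hbx : b x ≠ 0 ∧ b x ≠ ⊤
    · rw [Pi.mul_apply, ENNReal.mul_div_cancel hbx.1 hbx.2]
    · rw [Pi.mul_apply, hx hbx, ENNReal.zero_div, mul_zero]
  have hac : μ ≪ N := by
    rw [hμN]
    exact withDensity_absolutelyContinuous _ _
  refine ⟨hac, hac.ae_le ?_⟩
  have := Measure.rnDeriv_withDensity N hab
  rwa [← hμN] at this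

end Densities

/-! ### Disintegration of path measures along the bridge kernel -/

section Path

variable {d : ℕ} {β : ℝ}

lemma integral_bind_bridge (hex : BridgeExists d β) (q : Measure (Space d × Space d))
    [IsProbabilityMeasure q] {F : Path d β → ℝ} (hF : Integrable F (q.bind (bridgeKernel d β))) :
    ∫ ω, F ω ∂(q.bind (bridgeKernel d β)) = ∫ z, ∫ ω, F ω ∂(bridge β z.1 z.2) ∂q := by
  have := isMarkovKernel_bridgeKernel hex
  have h := Kernel.integral_comp (η := bridgeKernel d β) (κ := Kernel.const Unit q) (a := ())
    (f := F) (by rwa [Kernel.comp_apply, Kernel.const_apply])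
  rwa [Kernel.comp_apply, Kernel.const_apply] at h

/-- Under the bridge for the pair `z` the endpoints equal `z` almost surely, so a function of the
endpoints leaves the inner integral. -/
lemma lintegral_bind_mul_endpoints [Fact (0 < β)] (hex : BridgeExists d β) (ν : Measure (Space d × Space d))
    {p : Space d × Space d → ℝ≥0∞} (hp : Measurable p) {v : Path d β → ℝ≥0∞} (hv : Measurable v) :
    ∫⁻ ω, p (endpoints ω) * v ω ∂(ν.bind (bridgeKernel d β)) =
      ∫⁻ z, p z * ∫⁻ ω, v ω ∂(bridge β z.1 z.2) ∂ν := by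
  have hpv : Measurable fun ω : Path d β => p (endpoints ω) * v ω :=
    (hp.comp measurable_endpoints).mul hv
  rw [Measure.lintegral_bind (bridgeKernel d β).measurable.aemeasurable hpv.aemeasurable]
  refine lintegral_congr fun z => ?_
  rw [← lintegral_const_mul _ hv]
  refine lintegral_congr_ae ?_
  filter_upwards [ae_endpoints_eq hex z] with ω hω
  rw [hω]

lemma bind_withDensity [Fact (0 < β)] (hex : BridgeExists d β) (ν : Measure (Space d × Space d))
    {p : Space d × Space d → ℝ≥0∞} (hp : Measurable p) :
    (ν.withDensity p).bind (bridgeKernel d β) =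
      (ν.bind (bridgeKernel d β)).withDensity fun ω => p (endpoints ω) := by
  ext s hs
  rw [Measure.bind_apply hs (bridgeKernel d β).measurable.aemeasurable,
    lintegral_withDensity_eq_lintegral_mul _ hp ((bridgeKernel d β).measurable_coe hs),
    withDensity_apply _ hs, ← lintegral_indicator hs]
  have h := lintegral_bind_mul_endpoints hex ν hp (v := s.indicator 1) (measurable_one.indicator hs)
  have h2 : ∀ z : Space d × Space d, ∫⁻ ω, s.indicator 1 ω ∂(bridge β z.1 z.2) =
      bridgeKernel d β z s := fun z => by rw [lintegral_indicator_one hs]; rfl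
  simp only [h2] at h
  rw [Pi.mul_def, ← h]
  refine lintegral_congr fun ω => ?_
  by_cases hω : ω ∈ s <;> simp [hω]

lemma map_endpoints_withDensity [Fact (0 < β)] (hex : BridgeExists d β) (ν : Measure (Space d × Space d))
    {p : Space d × Space d → ℝ≥0∞} (hp : Measurable p) {v : Path d β → ℝ≥0∞} (hv : Measurable v) :
    ((ν.bind (bridgeKernel d β)).withDensity fun ω => p (endpoints ω) * v ω).map endpoints =
      ν.withDensity fun z => p z * ∫⁻ ω, v ω ∂(bridge β z.1 z.2) := by
  ext s hs
  rw [Measure.map_apply measurable_endpoints hs, withDensity_apply _ (measurable_endpoints hs),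
    withDensity_apply _ hs, ← lintegral_indicator hs, ← lintegral_indicator (measurable_endpoints hs)]
  have h := lintegral_bind_mul_endpoints hex ν (p := s.indicator p) (hp.indicator hs) hv
  refine Eq.trans (lintegral_congr fun ω => ?_) (h.trans (lintegral_congr fun z => ?_))
  · by_cases hω : endpoints ω ∈ s
    · rw [Set.indicator_of_mem (by exact hω), Set.indicator_of_mem hω]
    · rw [Set.indicator_of_notMem (by exact hω), Set.indicator_of_notMem hω, zero_mul]
  · by_cases hz : z ∈ s <;> simp [hz]

lemma isProbabilityMeasure_bind (hex : BridgeExists d β) (q : Measure (Space d × Space d))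
    [IsProbabilityMeasure q] : IsProbabilityMeasure (q.bind (bridgeKernel d β)) := by
  have := isMarkovKernel_bridgeKernel hex
  infer_instance

/-! ### The rate of a pair law -/

lemma le_toReal_of_pairRate_ne_top {q : Measure (Space d × Space d)} {μ : Measure (Path d β)}
    (h : pairRate q μ ≠ ⊤) (F : Path d β →ᵇ ℝ) :
    (∫ ω, F ω ∂μ) - ∫ z, Real.log (∫ ω, Real.exp (F ω) ∂(bridge β z.1 z.2)) ∂q ≤
      (pairRate q μ).toReal := by
  have h1 := le_iSup (fun F : Path d β →ᵇ ℝ => (((∫ ω, F ω ∂μ) -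
      ∫ z, Real.log (∫ ω, Real.exp (F ω) ∂(bridge β z.1 z.2)) ∂q : ℝ) : EReal)) F
  have hbot : pairRate q μ ≠ ⊥ := fun hb =>
    EReal.coe_ne_bot _ (le_bot_iff.1 (h1.trans (le_of_eq hb)))
  have h2 : (((∫ ω, F ω ∂μ) -
      ∫ z, Real.log (∫ ω, Real.exp (F ω) ∂(bridge β z.1 z.2)) ∂q : ℝ) : EReal) ≤
      ((pairRate q μ).toReal : EReal) := by
    rw [EReal.coe_toReal h hbot]
    exact h1
  exact EReal.coe_le_coe_iff.1 h2

lemma coe_toReal_pairRate {q : Measure (Space d × Space d)} {μ : Measure (Path d β)}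
    (h : pairRate q μ ≠ ⊤) : ((pairRate q μ).toReal : EReal) = pairRate q μ := by
  refine EReal.coe_toReal h fun hb => ?_
  have h1 := le_iSup (fun F : Path d β →ᵇ ℝ => (((∫ ω, F ω ∂μ) -
      ∫ z, Real.log (∫ ω, Real.exp (F ω) ∂(bridge β z.1 z.2)) ∂q : ℝ) : EReal)) 0
  exact EReal.coe_ne_bot _ (le_bot_iff.1 (h1.trans (le_of_eq hb)))

/-- For `F = c f(ω(0), ω(β))` the logarithmic moment is `c f(z)`, so the functional is linear in
`c`. A finite supremum forces its slope, the difference of the integrals of `f`, to vanish. -/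
lemma endpointLaw_eq_of_pairRate_ne_top [Fact (0 < β)] (hex : BridgeExists d β) {q : Measure (Space d × Space d)}
    {μ : Measure (Path d β)} [IsProbabilityMeasure q] [IsProbabilityMeasure μ]
    (h : pairRate q μ ≠ ⊤) : endpointLaw μ = q := by
  have hprob : IsProbabilityMeasure (endpointLaw μ) :=
    Measure.isProbabilityMeasure_map measurable_endpoints.aemeasurable
  have hmk := isMarkovKernel_bridgeKernel hex
  refine ext_of_forall_integral_eq_of_IsFiniteMeasure fun f => ?_
  have key : ∀ c : ℝ, c * (∫ z, f z ∂(endpointLaw μ) - ∫ z, f z ∂q) ≤ (pairRate q μ).toReal := by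
    intro c
    have h1 := le_toReal_of_pairRate_ne_top h
      ((c • f).compContinuous ⟨endpoints, continuous_endpoints⟩)
    have h2 : ∀ z : Space d × Space d, ∫ ω, Real.exp (((c • f).compContinuous
        ⟨endpoints, continuous_endpoints⟩) ω) ∂(bridge β z.1 z.2) = Real.exp (c * f z) := by
      intro z
      have : ∀ᵐ ω ∂(bridge β z.1 z.2), Real.exp (((c • f).compContinuous
          ⟨endpoints, continuous_endpoints⟩) ω) = Real.exp (c * f z) := by
        filter_upwards [ae_endpoints_eq hex z] with ω hω
        simp [hω]
      have hpz : IsProbabilityMeasure (bridge β z.1 z.2) := hmk.isProbabilityMeasure z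
      rw [integral_congr_ae this]
      simp
    simp only [h2, Real.log_exp] at h1
    have h3 : ∫ ω, ((c • f).compContinuous ⟨endpoints, continuous_endpoints⟩) ω ∂μ =
        c * ∫ z, f z ∂(endpointLaw μ) := by
      rw [endpointLaw, integral_map measurable_endpoints.aemeasurable
        f.continuous.aestronglyMeasurable, ← integral_const_mul]
      rfl
    rw [h3, integral_const_mul] at h1
    linarith
  by_contra hne
  have hD : (∫ z, f z ∂(endpointLaw μ) - ∫ z, f z ∂q) ≠ 0 := sub_ne_zero.2 hne
  -- This multiple turns the bound into `C + 1 ≤ C`.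
  have := key (((pairRate q μ).toReal + 1) / (∫ z, f z ∂(endpointLaw μ) - ∫ z, f z ∂q))
  rw [div_mul_cancel₀ _ hD] at this
  linarith

section LogMoment

variable {F : Path d β → ℝ} {M : ℝ}

lemma integrable_exp_of_bounded {P : Measure (Path d β)} [IsFiniteMeasure P] (hF : Measurable F)
    (hM : ∀ ω, |F ω| ≤ M) : Integrable (fun ω => Real.exp (F ω)) P :=
  Integrable.of_bound (by fun_prop) (Real.exp M) (ae_of_all _ fun x => by
    rw [Real.norm_eq_abs, Real.abs_exp]
    exact Real.exp_le_exp.2 ((le_abs_self _).trans (hM x)))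

lemma expMoment_mem_Icc {P : Measure (Path d β)} [IsProbabilityMeasure P] (hF : Measurable F)
    (hM : ∀ ω, |F ω| ≤ M) : ∫ ω, Real.exp (F ω) ∂P ∈ Set.Icc (Real.exp (-M)) (Real.exp M) := by
  have hi : Integrable (fun ω => Real.exp (F ω)) P := integrable_exp_of_bounded hF hM
  constructor
  · have h := integral_mono (integrable_const (Real.exp (-M))) hi fun ω =>
      Real.exp_le_exp.2 (abs_le.1 (hM ω)).1
    simpa using h
  · have h := integral_mono hi (integrable_const (Real.exp M)) fun ω =>
      Real.exp_le_exp.2 (abs_le.1 (hM ω)).2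
    simpa using h

lemma measurable_expMoment (hex : BridgeExists d β) (hF : Measurable F) :
    Measurable fun z : Space d × Space d => ∫ ω, Real.exp (F ω) ∂(bridge β z.1 z.2) := by
  have := isMarkovKernel_bridgeKernel hex
  have h : StronglyMeasurable fun ω => Real.exp (F ω) := (hF.exp).stronglyMeasurable
  exact (h.integral_kernel (κ := bridgeKernel d β)).measurable

lemma abs_log_expMoment_le (hex : BridgeExists d β) (hF : Measurable F) (hM : ∀ ω, |F ω| ≤ M)
    (z : Space d × Space d) :
    |Real.log (∫ ω, Real.exp (F ω) ∂(bridge β z.1 z.2))| ≤ M := by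
  have := (isMarkovKernel_bridgeKernel hex).isProbabilityMeasure z
  rw [bridgeKernel_apply] at this
  have h := expMoment_mem_Icc (P := bridge β z.1 z.2) hF hM
  have hpos := (Real.exp_pos _).trans_le h.1
  rw [abs_le]
  exact ⟨(Real.le_log_iff_exp_le hpos).2 h.1, (Real.log_le_iff_le_exp hpos).2 h.2⟩

lemma integrable_log_expMoment (hex : BridgeExists d β) (q : Measure (Space d × Space d))
    [IsFiniteMeasure q] (hF : Measurable F) (hM : ∀ ω, |F ω| ≤ M) :
    Integrable (fun z : Space d × Space d =>
      Real.log (∫ ω, Real.exp (F ω) ∂(bridge β z.1 z.2))) q :=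
  Integrable.of_bound (measurable_expMoment hex hF).log.aestronglyMeasurable M
    (ae_of_all _ fun z => abs_log_expMoment_le hex hF hM z)

lemma integral_log_le_log_integral {X : Type*} [MeasurableSpace X] {q : Measure X}
    [IsProbabilityMeasure q] {h : X → ℝ} (hpos : ∀ x, 0 < h x) (hi : Integrable h q)
    (hli : Integrable (fun x => Real.log (h x)) q) :
    ∫ x, Real.log (h x) ∂q ≤ Real.log (∫ x, h x ∂q) := by
  have hA : 0 < ∫ x, h x ∂q := by
    rw [integral_pos_iff_support_of_nonneg (fun x => (hpos x).le) hi]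
    have : Function.support h = Set.univ := by
      ext x; simp [(hpos x).ne']
    rw [this]; simp
  set A := ∫ x, h x ∂q with hAdef
  have h1 : ∀ x, Real.log (h x) ≤ Real.log A + (h x / A - 1) := by
    intro x
    have h2 := Real.log_le_sub_one_of_pos (div_pos (hpos x) hA)
    rw [Real.log_div (hpos x).ne' hA.ne'] at h2
    linarith
  have hi2 : Integrable (fun x => h x / A - 1) q := (hi.div_const A).sub (integrable_const 1)
  have h3 := integral_mono hli ((integrable_const (Real.log A)).add hi2) h1
  have h4 : ∫ x, (Real.log A + (h x / A - 1)) ∂q = Real.log A := by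
    rw [integral_add (integrable_const _) hi2,
      integral_sub (hi.div_const A) (integrable_const 1), integral_div, ← hAdef, div_self hA.ne']
    simp
  exact h3.trans (le_of_eq h4)

end LogMoment

/-- By Jensen, averaging `log E_{x,y}[e^F]` over `q` gives at most the logarithm of the exponential
moment under the mixture. Hence `I^{(q)}` dominates the Donsker-Varadhan functional against that
mixture. -/
lemma integral_llr_le_pairRate (hex : BridgeExists d β) {q : Measure (Space d × Space d)}
    {μ : Measure (Path d β)} [IsProbabilityMeasure q] [IsProbabilityMeasure μ]
    (h : pairRate q μ ≠ ⊤) :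
    μ ≪ q.bind (bridgeKernel d β) ∧ Integrable (llr μ (q.bind (bridgeKernel d β))) μ ∧
      ((∫ ω, llr μ (q.bind (bridgeKernel d β)) ω ∂μ : ℝ) : EReal) ≤ pairRate q μ := by
  have hmk := isMarkovKernel_bridgeKernel hex
  have hP := isProbabilityMeasure_bind hex q
  have key := integral_llr_le_of_donskerVaradhan (μ := μ) (P := q.bind (bridgeKernel d β))
    (C := (pairRate q μ).toReal) fun F => by
      refine le_trans ?_ (le_toReal_of_pairRate_ne_top h F)
      have hM : ∀ ω, |F ω| ≤ ‖F‖ := fun ω => F.norm_coe_le_norm ω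
      have hFm : Measurable F := F.continuous.measurable
      rw [integral_bind_bridge hex q (integrable_exp_of_bounded hFm hM)]
      refine sub_le_sub_left (integral_log_le_log_integral (fun z => ?_) ?_
        (integrable_log_expMoment hex q hFm hM)) _
      · have := hmk.isProbabilityMeasure z
        rw [bridgeKernel_apply] at this
        exact integral_exp_pos (integrable_exp_of_bounded hFm hM)
      · refine Integrable.of_bound (measurable_expMoment hex hFm).aestronglyMeasurable
          (Real.exp ‖F‖) (ae_of_all _ fun z => ?_)
        have := hmk.isProbabilityMeasure z
        rw [bridgeKernel_apply] at this
        have h2 := expMoment_mem_Icc (P := bridge β z.1 z.2) hFm hM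
        rw [Real.norm_eq_abs, abs_of_pos ((Real.exp_pos _).trans_le h2.1)]
        exact h2.2
  refine ⟨key.1, key.2.1, ?_⟩
  rw [← coe_toReal_pairRate h]
  exact EReal.coe_le_coe_iff.2 key.2.2

/-- The Jensen loss can be avoided: subtracting `log E_{x,y}[e^F]`, read at the endpoints,
normalizes `F` under every single bridge. The corrected function has exponential moment `1` under
the mixture, and the Gibbs inequality applies to it. -/
lemma pairRate_le_integral_llr [Fact (0 < β)] (hex : BridgeExists d β) {μ : Measure (Path d β)}
    [IsProbabilityMeasure μ] (hac : μ ≪ (endpointLaw μ).bind (bridgeKernel d β))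
    (hint : Integrable (llr μ ((endpointLaw μ).bind (bridgeKernel d β))) μ) :
    pairRate (endpointLaw μ) μ ≤
      ((∫ ω, llr μ ((endpointLaw μ).bind (bridgeKernel d β)) ω ∂μ : ℝ) : EReal) := by
  have hmk := isMarkovKernel_bridgeKernel hex
  have hprob : IsProbabilityMeasure (endpointLaw μ) :=
    Measure.isProbabilityMeasure_map measurable_endpoints.aemeasurable
  have hP := isProbabilityMeasure_bind hex (endpointLaw μ)
  refine iSup_le fun F => EReal.coe_le_coe_iff.2 ?_
  have hM : ∀ ω, |F ω| ≤ ‖F‖ := fun ω => F.norm_coe_le_norm ω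
  have hFm : Measurable F := F.continuous.measurable
  set Z : Space d × Space d → ℝ := fun z => ∫ ω, Real.exp (F ω) ∂(bridge β z.1 z.2) with hZ
  have hZm : Measurable Z := measurable_expMoment hex hFm
  have hZlog : ∀ z, |Real.log (Z z)| ≤ ‖F‖ := abs_log_expMoment_le hex hFm hM
  have hZpos : ∀ z, 0 < Z z := fun z => by
    have := hmk.isProbabilityMeasure z
    rw [bridgeKernel_apply] at this
    exact integral_exp_pos (integrable_exp_of_bounded hFm hM)
  set G : Path d β → ℝ := fun ω => F ω - Real.log (Z (endpoints ω)) with hG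
  have hGm : Measurable G := hFm.sub (hZm.comp measurable_endpoints).log
  have hGM : ∀ ω, |G ω| ≤ ‖F‖ + ‖F‖ := fun ω =>
    (abs_sub _ _).trans (add_le_add (hM ω) (hZlog _))
  have hexp : ∫ ω, Real.exp (G ω) ∂((endpointLaw μ).bind (bridgeKernel d β)) ≤ 1 := by
    rw [integral_bind_bridge hex _ (integrable_exp_of_bounded hGm hGM)]
    have h1 : ∀ z : Space d × Space d, ∫ ω, Real.exp (G ω) ∂(bridge β z.1 z.2) = 1 := by
      intro z
      have h2 : ∀ᵐ ω ∂(bridge β z.1 z.2), Real.exp (G ω) = Real.exp (F ω) / Z z := by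
        filter_upwards [ae_endpoints_eq hex z] with ω hω
        rw [hG]
        simp only
        rw [hω, Real.exp_sub, Real.exp_log (hZpos z)]
      rw [integral_congr_ae h2, integral_div]
      exact div_self (hZpos z).ne'
    simp [h1]
  refine le_trans (le_of_eq ?_) (integral_le_integral_llr hac hint hGm hGM hexp)
  have hi1 : Integrable F μ := F.integrable μ
  have hi2 : Integrable (fun ω => Real.log (Z (endpoints ω))) μ :=
    Integrable.of_bound (hZm.comp measurable_endpoints).log.aestronglyMeasurable ‖F‖
      (ae_of_all _ fun ω => hZlog _)
  rw [hG, integral_sub hi1 hi2, endpointLaw, integral_map measurable_endpoints.aemeasurable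
    hZm.log.aestronglyMeasurable]

/-- The infimum in the definition of the symmetrised rate is attained at the endpoint law. -/
lemma symRate_eq [Fact (0 < β)] (hex : BridgeExists d β) (m : Measure (Space d)) {μ : Measure (Path d β)}
    [IsProbabilityMeasure μ] (hμ : (endpointLaw μ).fst = (endpointLaw μ).snd) :
    symRate m μ = addTop (relEntropy (endpointLaw μ) ((endpointLaw μ).fst.prod m))
      (pairRate (endpointLaw μ) μ) := by
  have hprob : IsProbabilityMeasure (endpointLaw μ) :=
    Measure.isProbabilityMeasure_map measurable_endpoints.aemeasurable
  refine le_antisymm (iInf_le_of_le _ (iInf_le_of_le hprob (iInf_le _ hμ))) ?_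
  refine le_iInf fun q => le_iInf fun hq => le_iInf fun hqs => ?_
  by_cases h : pairRate q μ = ⊤
  · rw [h, addTop_top_right]
    exact le_top
  · rw [endpointLaw_eq_of_pairRate_ne_top hex h]

lemma marginals_eq_of_symRate_ne_top [Fact (0 < β)] (hex : BridgeExists d β) {m : Measure (Space d)}
    {μ : Measure (Path d β)} [IsProbabilityMeasure μ] (h : symRate m μ ≠ ⊤) :
    (endpointLaw μ).fst = (endpointLaw μ).snd := by
  by_contra hne
  apply h
  refine iInf_eq_top.2 fun q => iInf_eq_top.2 fun hq => iInf_eq_top.2 fun hqs => ?_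
  have : pairRate q μ = ⊤ := by
    by_contra hne'
    rw [← endpointLaw_eq_of_pairRate_ne_top hex hne'] at hqs
    exact hne hqs
  rw [this, addTop_top_right]

end Path

section NegIntTransfer

variable {X Y : Type*} [MeasurableSpace X] [MeasurableSpace Y] {q : Measure X}

lemma negInt_map_iff {e : X → Y} (he : Measurable e) {f : Y → ℝ} (hf : Measurable f) :
    NegInt (q.map e) f ↔ NegInt q fun x => f (e x) := by
  rw [NegInt, NegInt, lintegral_map (by fun_prop) he]

/-- The negative part of `-f = g - (f + g)` is controlled by that of `g` and by the integrable sum.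
This splits the integral of a total log-density into its separate contributions. -/
lemma integrable_of_negInt_add {f g : X → ℝ} (hf : AEMeasurable f q) (hg : AEMeasurable g q)
    (hfn : NegInt q f) (hgn : NegInt q g) (h : Integrable (fun x => f x + g x) q) :
    Integrable f q ∧ Integrable g q := by
  have hf' : NegInt q fun x => -f x := by
    refine (hgn.add h.neg.negInt hg).mono (ae_of_all _ fun x => ?_)
    simp
  have hfi := integrable_of_negInt hf hfn hf'
  refine ⟨hfi, (h.sub hfi).congr (ae_of_all _ fun x => ?_)⟩
  simp

end NegIntTransfer

/-! ### The kernel of the operator and its mixtures of bridges -/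

variable {d : ℕ} {β : ℝ}

/-- The standing assumptions on the potential and the weight. -/
structure IsModel (β : ℝ) (W : Space d → ℝ≥0∞) (g : Space d → Space d → ℝ) : Prop where
  bridgeExists : BridgeExists d β
  measurable_W : Measurable W
  measurable_g : Measurable (Function.uncurry g)
  g_pos : ∀ x y, 0 < g x y
  g_symm : ∀ x y, g x y = g y x
  g_bdd : ∃ C : ℝ, ∀ x y, g x y ≤ C

/-- The kernel `g(x, y) E_{x,y}[e^{-W̃}]`. -/
def kern (β : ℝ) (W : Space d → ℝ≥0∞) (g : Space d → Space d → ℝ) (z : Space d × Space d) :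
    ℝ≥0∞ :=
  ENNReal.ofReal (g z.1 z.2) * bridgeWeight β W z.1 z.2

/-- The integral operator on nonnegative functions. -/
def opE (β : ℝ) (m : Measure (Space d)) (W : Space d → ℝ≥0∞) (g : Space d → Space d → ℝ)
    (f : Space d → ℝ≥0∞) (x : Space d) : ℝ≥0∞ :=
  ∫⁻ y, f y * kern β W g (x, y) ∂m

/-- The quadratic form of the integral operator. -/
def form (β : ℝ) (m : Measure (Space d)) (W : Space d → ℝ≥0∞) (g : Space d → Space d → ℝ)
    (f : Space d → ℝ≥0∞) : ℝ≥0∞ :=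
  ∫⁻ x, f x * opE β m W g f x ∂m

/-- The mixture of weighted bridges with weight `f(x) f(y) g(x, y) / c`. -/
def mix (β : ℝ) [Fact (0 < β)] (m : Measure (Space d)) (W : Space d → ℝ≥0∞)
    (g : Space d → Space d → ℝ) (c : ℝ≥0∞) (f : Space d → ℝ≥0∞) : Measure (Path d β) :=
  ((m.prod m).bind (bridgeKernel d β)).withDensity fun ω =>
    c⁻¹ * (f (endpoints ω).1 * f (endpoints ω).2) *
      ENNReal.ofReal (g (endpoints ω).1 (endpoints ω).2) * weight W ω

variable {m : Measure (Space d)} {W : Space d → ℝ≥0∞} {g : Space d → Space d → ℝ}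
  {f : Space d → ℝ≥0∞}

namespace IsModel

lemma measurable_ofReal_g (hM : IsModel β W g) :
    Measurable fun z : Space d × Space d => ENNReal.ofReal (g z.1 z.2) :=
  hM.measurable_g.ennreal_ofReal

lemma measurable_kern (hM : IsModel β W g) : Measurable (kern β W g) :=
  hM.measurable_ofReal_g.mul (measurable_bridgeWeight hM.measurable_W)

lemma measurable_opE (hM : IsModel β W g) [SFinite m] (hf : Measurable f) :
    Measurable (opE β m W g f) := by
  have h : Measurable fun z : Space d × Space d => f z.2 * kern β W g z :=
    (hf.comp measurable_snd).mul hM.measurable_kern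
  exact h.lintegral_prod_right'

lemma kern_swap [Fact (0 < β)] (hM : IsModel β W g) (x y : Space d) :
    kern β W g (x, y) = kern β W g (y, x) := by
  simp only [kern]
  rw [hM.g_symm, bridgeWeight_symm hM.measurable_W]

lemma kern_ne_top (hM : IsModel β W g) (z : Space d × Space d) : kern β W g z ≠ ⊤ :=
  ENNReal.mul_ne_top ENNReal.ofReal_ne_top
    (ne_top_of_le_ne_top ENNReal.one_ne_top (bridgeWeight_le_one hM.bridgeExists W z.1 z.2))

lemma kern_ne_zero_iff (hM : IsModel β W g) (z : Space d × Space d) :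
    kern β W g z ≠ 0 ↔ bridgeWeight β W z.1 z.2 ≠ 0 := by
  have : ENNReal.ofReal (g z.1 z.2) ≠ 0 := by simp [hM.g_pos]
  simp [kern, this]

lemma toReal_kern (hM : IsModel β W g) (x y : Space d) :
    (kern β W g (x, y)).toReal = (bridgeWeight β W x y).toReal * g x y := by
  rw [kern, ENNReal.toReal_mul, ENNReal.toReal_ofReal (hM.g_pos _ _).le, mul_comm]

lemma measurable_pair_density (hM : IsModel β W g) (hf : Measurable f) (c : ℝ≥0∞) :
    Measurable fun z : Space d × Space d => c⁻¹ * (f z.1 * f z.2) * kern β W g z :=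
  (((hf.comp measurable_fst).mul (hf.comp measurable_snd)).const_mul _).mul hM.measurable_kern

lemma negInt_neg_log_g (hM : IsModel β W g) (q : Measure (Space d × Space d))
    [IsFiniteMeasure q] : NegInt q fun z => -Real.log (g z.1 z.2) := by
  obtain ⟨C, hC⟩ := hM.g_bdd
  refine (negInt_const (-Real.log C)).mono (ae_of_all _ fun z => ?_)
  exact neg_le_neg (Real.log_le_log (hM.g_pos _ _) (hC _ _))

lemma measurable_log_g (hM : IsModel β W g) :
    Measurable fun z : Space d × Space d => -Real.log (g z.1 z.2) :=
  (Real.measurable_log.comp hM.measurable_g).neg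

section Mixture

variable [hβ : Fact (0 < β)] {c : ℝ≥0∞}

lemma endpointLaw_mix (hM : IsModel β W g) [SFinite m] (hf : Measurable f) :
    endpointLaw (mix β m W g c f) =
      (m.prod m).withDensity fun z => c⁻¹ * (f z.1 * f z.2) * kern β W g z := by
  have hp : Measurable fun z : Space d × Space d =>
      c⁻¹ * (f z.1 * f z.2) * ENNReal.ofReal (g z.1 z.2) :=
    (((hf.comp measurable_fst).mul (hf.comp measurable_snd)).const_mul _).mul
      hM.measurable_ofReal_g
  have h := map_endpoints_withDensity hM.bridgeExists (m.prod m) hp (measurable_weight hM.measurable_W)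
  refine h.trans ?_
  congr 1
  funext z
  rw [kern, mul_assoc]
  rfl

lemma measurable_mix_density (hM : IsModel β W g) (hf : Measurable f) (c : ℝ≥0∞) :
    Measurable fun ω : Path d β => c⁻¹ * (f (endpoints ω).1 * f (endpoints ω).2) *
      ENNReal.ofReal (g (endpoints ω).1 (endpoints ω).2) * weight W ω := by
  have hp : Measurable fun z : Space d × Space d =>
      c⁻¹ * (f z.1 * f z.2) * ENNReal.ofReal (g z.1 z.2) :=
    (((hf.comp measurable_fst).mul (hf.comp measurable_snd)).const_mul _).mul
      hM.measurable_ofReal_g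
  exact (hp.comp measurable_endpoints).mul (measurable_weight hM.measurable_W)

lemma fst_endpointLaw_mix (hM : IsModel β W g) [SFinite m] (hf : Measurable f) :
    (endpointLaw (mix β m W g c f)).fst =
      m.withDensity fun x => c⁻¹ * (f x * opE β m W g f x) := by
  rw [hM.endpointLaw_mix hf]
  have hd := hM.measurable_pair_density hf c
  have hop := hM.measurable_opE (m := m) hf
  refine Measure.ext_of_lintegral _ fun φ hφ => ?_
  have hφ1 : Measurable fun z : Space d × Space d => φ z.1 := hφ.comp measurable_fst
  rw [Measure.fst, lintegral_map hφ measurable_fst,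
    lintegral_withDensity_eq_lintegral_mul _ hd hφ1,
    lintegral_withDensity_eq_lintegral_mul _ (by fun_prop) hφ,
    lintegral_prod _ (hd.mul hφ1).aemeasurable]
  refine lintegral_congr fun x => ?_
  have hk : Measurable fun y => f y * kern β W g (x, y) :=
    hf.mul (hM.measurable_kern.comp measurable_prodMk_left)
  simp only [Pi.mul_apply]
  rw [opE, ← lintegral_const_mul _ hk, ← lintegral_const_mul _ (hk.const_mul _),
    ← lintegral_mul_const _ ((hk.const_mul _).const_mul _)]
  refine lintegral_congr fun y => ?_
  ring

lemma fst_eq_snd_endpointLaw_mix (hM : IsModel β W g) [SFinite m] (hf : Measurable f) :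
    (endpointLaw (mix β m W g c f)).fst = (endpointLaw (mix β m W g c f)).snd := by
  rw [hM.endpointLaw_mix hf]
  have hd := hM.measurable_pair_density hf c
  refine Measure.ext_of_lintegral _ fun φ hφ => ?_
  have hφ1 : Measurable fun z : Space d × Space d => φ z.1 := hφ.comp measurable_fst
  have hφ2 : Measurable fun z : Space d × Space d => φ z.2 := hφ.comp measurable_snd
  rw [Measure.fst, Measure.snd, lintegral_map hφ measurable_fst, lintegral_map hφ measurable_snd,
    lintegral_withDensity_eq_lintegral_mul _ hd hφ1,
    lintegral_withDensity_eq_lintegral_mul _ hd hφ2,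
    lintegral_prod _ (hd.mul hφ1).aemeasurable, lintegral_prod_symm _ (hd.mul hφ2).aemeasurable]
  refine lintegral_congr fun x => lintegral_congr fun y => ?_
  simp only [Pi.mul_apply]
  rw [hM.kern_swap x y]
  ring

/-- Taking `c` to be the quadratic form of `f` therefore normalizes the mixture. -/
lemma mix_univ (hM : IsModel β W g) [SFinite m] (hf : Measurable f) :
    mix β m W g c f Set.univ = c⁻¹ * form β m W g f := by
  have h1 : mix β m W g c f Set.univ = (endpointLaw (mix β m W g c f)).fst Set.univ := by
    rw [Measure.fst_univ, endpointLaw, Measure.map_apply measurable_endpoints MeasurableSet.univ,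
      Set.preimage_univ]
  rw [h1, hM.fst_endpointLaw_mix hf, withDensity_apply _ MeasurableSet.univ, setLIntegral_univ,
    lintegral_const_mul _ (show Measurable fun x => f x * opE β m W g f x from
      hf.mul (hM.measurable_opE hf))]
  rfl

lemma isProbabilityMeasure_mix (hM : IsModel β W g) [SFinite m] (hf : Measurable f)
    (h0 : form β m W g f ≠ 0) (htop : form β m W g f ≠ ⊤) :
    IsProbabilityMeasure (mix β m W g (form β m W g f) f) :=
  ⟨by rw [hM.mix_univ hf, ENNReal.inv_mul_cancel h0 htop]⟩

end Mixture

end IsModel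

lemma ae_endpoints [Fact (0 < β)] {μ : Measure (Path d β)} {p : Space d × Space d → Prop}
    (h : ∀ᵐ z ∂(endpointLaw μ), p z) : ∀ᵐ ω ∂μ, p (endpoints ω) :=
  ae_of_ae_map measurable_endpoints.aemeasurable h

lemma isProbabilityMeasure_endpointLaw [Fact (0 < β)] (μ : Measure (Path d β))
    [IsProbabilityMeasure μ] : IsProbabilityMeasure (endpointLaw μ) :=
  Measure.isProbabilityMeasure_map measurable_endpoints.aemeasurable

lemma toReal_weight {ω : Path d β} (h : action W ω ≠ ⊤) :
    (weight W ω).toReal = Real.exp (-(action W ω).toReal) := by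
  rw [weight_eq W ω h, ENNReal.toReal_ofReal (Real.exp_pos _).le]

/-- The modified rate of a measure whose terms are all finite. -/
lemma modifiedRate_eq_coe_add [Fact (0 < β)] (hex : BridgeExists d β) {μ : Measure (Path d β)}
    [IsProbabilityMeasure μ] (hμ : (endpointLaw μ).fst = (endpointLaw μ).snd)
    (hac : endpointLaw μ ≪ (endpointLaw μ).fst.prod m)
    (h1 : Integrable (llr (endpointLaw μ) ((endpointLaw μ).fst.prod m)) (endpointLaw μ))
    (hact : ∫⁻ ω, action W ω ∂μ ≠ ⊤)
    (h4 : Integrable (fun z => -Real.log (g z.1 z.2)) (endpointLaw μ)) :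
    modifiedRate m W g μ = addTop (addTop (addTop
      ((∫ z, llr (endpointLaw μ) ((endpointLaw μ).fst.prod m) z ∂(endpointLaw μ) : ℝ) : EReal)
      (pairRate (endpointLaw μ) μ)) (((∫⁻ ω, action W ω ∂μ).toReal : ℝ) : EReal))
      ((∫ z, -Real.log (g z.1 z.2) ∂(endpointLaw μ) : ℝ) : EReal) := by
  rw [modifiedRate, symRate_eq hex m hμ, relEntropy, if_pos hac, extIntegral_of_integrable h1,
    extIntegral_of_integrable h4, EReal.coe_ennreal_toReal hact]

/-! ### Lower bound: comparison of a path measure with a mixture of bridges -/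

section LowerBound

variable [hβ : Fact (0 < β)]

/-- The product measure controls the second marginal through `m`, and the second marginal is the
first. -/
lemma fst_absolutelyContinuous {q : Measure (Space d × Space d)} [IsProbabilityMeasure q]
    [SFinite m] (hq : q.fst = q.snd) (h : q ≪ q.fst.prod m) : q.fst ≪ m := by
  refine Measure.AbsolutelyContinuous.mk fun s hs hms => ?_
  rw [hq, Measure.snd_apply hs]
  refine h ?_
  have : (Prod.snd ⁻¹' s : Set (Space d × Space d)) = Set.univ ×ˢ s := by
    ext z; simp
  rw [this, Measure.prod_prod, hms, mul_zero]

lemma sqrt_mul_sqrt (a : ℝ≥0∞) : a ^ (1 / 2 : ℝ) * a ^ (1 / 2 : ℝ) = a := by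
  rw [← ENNReal.rpow_add_of_nonneg _ _ (by norm_num) (by norm_num)]
  norm_num

/-- The chain rule for the log-density of a path measure with respect to a mixture of bridges. -/
lemma llr_mix (hM : IsModel β W g) [SigmaFinite m] {μ : Measure (Path d β)}
    [IsProbabilityMeasure μ] (hμ : (endpointLaw μ).fst = (endpointLaw μ).snd)
    (hac : endpointLaw μ ≪ (endpointLaw μ).fst.prod m)
    (hacP : μ ≪ (endpointLaw μ).bind (bridgeKernel d β)) (hact : ∀ᵐ ω ∂μ, action W ω ≠ ⊤)
    {c : ℝ≥0∞} (hc0 : c ≠ 0) (hctop : c ≠ ⊤)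
    (hfin : form β m W g (fun x => ((endpointLaw μ).fst.rnDeriv m x) ^ (1 / 2 : ℝ)) ≠ ⊤) :
    μ ≪ mix β m W g c (fun x => ((endpointLaw μ).fst.rnDeriv m x) ^ (1 / 2 : ℝ)) ∧
    ∀ᵐ ω ∂μ, llr μ (mix β m W g c (fun x => ((endpointLaw μ).fst.rnDeriv m x) ^ (1 / 2 : ℝ))) ω =
      llr (endpointLaw μ) ((endpointLaw μ).fst.prod m) (endpoints ω) +
        (llr μ ((endpointLaw μ).bind (bridgeKernel d β)) ω + ((action W ω).toReal +
        (-Real.log (g (endpoints ω).1 (endpoints ω).2) + (Real.log c.toReal +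
          (1 / 2) * (Real.log ((endpointLaw μ).fst.rnDeriv m (endpoints ω).1).toReal -
            Real.log ((endpointLaw μ).fst.rnDeriv m (endpoints ω).2).toReal))))) := by
  have hex := hM.bridgeExists
  have hqp := isProbabilityMeasure_endpointLaw μ
  set q := endpointLaw μ with hq
  have hP := isProbabilityMeasure_bind hex q
  have hfm := fst_absolutelyContinuous hμ hac
  set r := q.fst.rnDeriv m with hr
  have hrm : Measurable r := Measure.measurable_rnDeriv _ _
  set p := q.rnDeriv (q.fst.prod m) with hp
  have hpm : Measurable p := Measure.measurable_rnDeriv _ _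
  set P := q.bind (bridgeKernel d β) with hPdef
  set ρ := μ.rnDeriv P with hρ
  have hρm : Measurable ρ := Measure.measurable_rnDeriv _ _
  set f : Space d → ℝ≥0∞ := fun x => r x ^ (1 / 2 : ℝ) with hf
  have hfmeas : Measurable f := hrm.pow_const _
  have e1 : m.withDensity r = q.fst := Measure.withDensity_rnDeriv_eq _ _ hfm
  -- Everything is expressed over one base, the `m ⊗ m`-mixture of bridges: there `μ` has density
  -- `r(x) p(x,y) ρ(ω)`, to be divided by the density of the mixture.
  have e2 : q = (m.prod m).withDensity fun z => r z.1 * p z := by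
    have h1 : (q.fst.prod m).withDensity p = q := Measure.withDensity_rnDeriv_eq _ _ hac
    have h2 : q.fst.prod m = (m.prod m).withDensity fun z => r z.1 := by
      conv_lhs => rw [← e1]
      exact prod_withDensity_left hrm
    rw [h2, ← withDensity_mul _ (show Measurable fun z : Space d × Space d => r z.1 from
      hrm.comp measurable_fst) hpm] at h1
    exact h1.symm
  have hrp : Measurable fun z : Space d × Space d => r z.1 * p z :=
    (hrm.comp measurable_fst).mul hpm
  have e3 : μ = ((m.prod m).bind (bridgeKernel d β)).withDensity fun ω =>
      (r (endpoints ω).1 * p (endpoints ω)) * ρ ω := by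
    have h1 : P.withDensity ρ = μ := Measure.withDensity_rnDeriv_eq _ _ hacP
    have h2 : P = ((m.prod m).bind (bridgeKernel d β)).withDensity fun ω =>
        r (endpoints ω).1 * p (endpoints ω) := by
      rw [hPdef]
      conv_lhs => rw [e2]
      exact bind_withDensity hex _ hrp
    rw [h2, ← withDensity_mul _ (show Measurable fun ω : Path d β =>
      r (endpoints ω).1 * p (endpoints ω) from hrp.comp measurable_endpoints) hρm] at h1
    exact h1.symm
  have hr1 : ∀ᵐ x ∂q.fst, 0 < r x ∧ r x < ⊤ :=
    (Measure.rnDeriv_pos hfm).and (hfm.ae_le (Measure.rnDeriv_lt_top q.fst m))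
  have hrz1 : ∀ᵐ z ∂q, 0 < r z.1 ∧ r z.1 < ⊤ := ae_of_ae_map measurable_fst.aemeasurable hr1
  have hrz2 : ∀ᵐ z ∂q, 0 < r z.2 ∧ r z.2 < ⊤ := by
    rw [hμ] at hr1
    exact ae_of_ae_map measurable_snd.aemeasurable hr1
  have hpz : ∀ᵐ z ∂q, 0 < p z ∧ p z < ⊤ :=
    (Measure.rnDeriv_pos hac).and (hac.ae_le (Measure.rnDeriv_lt_top q _))
  have hρω : ∀ᵐ ω ∂μ, 0 < ρ ω ∧ ρ ω < ⊤ :=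
    (Measure.rnDeriv_pos hacP).and (hacP.ae_le (Measure.rnDeriv_lt_top μ _))
  have hfinm : IsFiniteMeasure (mix β m W g c f) :=
    ⟨by
      rw [hM.mix_univ hfmeas]
      exact ENNReal.mul_lt_top (ENNReal.inv_lt_top.2 (pos_iff_ne_zero.2 hc0)) hfin.lt_top⟩
  have hall := ((ae_endpoints hrz1).and (ae_endpoints hrz2)).and
    (((ae_endpoints hpz).and hρω).and hact)
  have key := rnDeriv_of_withDensity (μ := μ) (N := mix β m W g c f)
    ((hrp.comp measurable_endpoints).mul hρm) (hM.measurable_mix_density hfmeas c) e3 rfl (by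
      filter_upwards [hall] with ω hω
      obtain ⟨⟨h1, h2⟩, ⟨h3, h4⟩, h5⟩ := hω
      have hw0 : weight W ω ≠ 0 := fun h => h5 (weight_eq_zero_iff.1 h)
      have hwt : weight W ω ≠ ⊤ := ne_top_of_le_ne_top ENNReal.one_ne_top (weight_le_one W ω)
      have hf0 : ∀ x, 0 < r x ∧ r x < ⊤ → f x ≠ 0 ∧ f x ≠ ⊤ := fun x hx =>
        ⟨(ENNReal.rpow_pos hx.1 hx.2.ne).ne', ENNReal.rpow_ne_top_of_nonneg (by norm_num) hx.2.ne⟩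
      have hg0 : ENNReal.ofReal (g (endpoints ω).1 (endpoints ω).2) ≠ 0 := by simp [hM.g_pos]
      constructor
      · exact mul_ne_zero (mul_ne_zero (mul_ne_zero (ENNReal.inv_ne_zero.2 hctop)
          (mul_ne_zero (hf0 _ h1).1 (hf0 _ h2).1)) hg0) hw0
      · exact ENNReal.mul_ne_top (ENNReal.mul_ne_top (ENNReal.mul_ne_top (ENNReal.inv_ne_top.2 hc0)
          (ENNReal.mul_ne_top (hf0 _ h1).2 (hf0 _ h2).2)) ENNReal.ofReal_ne_top) hwt)
  refine ⟨key.1, ?_⟩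
  filter_upwards [hall, key.2] with ω hω hd
  obtain ⟨⟨h1, h2⟩, ⟨h3, h4⟩, h5⟩ := hω
  have hR1 := ENNReal.toReal_pos h1.1.ne' h1.2.ne
  have hR2 := ENNReal.toReal_pos h2.1.ne' h2.2.ne
  have hPp := ENNReal.toReal_pos h3.1.ne' h3.2.ne
  have hRo := ENNReal.toReal_pos h4.1.ne' h4.2.ne
  have hC := ENNReal.toReal_pos hc0 hctop
  have hG := hM.g_pos (endpoints ω).1 (endpoints ω).2
  have hF1 := Real.rpow_pos_of_pos hR1 (1 / 2)
  have hF2 := Real.rpow_pos_of_pos hR2 (1 / 2)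
  rw [llr_def, llr_def, llr_def]
  simp only
  rw [hd]
  simp only [Pi.mul_apply, Function.comp_apply, ENNReal.toReal_div, ENNReal.toReal_mul,
    ENNReal.toReal_inv, hf, ← ENNReal.toReal_rpow, toReal_weight h5, ENNReal.toReal_ofReal hG.le]
  have hE := Real.exp_pos (-(action W ω).toReal)
  -- The quotient `r(x) / √(r(x) r(y))` is what leaves half the difference of the logarithms of `r`.
  rw [Real.log_div (by positivity) (by positivity), Real.log_mul (by positivity) (by positivity),
    Real.log_mul (by positivity) (by positivity), Real.log_mul (by positivity) (by positivity),
    Real.log_mul (by positivity) (by positivity), Real.log_mul (by positivity) (by positivity),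
    Real.log_mul (by positivity) (by positivity), Real.log_inv, Real.log_exp,
    Real.log_rpow hR1, Real.log_rpow hR2]
  ring

/-- Every measure of finite modified rate is compared with the mixture of bridges built from the
square root of the density of its marginal. -/
theorem rate_lower_bound (hM : IsModel β W g) [SigmaFinite m] {μ : Measure (Path d β)}
    [IsProbabilityMeasure μ] (h : modifiedRate m W g μ ≠ ⊤) :
    ∃ f : Space d → ℝ≥0∞, Measurable f ∧ ∫⁻ x, f x * f x ∂m = 1 ∧
      (form β m W g f ≠ ⊤ → form β m W g f ≠ 0 ∧ ∃ K : ℝ, 0 ≤ K ∧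
        ((K - Real.log (form β m W g f).toReal : ℝ) : EReal) ≤ modifiedRate m W g μ ∧
        (K = 0 → μ = mix β m W g (form β m W g f) f)) := by
  have hex := hM.bridgeExists
  have hqp := isProbabilityMeasure_endpointLaw μ
  obtain ⟨hSA, hG⟩ := ne_top_of_addTop_ne_top h
  obtain ⟨hS, hA⟩ := ne_top_of_addTop_ne_top hSA
  have hμ := marginals_eq_of_symRate_ne_top hex hS
  rw [symRate_eq hex m hμ] at hS
  obtain ⟨hH, hR⟩ := ne_top_of_addTop_ne_top hS
  obtain ⟨hacP, hU2, hU2le⟩ := integral_llr_le_pairRate hex hR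
  have hac : endpointLaw μ ≪ (endpointLaw μ).fst.prod m := by
    by_contra hne
    exact hH (by rw [relEntropy, if_neg hne])
  rw [relEntropy, if_pos hac] at hH
  have hU1 := negInt_neg_of_extIntegral_ne_top hH
  have hact : ∫⁻ ω, action W ω ∂μ ≠ ⊤ := by
    intro h'
    rw [h'] at hA
    exact hA rfl
  have hactm := measurable_action (β := β) hM.measurable_W
  have hact_ae : ∀ᵐ ω ∂μ, action W ω ≠ ⊤ := by
    filter_upwards [ae_lt_top hactm hact] with ω hω using hω.ne
  have hAi : Integrable (fun ω => (action W ω).toReal) μ :=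
    integrable_toReal_of_lintegral_ne_top hactm.aemeasurable hact
  have hl : Integrable (fun z => -Real.log (g z.1 z.2)) (endpointLaw μ) :=
    integrable_of_negInt hM.measurable_log_g.aemeasurable (hM.negInt_neg_log_g _)
      (negInt_neg_of_extIntegral_ne_top hG)
  have hli : Integrable (fun ω => -Real.log (g (endpoints ω).1 (endpoints ω).2)) μ :=
    hl.comp_measurable measurable_endpoints
  have hfm := fst_absolutelyContinuous hμ hac
  have hrm : Measurable ((endpointLaw μ).fst.rnDeriv m) := Measure.measurable_rnDeriv _ _
  set f : Space d → ℝ≥0∞ := fun x => ((endpointLaw μ).fst.rnDeriv m x) ^ (1 / 2 : ℝ) with hf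
  have hfmeas : Measurable f := hrm.pow_const _
  refine ⟨f, hfmeas, ?_, fun htop => ?_⟩
  · simp only [hf, sqrt_mul_sqrt]
    rw [Measure.lintegral_rnDeriv hfm, measure_univ]
  -- If the form vanished, the mixture with constant `1` would be the zero measure and yet dominate
  -- `μ`.
  have h0 : form β m W g f ≠ 0 := by
    intro h0
    have h1 := (llr_mix hM hμ hac hacP hact_ae one_ne_zero ENNReal.one_ne_top htop).1
    have h2 : mix β m W g 1 f Set.univ = 0 := by rw [hM.mix_univ hfmeas, h0, mul_zero]
    have h3 := h1 h2
    simp at h3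
  refine ⟨h0, ?_⟩
  set c := form β m W g f with hc
  obtain ⟨hacN, hL⟩ := llr_mix hM hμ hac hacP hact_ae h0 htop htop
  have hNp := hM.isProbabilityMeasure_mix hfmeas h0 htop
  rw [← hf] at hacN hL
  set N := mix β m W g c f with hN
  set D : Space d → ℝ := fun x => Real.log ((endpointLaw μ).fst.rnDeriv m x).toReal with hD
  have hDm : Measurable D := hrm.ennreal_toReal.log
  have hllrm := measurable_llr (endpointLaw μ) ((endpointLaw μ).fst.prod m)
  have hU1' : NegInt μ fun ω =>
      -llr (endpointLaw μ) ((endpointLaw μ).fst.prod m) (endpoints ω) :=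
    (negInt_map_iff measurable_endpoints hllrm.neg).1 hU1
  have hLneg : NegInt μ (llr μ N) :=
    negInt_llr hacN MeasurableSet.univ (by simp) (measure_ne_top _ _)
  have hrest : Integrable (fun ω => llr μ ((endpointLaw μ).bind (bridgeKernel d β)) ω +
      ((action W ω).toReal + (-Real.log (g (endpoints ω).1 (endpoints ω).2) +
        Real.log c.toReal))) μ := hU2.add (hAi.add (hli.add (integrable_const _)))
  have hLm := measurable_llr μ N
  have hllrem : Measurable fun ω : Path d β =>
    llr (endpointLaw μ) ((endpointLaw μ).fst.prod m) (endpoints ω) :=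
    hllrm.comp measurable_endpoints
  -- Finite rate so far only makes the positive part of the endpoint entropy integrable. That
  -- suffices: solving the chain rule for the half difference leaves terms with integrable negative
  -- parts, so the difference is integrable with mean zero.
  have hdiff1 : NegInt μ fun ω => (1 / 2) * (D (endpoints ω).1 - D (endpoints ω).2) := by
    refine ((hLneg.add hU1' hLm.aemeasurable).add hrest.neg.negInt
      (hLm.add hllrem.neg).aemeasurable).mono ?_
    filter_upwards [hL] with ω hω
    rw [hω]
    simp only [Pi.neg_apply, hD]
    linarith
  have hDz : Measurable fun z : Space d × Space d => D z.1 - D z.2 :=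
    (hDm.comp measurable_fst).sub (hDm.comp measurable_snd)
  have hDω : Measurable fun ω : Path d β => D (endpoints ω).1 - D (endpoints ω).2 :=
    hDz.comp measurable_endpoints
  have hdiff : NegInt (endpointLaw μ) fun z => D z.1 - D z.2 := by
    rw [endpointLaw, negInt_map_iff measurable_endpoints hDz]
    refine (hdiff1.add hdiff1 (hDω.const_mul _).aemeasurable).mono (ae_of_all _ fun ω => ?_)
    linarith
  obtain ⟨hDi, hD0⟩ := stationary_difference hμ hDm hdiff
  have hDiω : Integrable (fun ω => D (endpoints ω).1 - D (endpoints ω).2) μ :=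
    hDi.comp_measurable measurable_endpoints
  have hD0ω : ∫ ω, (D (endpoints ω).1 - D (endpoints ω).2) ∂μ = 0 := by
    rw [← hD0, endpointLaw, integral_map measurable_endpoints.aemeasurable hDz.aestronglyMeasurable]
  -- Now the chain rule is solved for the endpoint entropy, whose integrability becomes available
  -- only at this point.
  have hU1neg : NegInt μ fun ω =>
      llr (endpointLaw μ) ((endpointLaw μ).fst.prod m) (endpoints ω) := by
    refine ((hLneg.add (hDiω.const_mul (1 / 2)).neg.negInt hLm.aemeasurable).add hrest.neg.negInt
      (hLm.add (hDω.const_mul _).neg).aemeasurable).mono ?_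
    filter_upwards [hL] with ω hω
    rw [hω]
    simp only [Pi.neg_apply, hD]
    linarith
  have hU1i : Integrable (fun ω =>
      llr (endpointLaw μ) ((endpointLaw μ).fst.prod m) (endpoints ω)) μ :=
    integrable_of_negInt hllrem.aemeasurable hU1neg hU1'
  have hU1q : Integrable (llr (endpointLaw μ) ((endpointLaw μ).fst.prod m)) (endpointLaw μ) :=
    (integrable_map_measure hllrm.aestronglyMeasurable measurable_endpoints.aemeasurable).2 hU1i
  have hLi : Integrable (llr μ N) μ := by
    refine (hU1i.add (hrest.add (hDiω.const_mul (1 / 2)))).congr ?_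
    filter_upwards [hL] with ω hω
    rw [hω]
    simp only [Pi.add_apply, hD]
    ring
  have hLint : ∫ ω, llr μ N ω ∂μ =
      (∫ z, llr (endpointLaw μ) ((endpointLaw μ).fst.prod m) z ∂(endpointLaw μ)) +
      ((∫ ω, llr μ ((endpointLaw μ).bind (bridgeKernel d β)) ω ∂μ) +
      ((∫ ω, (action W ω).toReal ∂μ) +
      ((∫ z, -Real.log (g z.1 z.2) ∂(endpointLaw μ)) + Real.log c.toReal))) := by
    have e1 : ∫ z, llr (endpointLaw μ) ((endpointLaw μ).fst.prod m) z ∂(endpointLaw μ) =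
        ∫ ω, llr (endpointLaw μ) ((endpointLaw μ).fst.prod m) (endpoints ω) ∂μ :=
      integral_map measurable_endpoints.aemeasurable hllrm.aestronglyMeasurable
    have e2 : ∫ z, -Real.log (g z.1 z.2) ∂(endpointLaw μ) =
        ∫ ω, -Real.log (g (endpoints ω).1 (endpoints ω).2) ∂μ :=
      integral_map measurable_endpoints.aemeasurable hM.measurable_log_g.aestronglyMeasurable
    rw [e1, e2, integral_congr_ae hL]
    have hhalf := hDiω.const_mul (1 / 2)
    have hc' := integrable_const (μ := μ) (Real.log c.toReal)
    have i1 : Integrable (fun ω => Real.log c.toReal +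
      (1 / 2) * (D (endpoints ω).1 - D (endpoints ω).2)) μ := hc'.add hhalf
    have i2 : Integrable (fun ω => -Real.log (g (endpoints ω).1 (endpoints ω).2) +
      (Real.log c.toReal + (1 / 2) * (D (endpoints ω).1 - D (endpoints ω).2))) μ := hli.add i1
    have i3 : Integrable (fun ω => (action W ω).toReal +
      (-Real.log (g (endpoints ω).1 (endpoints ω).2) +
      (Real.log c.toReal + (1 / 2) * (D (endpoints ω).1 - D (endpoints ω).2)))) μ := hAi.add i2
    have i4 : Integrable (fun ω => llr μ ((endpointLaw μ).bind (bridgeKernel d β)) ω +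
      ((action W ω).toReal + (-Real.log (g (endpoints ω).1 (endpoints ω).2) +
      (Real.log c.toReal + (1 / 2) * (D (endpoints ω).1 - D (endpoints ω).2))))) μ := hU2.add i3
    rw [integral_add hU1i i4, integral_add hU2 i3, integral_add hAi i2, integral_add hli i1,
      integral_add hc' hhalf, integral_const_mul, hD0ω]
    simp
  -- `K` is the relative entropy of `μ` with respect to the normalized mixture, so `K = 0` means
  -- equality of the two.
  refine ⟨∫ ω, llr μ N ω ∂μ, ?_, ?_, ?_⟩
  · have h2 := InformationTheory.integral_llr_add_sub_measure_univ_nonneg hacN hLi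
    simpa using h2
  · rw [modifiedRate_eq_coe_add hex hμ hac hU1q hact hl]
    refine le_trans (le_of_eq ?_) (addTop_mono (addTop_mono (addTop_mono le_rfl hU2le) le_rfl) le_rfl)
    rw [addTop_coe, addTop_coe, addTop_coe, EReal.coe_eq_coe_iff, hLint,
      integral_toReal hactm.aemeasurable (ae_lt_top hactm hact)]
    ring
  · intro hK
    have h1 : InformationTheory.klDiv μ N = 0 := by
      rw [InformationTheory.klDiv_of_ac_of_integrable hacN hLi, hK]
      simp
    exact InformationTheory.klDiv_eq_zero_iff.1 h1

end LowerBound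

/-! ### Upper bound: the rate of a mixture of bridges -/

section UpperBound

variable [hβ : Fact (0 < β)]

/-- Almost surely under the mixture no factor of its density is degenerate, so logarithms of
products and quotients may be split. -/
lemma IsModel.ae_endpointLaw_mix (hM : IsModel β W g) [SigmaFinite m] (hf : Measurable f)
    (hftop : ∀ᵐ x ∂m, f x ≠ ⊤) {c : ℝ≥0∞} (hc : form β m W g f = c) (hc0 : c ≠ 0) (hctop : c ≠ ⊤) :
    ∀ᵐ z ∂(endpointLaw (mix β m W g c f)), (((f z.1 ≠ 0 ∧ f z.1 ≠ ⊤) ∧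
      (opE β m W g f z.1 ≠ 0 ∧ opE β m W g f z.1 ≠ ⊤)) ∧ ((f z.2 ≠ 0 ∧ f z.2 ≠ ⊤) ∧
      (opE β m W g f z.2 ≠ 0 ∧ opE β m W g f z.2 ≠ ⊤))) ∧ kern β W g z ≠ 0 := by
  have hμp : IsProbabilityMeasure (mix β m W g c f) := by
    have := hM.isProbabilityMeasure_mix (m := m) hf (hc ▸ hc0) (hc ▸ hctop)
    rwa [hc] at this
  have hμ := hM.fst_eq_snd_endpointLaw_mix (m := m) (c := c) hf
  have hqd := hM.endpointLaw_mix (m := m) (c := c) hf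
  have hq1 := hM.fst_endpointLaw_mix (m := m) (c := c) hf
  set μ := mix β m W g c f
  have hqp := isProbabilityMeasure_endpointLaw μ
  have hop := hM.measurable_opE (m := m) hf
  have hdens1 : Measurable fun x => c⁻¹ * (f x * opE β m W g f x) := (hf.mul hop).const_mul _
  have hpd := hM.measurable_pair_density hf c
  have hcinv0 : c⁻¹ ≠ 0 := ENNReal.inv_ne_zero.2 hctop
  have hx : ∀ᵐ x ∂(endpointLaw μ).fst, (f x ≠ 0 ∧ f x ≠ ⊤) ∧
      (opE β m W g f x ≠ 0 ∧ opE β m W g f x ≠ ⊤) := by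
    have htot : ∫⁻ x, c⁻¹ * (f x * opE β m W g f x) ∂m ≠ ⊤ := by
      rw [← setLIntegral_univ, ← withDensity_apply _ MeasurableSet.univ, ← hq1]
      exact measure_ne_top _ _
    rw [hq1, ae_withDensity_iff hdens1]
    filter_upwards [hftop, ae_lt_top hdens1 htot] with x h1 h2 h3
    have h4 := right_ne_zero_of_mul h3
    have h5 := left_ne_zero_of_mul h4
    refine ⟨⟨h5, h1⟩, right_ne_zero_of_mul h4, fun h6 => h2.ne ?_⟩
    rw [h6, ENNReal.mul_top h5, ENNReal.mul_top hcinv0]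
  have hz1 := ae_of_ae_map measurable_fst.aemeasurable hx
  have hz2 : ∀ᵐ z ∂(endpointLaw μ), (f z.2 ≠ 0 ∧ f z.2 ≠ ⊤) ∧
      (opE β m W g f z.2 ≠ 0 ∧ opE β m W g f z.2 ≠ ⊤) := by
    rw [hμ] at hx
    exact ae_of_ae_map measurable_snd.aemeasurable hx
  have hk : ∀ᵐ z ∂(endpointLaw μ), kern β W g z ≠ 0 := by
    rw [hqd, ae_withDensity_iff hpd]
    exact ae_of_all _ fun z h => right_ne_zero_of_mul h
  exact (hz1.and hz2).and hk

lemma IsModel.rnDeriv_endpointLaw_mix (hM : IsModel β W g) [SigmaFinite m] (hf : Measurable f)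
    (hftop : ∀ᵐ x ∂m, f x ≠ ⊤) {c : ℝ≥0∞} (hc : form β m W g f = c) (hc0 : c ≠ 0) (hctop : c ≠ ⊤) :
    endpointLaw (mix β m W g c f) ≪ (endpointLaw (mix β m W g c f)).fst.prod m ∧
      (endpointLaw (mix β m W g c f)).rnDeriv ((endpointLaw (mix β m W g c f)).fst.prod m)
        =ᵐ[endpointLaw (mix β m W g c f)] fun z => (c⁻¹ * (f z.1 * f z.2) * kern β W g z) /
          (c⁻¹ * (f z.1 * opE β m W g f z.1)) := by
  have hzall := hM.ae_endpointLaw_mix hf hftop hc hc0 hctop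
  have hμp : IsProbabilityMeasure (mix β m W g c f) := by
    have := hM.isProbabilityMeasure_mix (m := m) hf (hc ▸ hc0) (hc ▸ hctop)
    rwa [hc] at this
  have hqd := hM.endpointLaw_mix (m := m) (c := c) hf
  have hq1 := hM.fst_endpointLaw_mix (m := m) (c := c) hf
  set μ := mix β m W g c f
  have hqp := isProbabilityMeasure_endpointLaw μ
  have hop := hM.measurable_opE (m := m) hf
  have hdens1 : Measurable fun x => c⁻¹ * (f x * opE β m W g f x) := (hf.mul hop).const_mul _
  have hpd := hM.measurable_pair_density hf c
  have hcinv0 : c⁻¹ ≠ 0 := ENNReal.inv_ne_zero.2 hctop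
  have hcinvt : c⁻¹ ≠ ⊤ := ENNReal.inv_ne_top.2 hc0
  have hRd : (endpointLaw μ).fst.prod m =
      (m.prod m).withDensity fun z => c⁻¹ * (f z.1 * opE β m W g f z.1) := by
    rw [hq1]
    exact prod_withDensity_left hdens1
  exact rnDeriv_of_withDensity (N := (endpointLaw μ).fst.prod m) hpd
    (hdens1.comp measurable_fst) hqd hRd (by
      filter_upwards [hzall] with z hz
      obtain ⟨⟨⟨h1, h2⟩, h3⟩, h4⟩ := hz
      exact ⟨mul_ne_zero hcinv0 (mul_ne_zero h1.1 h2.1),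
        ENNReal.mul_ne_top hcinvt (ENNReal.mul_ne_top h1.2 h2.2)⟩)

/-- The modified rate of a mixture of bridges. -/
theorem rate_mix_le (hM : IsModel β W g) [SigmaFinite m] (hf : Measurable f)
    (hftop : ∀ᵐ x ∂m, f x ≠ ⊤) {c : ℝ≥0∞} (hc : form β m W g f = c) (hc0 : c ≠ 0) (hctop : c ≠ ⊤)
    (hneg : NegInt (endpointLaw (mix β m W g c f)) (llr (endpointLaw (mix β m W g c f))
      ((endpointLaw (mix β m W g c f)).fst.prod m)))
    (hlog : Integrable (fun x => Real.log (opE β m W g f x / f x).toReal)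
      (endpointLaw (mix β m W g c f)).fst) :
    modifiedRate m W g (mix β m W g c f) ≤
      ((-∫ x, Real.log (opE β m W g f x / f x).toReal
        ∂(endpointLaw (mix β m W g c f)).fst : ℝ) : EReal) := by
  have hex := hM.bridgeExists
  have hμp : IsProbabilityMeasure (mix β m W g c f) := by
    have := hM.isProbabilityMeasure_mix (m := m) hf (hc ▸ hc0) (hc ▸ hctop)
    rwa [hc] at this
  have hμ := hM.fst_eq_snd_endpointLaw_mix (m := m) (c := c) hf
  have hqd := hM.endpointLaw_mix (m := m) (c := c) hf
  have hμd : mix β m W g c f = ((m.prod m).bind (bridgeKernel d β)).withDensity fun ω =>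
    c⁻¹ * (f (endpoints ω).1 * f (endpoints ω).2) *
      ENNReal.ofReal (g (endpoints ω).1 (endpoints ω).2) * weight W ω := rfl
  set μ := mix β m W g c f
  have hqp := isProbabilityMeasure_endpointLaw μ
  have hP := isProbabilityMeasure_bind hex (endpointLaw μ)
  have hop := hM.measurable_opE (m := m) hf
  have hpd := hM.measurable_pair_density hf c
  have hμdm := hM.measurable_mix_density hf c
  have hcinv0 : c⁻¹ ≠ 0 := ENNReal.inv_ne_zero.2 hctop
  have hcinvt : c⁻¹ ≠ ⊤ := ENNReal.inv_ne_top.2 hc0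
  have hzall := hM.ae_endpointLaw_mix hf hftop hc hc0 hctop
  have hw : ∀ᵐ ω ∂μ, action W ω ≠ ⊤ := by
    rw [hμd, ae_withDensity_iff hμdm]
    exact ae_of_all _ fun ω h h' => right_ne_zero_of_mul h (weight_eq_zero_iff.2 h')
  obtain ⟨hac, hrn1⟩ := hM.rnDeriv_endpointLaw_mix hf hftop hc hc0 hctop
  have hPd : (endpointLaw μ).bind (bridgeKernel d β) =
      ((m.prod m).bind (bridgeKernel d β)).withDensity fun ω =>
        c⁻¹ * (f (endpoints ω).1 * f (endpoints ω).2) * kern β W g (endpoints ω) := by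
    conv_lhs => rw [hqd]
    exact bind_withDensity hex _ hpd
  obtain ⟨hacP, hrn2⟩ := rnDeriv_of_withDensity (N := (endpointLaw μ).bind (bridgeKernel d β))
    hμdm (hpd.comp measurable_endpoints) hμd hPd (by
      filter_upwards [ae_endpoints hzall] with ω hω
      obtain ⟨⟨⟨h1, h2⟩, ⟨h3, h3'⟩⟩, h4⟩ := hω
      exact ⟨mul_ne_zero (mul_ne_zero hcinv0 (mul_ne_zero h1.1 h3.1)) h4,
        ENNReal.mul_ne_top (ENNReal.mul_ne_top hcinvt (ENNReal.mul_ne_top h1.2 h3.2))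
          (hM.kern_ne_top _)⟩)
  set t : Space d → ℝ := fun x => Real.log (opE β m W g f x / f x).toReal with ht
  have htm : Measurable t := (hop.div hf).ennreal_toReal.log
  set D : Space d → ℝ := fun x => -Real.log (f x).toReal with hD
  have hDm : Measurable D := hf.ennreal_toReal.log.neg
  -- The endpoint entropy contributes `log f(y) + log K - log (opE f)(x)`, and the conditional
  -- entropy cancels `log K`, the action and `log g`. Adding and subtracting `log f(x)` isolates the
  -- difference that the equal marginals cancel.
  have hsum : ∀ᵐ ω ∂μ, llr (endpointLaw μ) ((endpointLaw μ).fst.prod m) (endpoints ω) +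
      (llr μ ((endpointLaw μ).bind (bridgeKernel d β)) ω + ((action W ω).toReal +
        -Real.log (g (endpoints ω).1 (endpoints ω).2))) =
      (D (endpoints ω).1 - D (endpoints ω).2) - t (endpoints ω).1 := by
    filter_upwards [ae_endpoints hzall, ae_endpoints hrn1, hrn2, hw] with ω hω h1 h2 hwω
    obtain ⟨⟨⟨⟨a0, at'⟩, ⟨b0, bt⟩⟩, ⟨⟨c0, ct⟩, -⟩⟩, k0⟩ := hω
    have hA := ENNReal.toReal_pos a0 at'
    have hB := ENNReal.toReal_pos b0 bt
    have hC := ENNReal.toReal_pos c0 ct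
    have hK := ENNReal.toReal_pos ((hM.kern_ne_zero_iff _).1 k0) (ne_top_of_le_ne_top
      ENNReal.one_ne_top (bridgeWeight_le_one hex W _ _))
    have hci := ENNReal.toReal_pos hcinv0 hcinvt
    have hG := hM.g_pos (endpoints ω).1 (endpoints ω).2
    have hE := Real.exp_pos (-(action W ω).toReal)
    rw [llr_def, llr_def]
    simp only
    rw [h1, h2]
    simp only [Function.comp_apply, ht, hD, kern, ENNReal.toReal_div, ENNReal.toReal_mul,
      toReal_weight hwω, ENNReal.toReal_ofReal hG.le]
    simp (disch := positivity) only [Real.log_div, Real.log_mul, Real.log_exp]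
    ring
  have hllrm := measurable_llr (endpointLaw μ) ((endpointLaw μ).fst.prod m)
  have hactm := measurable_action (β := β) hM.measurable_W
  have m1 : Measurable fun ω : Path d β =>
      llr (endpointLaw μ) ((endpointLaw μ).fst.prod m) (endpoints ω) :=
    hllrm.comp measurable_endpoints
  have m2 := measurable_llr μ ((endpointLaw μ).bind (bridgeKernel d β))
  have m3 : Measurable fun ω : Path d β => (action W ω).toReal := hactm.ennreal_toReal
  have m4 : Measurable fun ω : Path d β => -Real.log (g (endpoints ω).1 (endpoints ω).2) :=
    hM.measurable_log_g.comp measurable_endpoints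
  have m34 : Measurable fun ω : Path d β => (action W ω).toReal +
      -Real.log (g (endpoints ω).1 (endpoints ω).2) := m3.add m4
  have m234 : Measurable fun ω : Path d β => llr μ ((endpointLaw μ).bind (bridgeKernel d β)) ω +
      ((action W ω).toReal + -Real.log (g (endpoints ω).1 (endpoints ω).2)) := m2.add m34
  have n1 : NegInt μ fun ω => llr (endpointLaw μ) ((endpointLaw μ).fst.prod m) (endpoints ω) :=
    (negInt_map_iff measurable_endpoints hllrm).1 hneg
  have n2 : NegInt μ (llr μ ((endpointLaw μ).bind (bridgeKernel d β))) :=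
    negInt_llr hacP MeasurableSet.univ (by simp) (measure_ne_top _ _)
  have n3 : NegInt μ fun ω => (action W ω).toReal :=
    negInt_of_nonneg (ae_of_all _ fun ω => ENNReal.toReal_nonneg)
  have n4 : NegInt μ fun ω => -Real.log (g (endpoints ω).1 (endpoints ω).2) :=
    (negInt_map_iff measurable_endpoints hM.measurable_log_g).1 (hM.negInt_neg_log_g _)
  have n34 := n3.add n4 m3.aemeasurable
  have n234 := n2.add n34 m2.aemeasurable
  have n1234 := n1.add n234 m1.aemeasurable
  have htq : Integrable (fun z => t z.1) (endpointLaw μ) := hlog.comp_measurable measurable_fst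
  have htω : Integrable (fun ω => t (endpoints ω).1) μ :=
    htq.comp_measurable measurable_endpoints
  have hDz : Measurable fun z : Space d × Space d => D z.1 - D z.2 :=
    (hDm.comp measurable_fst).sub (hDm.comp measurable_snd)
  have hdiff : NegInt (endpointLaw μ) fun z => D z.1 - D z.2 := by
    rw [endpointLaw, negInt_map_iff measurable_endpoints hDz]
    refine (n1234.add htω.negInt (m1.add m234).aemeasurable).mono ?_
    filter_upwards [hsum] with ω hω
    rw [hω]
    linarith
  obtain ⟨hDi, hD0⟩ := stationary_difference hμ hDm hdiff
  have hDiω : Integrable (fun ω => D (endpoints ω).1 - D (endpoints ω).2) μ :=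
    hDi.comp_measurable measurable_endpoints
  have hD0ω : ∫ ω, (D (endpoints ω).1 - D (endpoints ω).2) ∂μ = 0 := by
    rw [← hD0, endpointLaw, integral_map measurable_endpoints.aemeasurable hDz.aestronglyMeasurable]
  have hall : Integrable (fun ω =>
      llr (endpointLaw μ) ((endpointLaw μ).fst.prod m) (endpoints ω) +
      (llr μ ((endpointLaw μ).bind (bridgeKernel d β)) ω + ((action W ω).toReal +
        -Real.log (g (endpoints ω).1 (endpoints ω).2)))) μ :=
    (hDiω.sub htω).congr (by
      filter_upwards [hsum] with ω hω
      rw [hω]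
      rfl)
  -- The sum is integrable and each of the four summands has an integrable negative part, so each is
  -- integrable.
  obtain ⟨i1, i234⟩ := integrable_of_negInt_add m1.aemeasurable
    m234.aemeasurable n1 n234 hall
  obtain ⟨i2, i34⟩ := integrable_of_negInt_add m2.aemeasurable m34.aemeasurable n2 n34 i234
  obtain ⟨i3, i4⟩ := integrable_of_negInt_add m3.aemeasurable m4.aemeasurable n3 n4 i34
  have hactfin : ∫⁻ ω, action W ω ∂μ ≠ ⊤ := by
    have h1 : ∫⁻ ω, action W ω ∂μ = ∫⁻ ω, ENNReal.ofReal (action W ω).toReal ∂μ := by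
      refine lintegral_congr_ae ?_
      filter_upwards [hw] with ω hω
      exact (ENNReal.ofReal_toReal hω).symm
    rw [h1]
    exact (Integrable.lintegral_lt_top i3).ne
  have j1 : Integrable (llr (endpointLaw μ) ((endpointLaw μ).fst.prod m)) (endpointLaw μ) :=
    (integrable_map_measure hllrm.aestronglyMeasurable measurable_endpoints.aemeasurable).2 i1
  have j4 : Integrable (fun z => -Real.log (g z.1 z.2)) (endpointLaw μ) :=
    (integrable_map_measure hM.measurable_log_g.aestronglyMeasurable
      measurable_endpoints.aemeasurable).2 i4
  rw [modifiedRate_eq_coe_add hex hμ hac j1 hactfin j4]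
  refine (addTop_mono (addTop_mono (addTop_mono le_rfl (pairRate_le_integral_llr hex hacP i2))
    le_rfl) le_rfl).trans (le_of_eq ?_)
  rw [addTop_coe, addTop_coe, addTop_coe, EReal.coe_eq_coe_iff,
    ← integral_toReal hactm.aemeasurable (ae_lt_top hactm hactfin)]
  have e1 : ∫ z, llr (endpointLaw μ) ((endpointLaw μ).fst.prod m) z ∂(endpointLaw μ) =
      ∫ ω, llr (endpointLaw μ) ((endpointLaw μ).fst.prod m) (endpoints ω) ∂μ :=
    integral_map measurable_endpoints.aemeasurable hllrm.aestronglyMeasurable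
  have e2 : ∫ z, -Real.log (g z.1 z.2) ∂(endpointLaw μ) =
      ∫ ω, -Real.log (g (endpoints ω).1 (endpoints ω).2) ∂μ :=
    integral_map measurable_endpoints.aemeasurable hM.measurable_log_g.aestronglyMeasurable
  have e3 : ∫ x, t x ∂(endpointLaw μ).fst = ∫ ω, t (endpoints ω).1 ∂μ := by
    rw [Measure.fst, integral_map measurable_fst.aemeasurable htm.aestronglyMeasurable, endpointLaw,
      integral_map measurable_endpoints.aemeasurable
        (show Measurable fun z : Space d × Space d => t z.1 from
          htm.comp measurable_fst).aestronglyMeasurable]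
  rw [e1, e2, e3]
  have h1 := integral_congr_ae hsum
  rw [integral_add i1 i234, integral_add i2 i34, integral_add i3 i4, integral_sub hDiω htω,
    hD0ω] at h1
  linarith

end UpperBound

/-! ### The quadratic form of a positive kernel -/

section SchurTest

lemma eq_one_of_mul_self_eq_one {s : ℝ≥0∞} (h : s * s = 1) : s = 1 := by
  have hs : s ≠ ⊤ := by
    rintro rfl
    simp at h
  lift s to NNReal using hs
  norm_cast at h ⊢
  exact NNReal.coe_eq_one.1 ((pow_eq_one_iff_of_nonneg s.2 two_ne_zero).1
    (by rw [pow_two]; exact congrArg NNReal.toReal h))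

/-- The two sides differ by `(a t - b s)² / (s t)`. -/
lemma two_mul_mul_le_weighted {a b s t : ℝ≥0∞} (ha : a ≠ ⊤) (hb : b ≠ ⊤) (hs0 : s ≠ 0)
    (hs : s ≠ ⊤) (ht0 : t ≠ 0) (ht : t ≠ ⊤) :
    2 * (a * b) ≤ a * a * (t / s) + b * b * (s / t) ∧
      (2 * (a * b) = a * a * (t / s) + b * b * (s / t) → a * t = b * s) := by
  lift a to NNReal using ha
  lift b to NNReal using hb
  lift s to NNReal using hs
  lift t to NNReal using ht
  have hs0' : s ≠ 0 := by exact_mod_cast hs0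
  have ht0' : t ≠ 0 := by exact_mod_cast ht0
  rw [← ENNReal.coe_div hs0', ← ENNReal.coe_div ht0']
  norm_cast
  rw [← NNReal.coe_le_coe, ← NNReal.coe_inj, ← NNReal.coe_inj]
  push_cast
  have hS : (0 : ℝ) < s := by positivity
  have hT : (0 : ℝ) < t := by positivity
  have key : (a : ℝ) * a * (t / s) + b * b * (s / t) - 2 * (a * b) =
      (a * t - b * s) ^ 2 / (s * t) := by
    field_simp
    ring
  have hnn : 0 ≤ ((a : ℝ) * t - b * s) ^ 2 / (s * t) := by positivity
  refine ⟨by linarith, fun h => ?_⟩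
  rw [← h, sub_self, eq_comm, div_eq_zero_iff] at key
  rcases key with h1 | h1
  · have := pow_eq_zero_iff (two_ne_zero) |>.1 h1
    linarith
  · exact absurd h1 (by positivity)

variable {d : ℕ} {β : ℝ} {m : Measure (Space d)} {W : Space d → ℝ≥0∞}
  {g : Space d → Space d → ℝ} {f φ : Space d → ℝ≥0∞} {L : ℝ≥0∞}

lemma lintegral_mul_kern (hM : IsModel β W g) [SigmaFinite m] {u v : Space d → ℝ≥0∞}
    (hu : Measurable u) (hv : Measurable v) :
    ∫⁻ z, u z.1 * v z.2 * kern β W g z ∂(m.prod m) = ∫⁻ x, u x * opE β m W g v x ∂m := by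
  have h : Measurable fun z : Space d × Space d => u z.1 * v z.2 * kern β W g z :=
    ((hu.comp measurable_fst).mul (hv.comp measurable_snd)).mul hM.measurable_kern
  rw [lintegral_prod _ h.aemeasurable]
  refine lintegral_congr fun x => ?_
  rw [opE, ← lintegral_const_mul _ (show Measurable fun y => v y * kern β W g (x, y) from
    hv.mul (hM.measurable_kern.comp measurable_prodMk_left))]
  simp only [mul_assoc]

/-- At a zero of `φ` the integral of `φ` against a strictly positive kernel vanishes, so `φ = 0`
almost everywhere, against the normalization. -/
lemma ae_ne_zero_of_eigen (hM : IsModel β W g) (hk : ∀ z, kern β W g z ≠ 0) (hφ : Measurable φ)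
    (heig : ∀ᵐ x ∂m, opE β m W g φ x = L * φ x) (hφ1 : ∫⁻ x, φ x * φ x ∂m = 1) :
    ∀ᵐ x ∂m, φ x ≠ 0 := by
  filter_upwards [heig] with x hx h0
  rw [h0, mul_zero, opE, lintegral_eq_zero_iff (show Measurable fun y => φ y * kern β W g (x, y) from
    hφ.mul (hM.measurable_kern.comp measurable_prodMk_left))] at hx
  have h1 : ∫⁻ x, φ x * φ x ∂m = 0 := by
    rw [lintegral_eq_zero_iff (show Measurable fun x => φ x * φ x from hφ.mul hφ)]
    filter_upwards [hx] with y hy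
    have := (mul_eq_zero.1 hy).resolve_right (hk _)
    simp [this]
  rw [hφ1] at h1
  exact one_ne_zero h1

lemma ae_ne_top_of_lintegral_mul_self (hf : Measurable f) (h : ∫⁻ x, f x * f x ∂m ≠ ⊤) :
    ∀ᵐ x ∂m, f x ≠ ⊤ := by
  filter_upwards [ae_lt_top (hf.mul hf) h] with x hx h'
  simp [h'] at hx

variable [hβ : Fact (0 < β)]

lemma lintegral_mul_kern_swap (hM : IsModel β W g) [SigmaFinite m] {u v : Space d → ℝ≥0∞}
    (hu : Measurable u) (hv : Measurable v) :
    ∫⁻ z, u z.1 * v z.2 * kern β W g z ∂(m.prod m) =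
      ∫⁻ z, v z.1 * u z.2 * kern β W g z ∂(m.prod m) := by
  have h : Measurable fun z : Space d × Space d => u z.1 * v z.2 * kern β W g z :=
    ((hu.comp measurable_fst).mul (hv.comp measurable_snd)).mul hM.measurable_kern
  rw [← lintegral_prod_swap]
  refine lintegral_congr fun z => ?_
  rw [Prod.fst_swap, Prod.snd_swap, mul_comm (u z.2)]
  congr 1
  exact hM.kern_swap z.2 z.1

/-- Schur's test: a positive eigenfunction bounds the quadratic form of a positive symmetric
kernel, and only its multiples attain the bound. -/
lemma schur_test (hM : IsModel β W g) [SigmaFinite m] (hk : ∀ z, kern β W g z ≠ 0)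
    (hφ : Measurable φ) (heig : ∀ᵐ x ∂m, opE β m W g φ x = L * φ x)
    (hLtop : L ≠ ⊤) (hφ1 : ∫⁻ x, φ x * φ x ∂m = 1) (hf : Measurable f)
    (hf1 : ∫⁻ x, f x * f x ∂m = 1) :
    form β m W g f ≤ L ∧ (form β m W g f = L → f =ᵐ[m] φ) := by
  have hφ0 := ae_ne_zero_of_eigen hM hk hφ heig hφ1
  have hφt := ae_ne_top_of_lintegral_mul_self hφ (by rw [hφ1]; exact ENNReal.one_ne_top)
  have hft := ae_ne_top_of_lintegral_mul_self hf (by rw [hf1]; exact ENNReal.one_ne_top)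
  have hsec : ∀ {p : Space d → Prop}, (∀ᵐ x ∂m, p x) →
      ∀ᵐ z ∂(m.prod m), p z.1 ∧ p z.2 := fun h =>
    (Measure.quasiMeasurePreserving_fst.ae h).and (Measure.quasiMeasurePreserving_snd.ae h)
  -- The test function `f² / φ`, paired with `K φ = L φ`, integrates to exactly `L`. The weighted
  -- inequality `2 f(x) f(y) ≤ f(x)² φ(y)/φ(x) + f(y)² φ(x)/φ(y)` then gives the bound.
  have hu : Measurable fun x => f x * f x / φ x := (hf.mul hf).div hφ
  have hform : ∫⁻ z, f z.1 * f z.2 * kern β W g z ∂(m.prod m) = form β m W g f :=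
    lintegral_mul_kern hM hf hf
  have hL : ∫⁻ z, (f z.1 * f z.1 / φ z.1) * φ z.2 * kern β W g z ∂(m.prod m) = L := by
    rw [lintegral_mul_kern hM hu hφ]
    have : ∫⁻ x, f x * f x / φ x * opE β m W g φ x ∂m = ∫⁻ x, L * (f x * f x) ∂m := by
      refine lintegral_congr_ae ?_
      filter_upwards [heig, hφ0, hφt] with x h1 h2 h3
      rw [h1, mul_left_comm, ENNReal.div_mul_cancel h2 h3]
    rw [this, lintegral_const_mul _ (show Measurable fun x => f x * f x from hf.mul hf), hf1, mul_one]
  have hL2 : ∫⁻ z, φ z.1 * (f z.2 * f z.2 / φ z.2) * kern β W g z ∂(m.prod m) = L := by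
    rw [lintegral_mul_kern_swap hM hφ hu, hL]
  have hAm : Measurable fun z : Space d × Space d => f z.1 * f z.2 * kern β W g z :=
    ((hf.comp measurable_fst).mul (hf.comp measurable_snd)).mul hM.measurable_kern
  have hB1m : Measurable fun z : Space d × Space d =>
      (f z.1 * f z.1 / φ z.1) * φ z.2 * kern β W g z :=
    ((hu.comp measurable_fst).mul (hφ.comp measurable_snd)).mul hM.measurable_kern
  have hB2m : Measurable fun z : Space d × Space d =>
      φ z.1 * (f z.2 * f z.2 / φ z.2) * kern β W g z :=
    ((hφ.comp measurable_fst).mul (hu.comp measurable_snd)).mul hM.measurable_kern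
  have hB : ∫⁻ z, ((f z.1 * f z.1 / φ z.1) * φ z.2 * kern β W g z +
      φ z.1 * (f z.2 * f z.2 / φ z.2) * kern β W g z) ∂(m.prod m) = L + L := by
    rw [lintegral_add_left hB1m, hL, hL2]
  have hA : ∫⁻ z, 2 * (f z.1 * f z.2 * kern β W g z) ∂(m.prod m) =
      form β m W g f + form β m W g f := by
    rw [lintegral_const_mul _ hAm, hform, two_mul]
  have hpt : ∀ᵐ z ∂(m.prod m), 2 * (f z.1 * f z.2 * kern β W g z) ≤
      ((f z.1 * f z.1 / φ z.1) * φ z.2 * kern β W g z +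
      φ z.1 * (f z.2 * f z.2 / φ z.2) * kern β W g z) ∧
      (2 * (f z.1 * f z.2 * kern β W g z) = ((f z.1 * f z.1 / φ z.1) * φ z.2 * kern β W g z +
      φ z.1 * (f z.2 * f z.2 / φ z.2) * kern β W g z) → f z.1 * φ z.2 = f z.2 * φ z.1) := by
    filter_upwards [hsec hφ0, hsec hφt, hsec hft] with z h0 ht hf'
    obtain ⟨h1, h2⟩ := two_mul_mul_le_weighted hf'.1 hf'.2 h0.1 ht.1 h0.2 ht.2
    have e1 : 2 * (f z.1 * f z.2 * kern β W g z) = 2 * (f z.1 * f z.2) * kern β W g z := by ring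
    have e2 : ((f z.1 * f z.1 / φ z.1) * φ z.2 * kern β W g z +
        φ z.1 * (f z.2 * f z.2 / φ z.2) * kern β W g z) =
        (f z.1 * f z.1 * (φ z.2 / φ z.1) + f z.2 * f z.2 * (φ z.1 / φ z.2)) * kern β W g z := by
      simp only [div_eq_mul_inv]
      ring
    rw [e1, e2]
    refine ⟨mul_le_mul_left h1 _, fun h => h2 ?_⟩
    exact (ENNReal.mul_left_inj (hk z) (hM.kern_ne_top z)).1 h
  have hle : form β m W g f + form β m W g f ≤ L + L := by
    rw [← hA, ← hB]
    exact lintegral_mono_ae (hpt.mono fun z hz => hz.1)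
  refine ⟨?_, fun heq => ?_⟩
  · by_contra hlt
    exact absurd hle (not_le.2 (ENNReal.add_lt_add (not_le.1 hlt) (not_le.1 hlt)))
  -- Equal finite integrals turn the pointwise inequality into an equality, and positivity of the
  -- kernel yields `f(x) φ(y) = f(y) φ(x)`. Integrating this against `φ(y)` gives `f = s φ`, and the
  -- norms give `s = 1`.
  · have hae := ae_eq_of_ae_le_of_lintegral_le (hpt.mono fun z hz => hz.1)
      (by rw [hA, heq]; exact ENNReal.add_ne_top.2 ⟨hLtop, hLtop⟩)
      (hB1m.add hB2m).aemeasurable (by rw [hA, hB, heq])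
    have hprop : ∀ᵐ z ∂(m.prod m), f z.1 * φ z.2 = f z.2 * φ z.1 := by
      filter_upwards [hpt, hae] with z h1 h2
      exact h1.2 h2
    have hcurry := Measure.ae_ae_of_ae_prod hprop
    set s := ∫⁻ y, f y * φ y ∂m with hs
    have hfs : ∀ᵐ x ∂m, f x = s * φ x := by
      filter_upwards [hcurry] with x hx
      have h1 : ∫⁻ y, f x * (φ y * φ y) ∂m = ∫⁻ y, (f y * φ y) * φ x ∂m := by
        refine lintegral_congr_ae ?_
        filter_upwards [hx] with y hy
        rw [← mul_assoc]
        rw [hy]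
        ring
      rwa [lintegral_const_mul _ (show Measurable fun x => φ x * φ x from hφ.mul hφ), hφ1, mul_one,
        lintegral_mul_const _ (show Measurable fun x => f x * φ x from hf.mul hφ)] at h1
    have hs1 : s * s = 1 := by
      have h1 : ∫⁻ x, f x * f x ∂m = ∫⁻ x, (s * s) * (φ x * φ x) ∂m := by
        refine lintegral_congr_ae ?_
        filter_upwards [hfs] with x hx
        rw [hx]
        ring
      rwa [hf1, lintegral_const_mul _ (show Measurable fun x => φ x * φ x from hφ.mul hφ), hφ1, mul_one, eq_comm] at h1
    have hs2 : s = 1 := eq_one_of_mul_self_eq_one hs1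
    filter_upwards [hfs] with x hx
    rw [hx, hs2, one_mul]

end SchurTest

/-! ### Bounded symmetric kernels on finite measure spaces -/

section BoundedKernel

variable {X : Type*} [MeasurableSpace X] {ν : Measure X}

/-- A bounded measurable symmetric kernel. -/
structure IsBoundedKernel (k : X × X → ℝ) (C : ℝ) : Prop where
  measurable : Measurable k
  bound : ∀ z, |k z| ≤ C
  symm : ∀ x y, k (x, y) = k (y, x)

variable {k : X × X → ℝ} {C : ℝ}

namespace IsBoundedKernel

variable [IsFiniteMeasure ν]

lemma memLp_section (hk : IsBoundedKernel k C) (x : X) : MemLp (fun y => k (x, y)) 2 ν :=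
  MemLp.of_bound (hk.measurable.comp measurable_prodMk_left).aestronglyMeasurable C
    (ae_of_all _ fun _ => hk.bound _)

/-- The section of the kernel as an element of `L²`. -/
def sec (hk : IsBoundedKernel k C) (ν : Measure X) [IsFiniteMeasure ν] (x : X) : Lp ℝ 2 ν :=
  (hk.memLp_section x).toLp _

lemma integral_eq_inner (hk : IsBoundedKernel k C) (f : Lp ℝ 2 ν) (x : X) :
    ∫ y, k (x, y) * f y ∂ν = inner ℝ (hk.sec ν x) f := by
  rw [L2.inner_def]
  refine integral_congr_ae ?_
  filter_upwards [(hk.memLp_section (ν := ν) x).coeFn_toLp] with y hy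
  rw [sec, hy]
  simp [mul_comm]

lemma exists_norm_sec_le (hk : IsBoundedKernel k C) (ν : Measure X) [IsFiniteMeasure ν] :
    ∃ R : ℝ, ∀ x, ‖hk.sec ν x‖ ≤ R := by
  refine ⟨_, fun x => Lp.norm_le_of_ae_bound (C := |C|) (abs_nonneg _) ?_⟩
  filter_upwards [(hk.memLp_section (ν := ν) x).coeFn_toLp] with y hy
  rw [sec, hy]
  exact (hk.bound _).trans (le_abs_self C)

lemma stronglyMeasurable_apply (hk : IsBoundedKernel k C) (f : Lp ℝ 2 ν) :
    StronglyMeasurable fun x => ∫ y, k (x, y) * f y ∂ν := by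
  have h : StronglyMeasurable fun z : X × X => k z * f z.2 :=
    hk.measurable.stronglyMeasurable.mul
      ((Lp.stronglyMeasurable f).comp_measurable measurable_snd)
  exact h.integral_prod_right'

lemma memLp_apply (hk : IsBoundedKernel k C) (f : Lp ℝ 2 ν) :
    MemLp (fun x => ∫ y, k (x, y) * f y ∂ν) 2 ν := by
  obtain ⟨R, hR⟩ := hk.exists_norm_sec_le ν
  refine MemLp.of_bound (hk.stronglyMeasurable_apply f).aestronglyMeasurable (R * ‖f‖)
    (ae_of_all _ fun x => ?_)
  rw [hk.integral_eq_inner f x]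
  exact (norm_inner_le_norm _ _).trans (mul_le_mul_of_nonneg_right (hR x) (norm_nonneg _))

/-- The integral operator as a linear map of `L²`. -/
def opLin (hk : IsBoundedKernel k C) (ν : Measure X) [IsFiniteMeasure ν] :
    Lp ℝ 2 ν →ₗ[ℝ] Lp ℝ 2 ν where
  toFun f := (hk.memLp_apply f).toLp _
  map_add' f f' := by
    rw [← MemLp.toLp_add]
    refine MemLp.toLp_congr _ _ (ae_of_all _ fun x => ?_)
    simp only [Pi.add_apply, hk.integral_eq_inner, inner_add_right]
  map_smul' c f := by
    rw [RingHom.id_apply, ← MemLp.toLp_const_smul]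
    refine MemLp.toLp_congr _ _ (ae_of_all _ fun x => ?_)
    simp only [Pi.smul_apply, hk.integral_eq_inner, inner_smul_right, smul_eq_mul]

lemma coeFn_opLin (hk : IsBoundedKernel k C) (f : Lp ℝ 2 ν) :
    hk.opLin ν f =ᵐ[ν] fun x => ∫ y, k (x, y) * f y ∂ν :=
  (hk.memLp_apply f).coeFn_toLp

lemma inner_opLin (hk : IsBoundedKernel k C) (f h : Lp ℝ 2 ν) :
    inner ℝ h (hk.opLin ν f) = ∫ x, ∫ y, h x * k (x, y) * f y ∂ν ∂ν := by
  rw [L2.inner_def]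
  refine integral_congr_ae ?_
  filter_upwards [hk.coeFn_opLin f] with x hx
  rw [hx]
  simp only [RCLike.inner_apply, conj_trivial]
  rw [mul_comm, ← integral_const_mul]
  simp only [mul_assoc]

lemma isSymmetric_opLin (hk : IsBoundedKernel k C) : (hk.opLin ν).IsSymmetric := by
  intro f h
  rw [real_inner_comm, hk.inner_opLin, hk.inner_opLin, integral_integral_swap]
  · refine integral_congr_ae (ae_of_all _ fun x => integral_congr_ae (ae_of_all _ fun y => ?_))
    simp only
    rw [hk.symm y x]
    ring
  · have hf := (Lp.memLp f).integrable (by norm_num)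
    have hh := (Lp.memLp h).integrable (by norm_num)
    have h1 : Integrable (fun z : X × X => h z.1 * f z.2) (ν.prod ν) := hh.mul_prod hf
    have h2 := h1.bdd_mul (c := C) hk.measurable.aestronglyMeasurable
      (ae_of_all _ fun z => hk.bound z)
    refine h2.congr (ae_of_all _ fun z => ?_)
    simp only [Function.uncurry]
    ring

/-- Hellinger-Toeplitz: a symmetric operator defined on the whole Hilbert space is bounded. -/
lemma continuous_opLin (hk : IsBoundedKernel k C) : Continuous (hk.opLin ν) :=
  hk.isSymmetric_opLin.continuous

end IsBoundedKernel

/-- A vector at which a nonnegative symmetric form vanishes lies in the kernel of the operator. -/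
lemma eq_smul_of_isMax {H : Type*} [NormedAddCommGroup H] [InnerProductSpace ℝ H]
    {T : H →ₗ[ℝ] H} (hT : T.IsSymmetric) {L : ℝ} (hL : ∀ h, inner ℝ h (T h) ≤ L * ‖h‖ ^ 2) {h : H}
    (heq : inner ℝ h (T h) = L * ‖h‖ ^ 2) : T h = L • h := by
  set v := L • h - T h with hv
  -- The form `L‖·‖² - ⟨·, T ·⟩` is nonnegative and vanishes at `h`; along `h + t v` with `v = L h -
  -- T h` it has linear coefficient `2‖v‖²`.
  have hsq : ∀ t : ℝ, 0 ≤ 2 * t * ‖v‖ ^ 2 + t ^ 2 * (L * ‖v‖ ^ 2 - inner ℝ v (T v)) := by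
    intro t
    have h1 := hL (h + t • v)
    have h2 : inner ℝ v (T h) = inner ℝ h (T v) := by rw [← hT, real_inner_comm]
    have h3 : ‖v‖ ^ 2 = L * inner ℝ h v - inner ℝ h (T v) := by
      rw [← real_inner_self_eq_norm_sq]
      conv_lhs => rw [hv]
      rw [← hv, inner_sub_left, inner_smul_left, hT]
      rfl
    rw [norm_add_sq_real, map_add, map_smul, inner_add_left, inner_add_right, inner_add_right,
      inner_smul_left, inner_smul_left, inner_smul_right, inner_smul_right, norm_smul,
      inner_smul_right, h2, heq] at h1
    simp only [conj_trivial, mul_pow, Real.norm_eq_abs, sq_abs] at h1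
    have h4 : 2 * t * ‖v‖ ^ 2 = 2 * t * (L * inner ℝ h v - inner ℝ h (T v)) :=
      congrArg (2 * t * ·) h3
    linarith
  set b := L * ‖v‖ ^ 2 - inner ℝ v (T v) with hb
  have hb0 : 0 ≤ b := sub_nonneg.2 (hL v)
  -- A negative step close to the minimizer; `b + 1` in place of `b` covers `b = 0`.
  have h4 := hsq (-‖v‖ ^ 2 / (b + 1))
  have h5 : 2 * (-‖v‖ ^ 2 / (b + 1)) * ‖v‖ ^ 2 + (-‖v‖ ^ 2 / (b + 1)) ^ 2 * b =
      -(‖v‖ ^ 2) ^ 2 * (b + 2) / (b + 1) ^ 2 := by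
    field_simp
    ring
  rw [h5] at h4
  have h6 : ‖v‖ = 0 := by
    by_contra hne
    have : 0 < ‖v‖ := lt_of_le_of_ne (norm_nonneg _) (Ne.symm hne)
    have h7 : -(‖v‖ ^ 2) ^ 2 * (b + 2) / (b + 1) ^ 2 < 0 := by
      rw [neg_mul, neg_div]
      exact neg_neg_of_pos (by positivity)
    linarith
  exact (sub_eq_zero.1 (norm_eq_zero.1 h6)).symm

/-- The quadratic form of a bounded symmetric kernel attains its maximum on the unit ball. -/
lemma IsBoundedKernel.exists_max [IsFiniteMeasure ν] [MeasureTheory.IsSeparable ν]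
    (hk : IsBoundedKernel k C) (hpos : ∃ h : Lp ℝ 2 ν, 0 < inner ℝ h (hk.opLin ν h)) :
    ∃ L : ℝ, (∃ f : Lp ℝ 2 ν, f ≠ 0 ∧ hk.opLin ν f = L • f) ∧
      ∀ h : Lp ℝ 2 ν, inner ℝ h (hk.opLin ν h) ≤ L * ‖h‖ ^ 2 := by
  have : Fact ((2 : ℝ≥0∞) ≠ ∞) := ⟨by norm_num⟩
  set T : Lp ℝ 2 ν →L[ℝ] Lp ℝ 2 ν := ⟨hk.opLin ν, hk.continuous_opLin⟩ with hT
  have hTapp : ∀ f, T f = hk.opLin ν f := fun f => rfl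
  set S : Set ℝ := (fun f : Lp ℝ 2 ν => inner ℝ f (T f)) '' Metric.closedBall 0 1 with hS
  have hSne : S.Nonempty := ⟨_, 0, by simp, rfl⟩
  have hSb : BddAbove S := by
    refine ⟨‖T‖, ?_⟩
    rintro _ ⟨f, hf, rfl⟩
    rw [mem_closedBall_zero_iff] at hf
    have h1 := real_inner_le_norm f (T f)
    have h2 := T.le_opNorm f
    have h3 := norm_nonneg f
    have h4 : ‖f‖ * ‖T f‖ ≤ 1 * (‖T‖ * 1) := by gcongr; exact h2.trans (by gcongr)
    change inner ℝ f (T f) ≤ ‖T‖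
    linarith
  set L := sSup S with hL
  have hbound : ∀ h : Lp ℝ 2 ν, inner ℝ h (hk.opLin ν h) ≤ L * ‖h‖ ^ 2 := by
    intro h
    by_cases h0 : h = 0
    · simp [h0]
    have hn : 0 < ‖h‖ := norm_pos_iff.2 h0
    have h1 : inner ℝ (‖h‖⁻¹ • h) (T (‖h‖⁻¹ • h)) ≤ L := by
      refine le_csSup hSb ⟨_, ?_, rfl⟩
      rw [mem_closedBall_zero_iff, norm_smul, norm_inv, norm_norm, inv_mul_cancel₀ hn.ne']
    rw [map_smul, inner_smul_left, inner_smul_right] at h1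
    simp only [conj_trivial] at h1
    rw [← hTapp]
    have h2 : inner ℝ h (T h) = ‖h‖ ^ 2 * (‖h‖⁻¹ * (‖h‖⁻¹ * inner ℝ h (T h))) := by
      field_simp
    rw [h2, mul_comm L]
    exact mul_le_mul_of_nonneg_left h1 (by positivity)
  have hLpos : 0 < L := by
    obtain ⟨h, hh⟩ := hpos
    by_contra hneg
    have := hbound h
    nlinarith [sq_nonneg ‖h‖]
  obtain ⟨u, -, hu, hmem⟩ := exists_seq_tendsto_sSup hSne hSb
  choose F hFball hFu using hmem
  -- A maximizing sequence has a weakly convergent subsequence, because the unit ball of the dual of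
  -- the separable space `L²` is weak-* sequentially compact.
  have hFn : ∀ n, ‖F n‖ ≤ 1 := fun n => mem_closedBall_zero_iff.1 (hFball n)
  obtain ⟨ℓ, hℓ, ψ, hψ, hlim⟩ := WeakDual.isSeqCompact_closedBall ℝ (Lp ℝ 2 ν) 0 1
    (x := fun n => StrongDual.toWeakDual (InnerProductSpace.toDual ℝ (Lp ℝ 2 ν) (F n))) (fun n => by
      change InnerProductSpace.toDual ℝ (Lp ℝ 2 ν) (F n) ∈ Metric.closedBall 0 1
      rw [mem_closedBall_zero_iff, LinearIsometryEquiv.norm_map]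
      exact hFn n)
  set f : Lp ℝ 2 ν := (InnerProductSpace.toDual ℝ (Lp ℝ 2 ν)).symm (WeakDual.toStrongDual ℓ) with hf
  have hfn : ‖f‖ ≤ 1 := by
    rw [hf, LinearIsometryEquiv.norm_map]
    exact mem_closedBall_zero_iff.1 hℓ
  have hweak : ∀ h, Tendsto (fun n => inner ℝ (F (ψ n)) h) atTop (𝓝 (inner ℝ f h)) := by
    intro h
    have h1 := ((WeakDual.eval_continuous h).tendsto ℓ).comp hlim
    have h2 : inner ℝ f h = ℓ h := by
      rw [hf, InnerProductSpace.toDual_symm_apply]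
      rfl
    rw [h2]
    exact h1
  have hpt : ∀ x, Tendsto (fun n => ∫ y, k (x, y) * F (ψ n) y ∂ν) atTop
      (𝓝 (∫ y, k (x, y) * f y ∂ν)) := by
    intro x
    simp only [hk.integral_eq_inner]
    simpa only [real_inner_comm] using hweak (hk.sec ν x)
  obtain ⟨R, hR⟩ := hk.exists_norm_sec_le ν
  have hptb : ∀ (h : Lp ℝ 2 ν), ‖h‖ ≤ 1 → ∀ x, |∫ y, k (x, y) * h y ∂ν| ≤ |R| := by
    intro h hh x
    rw [hk.integral_eq_inner]
    refine (abs_real_inner_le_norm _ _).trans ?_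
    have h1 := (hR x).trans (le_abs_self R)
    have h2 := norm_nonneg h
    have h3 := abs_nonneg R
    nlinarith [norm_nonneg (hk.sec ν x)]
  -- Compactness of the operator by hand: the image at `x` is an inner product with a section of the
  -- kernel, so weak convergence gives pointwise convergence. The images are uniformly bounded and
  -- the measure is finite, so dominated convergence makes the convergence strong.
  have hstrong : Tendsto (fun n => ‖T (F (ψ n)) - T f‖ ^ 2) atTop (𝓝 0) := by
    have h1 : ∀ n, ‖T (F (ψ n)) - T f‖ ^ 2 =
        ∫ x, ((∫ y, k (x, y) * F (ψ n) y ∂ν) - ∫ y, k (x, y) * f y ∂ν) ^ 2 ∂ν := by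
      intro n
      rw [← real_inner_self_eq_norm_sq, L2.inner_def]
      refine integral_congr_ae ?_
      filter_upwards [Lp.coeFn_sub (T (F (ψ n))) (T f), hk.coeFn_opLin (F (ψ n)),
        hk.coeFn_opLin f] with x e1 e2 e3
      rw [e1, Pi.sub_apply, hTapp, hTapp, e2, e3]
      simp [pow_two]
    simp only [h1]
    have h2 := tendsto_integral_of_dominated_convergence (μ := ν) (fun _ => (|R| + |R|) ^ 2)
      (F := fun n x => ((∫ y, k (x, y) * F (ψ n) y ∂ν) - ∫ y, k (x, y) * f y ∂ν) ^ 2)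
      (f := fun _ => (0 : ℝ))
      (fun n => (((hk.stronglyMeasurable_apply _).sub
        (hk.stronglyMeasurable_apply _)).pow 2).aestronglyMeasurable) (integrable_const _)
      (fun n => ae_of_all _ fun x => by
        rw [Real.norm_eq_abs, abs_pow]
        refine pow_le_pow_left₀ (abs_nonneg _) ?_ 2
        exact (abs_sub _ _).trans (add_le_add (hptb _ (hFn _) x) (hptb _ hfn x)))
      (ae_of_all _ fun x => by
        have := ((hpt x).sub_const (∫ y, k (x, y) * f y ∂ν)).pow 2
        simpa using this)
    simpa using h2
  have hstrong' : Tendsto (fun n => ‖T (F (ψ n)) - T f‖) atTop (𝓝 0) := by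
    have := hstrong.sqrt
    simpa [Real.sqrt_sq] using this
  have hinner : Tendsto (fun n => inner ℝ (F (ψ n)) (T (F (ψ n)))) atTop
      (𝓝 (inner ℝ f (T f))) := by
    have h1 : Tendsto (fun n => inner ℝ (F (ψ n)) (T (F (ψ n)) - T f)) atTop (𝓝 0) := by
      refine squeeze_zero_norm (fun n => ?_) hstrong'
      rw [Real.norm_eq_abs]
      refine (abs_real_inner_le_norm _ _).trans ?_
      have := hFn (ψ n)
      have h3 := norm_nonneg (T (F (ψ n)) - T f)
      nlinarith
    have h2 := (hweak (T f)).add h1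
    rw [add_zero] at h2
    refine h2.congr fun n => ?_
    rw [← inner_add_right]
    congr 1
    abel
  have hval : inner ℝ f (T f) = L := by
    refine tendsto_nhds_unique hinner ?_
    have := hu.comp hψ.tendsto_atTop
    refine this.congr fun n => ?_
    exact (hFu (ψ n)).symm
  have hf0 : f ≠ 0 := by
    rintro h0
    rw [h0] at hval
    simp at hval
    linarith
  -- As `L > 0` and the form at the limit equals `L`, no norm is lost in the weak limit.
  have hfn1 : L * ‖f‖ ^ 2 = L := by
    have h1 := hbound f
    rw [← hTapp, hval] at h1
    have h2 : ‖f‖ ^ 2 ≤ 1 := pow_le_one₀ (norm_nonneg _) hfn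
    nlinarith
  exact ⟨L, ⟨f, hf0, eq_smul_of_isMax hk.isSymmetric_opLin hbound (by rw [hfn1, ← hval, hTapp])⟩,
    hbound⟩

end BoundedKernel

/-! ### Admissible reference measures -/

section Admissible

variable {d : ℕ} {m : Measure (Space d)}

lemma IsAdmissible.sigmaFinite (hm : IsAdmissible m) : SigmaFinite m := by
  rcases hm with h | ⟨ψ, -, rfl⟩
  · infer_instance
  · exact SigmaFinite.withDensity_ofReal _

lemma IsAdmissible.lt_top_of_isCompact (hm : IsAdmissible m) {K : Set (Space d)}
    (hK : IsCompact K) : m K < ⊤ := by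
  rcases hm with h | ⟨ψ, -, rfl⟩
  · exact measure_lt_top _ _
  · rw [withDensity_apply _ hK.measurableSet]
    refine (setLIntegral_mono measurable_const (g := fun _ => ENNReal.ofReal ‖ψ‖) fun x _ =>
      ENNReal.ofReal_le_ofReal ((le_abs_self _).trans (ψ.norm_coe_le_norm x))).trans_lt ?_
    rw [setLIntegral_const]
    exact ENNReal.mul_lt_top ENNReal.ofReal_lt_top hK.measure_lt_top

end Admissible

/-! ### Nonnegative square-integrable functions -/

lemma exists_lp_of_lintegral_mul_self {X : Type*} [MeasurableSpace X] {ν : Measure X}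
    {f : X → ℝ≥0∞} (hf : Measurable f) (h : ∫⁻ x, f x * f x ∂ν ≠ ⊤) :
    ∃ F : Lp ℝ 2 ν, (∀ᵐ x ∂ν, 0 ≤ F x) ∧ (∀ᵐ x ∂ν, f x = ENNReal.ofReal (F x)) ∧
      ∫⁻ x, f x * f x ∂ν = ENNReal.ofReal (‖F‖ ^ 2) := by
  have hft : ∀ᵐ x ∂ν, f x ≠ ⊤ := by
    filter_upwards [ae_lt_top (hf.mul hf) h] with x hx h'
    simp [h'] at hx
  have hsq : ∀ᵐ x ∂ν, f x * f x = ENNReal.ofReal ((f x).toReal ^ 2) := by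
    filter_upwards [hft] with x hx
    rw [pow_two, ENNReal.ofReal_mul ENNReal.toReal_nonneg, ENNReal.ofReal_toReal hx]
  have hint : Integrable (fun x => (f x).toReal ^ 2) ν := by
    refine ⟨(hf.ennreal_toReal.pow_const 2).aestronglyMeasurable, ?_⟩
    rw [hasFiniteIntegral_iff_ofReal (ae_of_all _ fun x => by positivity),
      ← lintegral_congr_ae hsq]
    exact h.lt_top
  have hmem : MemLp (fun x => (f x).toReal) 2 ν :=
    (memLp_two_iff_integrable_sq hf.ennreal_toReal.aestronglyMeasurable).2 hint
  refine ⟨hmem.toLp _, ?_, ?_, ?_⟩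
  · filter_upwards [hmem.coeFn_toLp] with x hx
    rw [hx]
    exact ENNReal.toReal_nonneg
  · filter_upwards [hmem.coeFn_toLp, hft] with x hx hx'
    rw [hx, ENNReal.ofReal_toReal hx']
  · rw [← real_inner_self_eq_norm_sq, L2.inner_def, lintegral_congr_ae hsq,
      ← ofReal_integral_eq_lintegral_ofReal hint (ae_of_all _ fun x => by positivity)]
    congr 1
    refine integral_congr_ae ?_
    filter_upwards [hmem.coeFn_toLp] with x hx
    rw [hx]
    simp [pow_two]

/-! ### The operator on a compact domain -/

section CompactDomain

variable {d : ℕ} {β : ℝ} {m : Measure (Space d)} {W : Space d → ℝ≥0∞}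
  {g : Space d → Space d → ℝ} {f φ : Space d → ℝ≥0∞} {a lam : ℝ}

/-- The kernel of the operator, as a real function. -/
def kernReal (β : ℝ) (W : Space d → ℝ≥0∞) (g : Space d → Space d → ℝ) (z : Space d × Space d) : ℝ :=
  (kern β W g z).toReal

lemma opIntegrand_eq (hM : IsModel β W g) (u : Space d → ℝ) (x y : Space d) :
    opIntegrand β W g u x y = kernReal β W g (x, y) * u y := by
  rw [opIntegrand, kernReal, hM.toReal_kern]
  ring

variable [hβ : Fact (0 < β)]

lemma kern_eq_zero (hM : IsModel β W g) (hW : IsTrap W) {x y : Space d} (h : W x = ⊤ ∨ W y = ⊤) :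
    kern β W g (x, y) = 0 := by
  rw [kern, bridgeWeight_eq_zero hM.bridgeExists hW h, mul_zero]

lemma IsModel.exists_isBoundedKernel (hM : IsModel β W g) :
    ∃ C, IsBoundedKernel (kernReal β W g) C := by
  obtain ⟨C, hC⟩ := hM.g_bdd
  refine ⟨C, hM.measurable_kern.ennreal_toReal, fun z => ?_, fun x y => ?_⟩
  · rw [kernReal, abs_of_nonneg ENNReal.toReal_nonneg, hM.toReal_kern z.1 z.2]
    have h1 : (bridgeWeight β W z.1 z.2).toReal ≤ 1 := by
      have := ENNReal.toReal_mono ENNReal.one_ne_top (bridgeWeight_le_one hM.bridgeExists W z.1 z.2)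
      simpa using this
    have h2 := hM.g_pos z.1 z.2
    have h3 := hC z.1 z.2
    nlinarith
  · rw [kernReal, kernReal, hM.kern_swap]

/-- The kernel vanishes as soon as one argument leaves the domain, so extension by zero preserves
the eigenvalue equation. -/
lemma isEigenfunction_indicator (hM : IsModel β W g) (hW : IsTrap W) {C : ℝ}
    (hk : IsBoundedKernel (kernReal β W g) C) [IsFiniteMeasure (m.restrict {x | W x ≠ ⊤})]
    {F : Lp ℝ 2 (m.restrict {x | W x ≠ ⊤})} (hF : F ≠ 0)
    (heig : hk.opLin (m.restrict {x | W x ≠ ⊤}) F = a • F) :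
    IsEigenfunction β m W g a ({x | W x ≠ ⊤}.indicator F) := by
  have hD : MeasurableSet {x | W x ≠ ⊤} := hW.isClosed_domain.measurableSet
  have hop : ∀ x, opIntegrand β W g ({x | W x ≠ ⊤}.indicator F) x =
      {x | W x ≠ ⊤}.indicator fun y => kernReal β W g (x, y) * F y := by
    intro x
    funext y
    rw [opIntegrand_eq hM]
    by_cases hy : y ∈ {x | W x ≠ ⊤}
    · rw [Set.indicator_of_mem hy, Set.indicator_of_mem hy]
    · rw [Set.indicator_of_notMem hy, Set.indicator_of_notMem hy, mul_zero]
  refine ⟨(memLp_indicator_iff_restrict hD).2 (Lp.memLp F), fun h0 => hF ?_, ?_⟩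
  · rw [Lp.eq_zero_iff_ae_eq_zero]
    filter_upwards [ae_restrict_of_ae h0, ae_restrict_mem hD] with x hx hxD
    rwa [Set.indicator_of_mem hxD] at hx
  · have h1 : ∀ᵐ x ∂m, x ∈ {x | W x ≠ ⊤} →
        ∫ y in {x | W x ≠ ⊤}, kernReal β W g (x, y) * F y ∂m = a * F x := by
      rw [← ae_restrict_iff' hD]
      filter_upwards [hk.coeFn_opLin F, Lp.coeFn_smul a F] with x e1 e2
      rw [← e1, heig, e2]
      rfl
    filter_upwards [h1] with x hx
    rw [hop, integrable_indicator_iff hD, integral_indicator hD]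
    refine ⟨?_, ?_⟩
    · exact ((Lp.memLp F).integrable (by norm_num)).bdd_mul (c := C)
        (hk.measurable.comp measurable_prodMk_left).aestronglyMeasurable
        (ae_of_all _ fun y => hk.bound _)
    · by_cases hxD : x ∈ {x | W x ≠ ⊤}
      · rw [hx hxD, Set.indicator_of_mem hxD]
      · have h0 : ∀ y, kernReal β W g (x, y) * F y = 0 := fun y => by
          rw [kernReal, kern_eq_zero hM hW (Or.inl (not_not.1 hxD)), ENNReal.toReal_zero, zero_mul]
        simp only [h0, integral_zero]
        rw [Set.indicator_of_notMem hxD, mul_zero]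

lemma form_eq_ofReal_inner (hM : IsModel β W g) (hW : IsTrap W) {C : ℝ}
    (hk : IsBoundedKernel (kernReal β W g) C) [IsFiniteMeasure (m.restrict {x | W x ≠ ⊤})]
    {F : Lp ℝ 2 (m.restrict {x | W x ≠ ⊤})}
    (hF0 : ∀ᵐ x ∂(m.restrict {x | W x ≠ ⊤}), 0 ≤ F x)
    (hF : ∀ᵐ x ∂(m.restrict {x | W x ≠ ⊤}), f x = ENNReal.ofReal (F x)) :
    form β m W g f = ENNReal.ofReal (inner ℝ F (hk.opLin (m.restrict {x | W x ≠ ⊤}) F)) := by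
  have hD : MeasurableSet {x | W x ≠ ⊤} := hW.isClosed_domain.measurableSet
  have hop : ∀ x, opE β m W g f x = ENNReal.ofReal
      (∫ y, kernReal β W g (x, y) * F y ∂(m.restrict {x | W x ≠ ⊤})) := by
    intro x
    have h1 : opE β m W g f x = ∫⁻ y, f y * kern β W g (x, y) ∂(m.restrict {x | W x ≠ ⊤}) := by
      rw [opE, ← lintegral_indicator hD]
      refine lintegral_congr fun y => ?_
      by_cases hy : y ∈ {x | W x ≠ ⊤}
      · rw [Set.indicator_of_mem hy]
      · rw [Set.indicator_of_notMem hy, kern_eq_zero hM hW (Or.inr (not_not.1 hy)), mul_zero]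
    rw [h1, ofReal_integral_eq_lintegral_ofReal]
    · refine lintegral_congr_ae ?_
      filter_upwards [hF] with y hy
      rw [hy, kernReal, ENNReal.ofReal_mul ENNReal.toReal_nonneg,
        ENNReal.ofReal_toReal (hM.kern_ne_top _), mul_comm]
    · exact ((Lp.memLp F).integrable (by norm_num)).bdd_mul (c := C)
        (hk.measurable.comp measurable_prodMk_left).aestronglyMeasurable
        (ae_of_all _ fun y => hk.bound _)
    · filter_upwards [hF0] with y hy
      exact mul_nonneg ENNReal.toReal_nonneg hy
  have h2 : form β m W g f = ∫⁻ x, f x * opE β m W g f x ∂(m.restrict {x | W x ≠ ⊤}) := by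
    rw [form, ← lintegral_indicator hD]
    refine lintegral_congr fun x => ?_
    by_cases hx : x ∈ {x | W x ≠ ⊤}
    · rw [Set.indicator_of_mem hx]
    · have h0 : opE β m W g f x = 0 := by
        simp only [opE, kern_eq_zero hM hW (Or.inl (not_not.1 hx)), mul_zero, lintegral_zero]
      rw [Set.indicator_of_notMem hx, h0, mul_zero]
  rw [h2, L2.inner_def, ofReal_integral_eq_lintegral_ofReal (L2.integrable_inner _ _)]
  · refine lintegral_congr_ae ?_
    filter_upwards [hF, hF0, hk.coeFn_opLin F] with x e1 e2 e3
    rw [e1, hop x, e3, ← ENNReal.ofReal_mul e2]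
    simp [mul_comm]
  · filter_upwards [hF0, hk.coeFn_opLin F] with x e2 e3
    rw [e3]
    have : 0 ≤ ∫ y, kernReal β W g (x, y) * F y ∂(m.restrict {x | W x ≠ ⊤}) := by
      refine integral_nonneg_of_ae ?_
      filter_upwards [hF0] with y hy
      exact mul_nonneg ENNReal.toReal_nonneg hy
    simpa using mul_nonneg this e2

/-- On a compact domain the largest eigenvalue bounds the quadratic form. -/
lemma inner_opLin_le (hM : IsModel β W g) (hW : IsTrap W) {C : ℝ}
    (hk : IsBoundedKernel (kernReal β W g) C) [IsFiniteMeasure (m.restrict {x | W x ≠ ⊤})]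
    (hprincipal : IsPrincipalEigenvalue β m W g lam) (hφ : Measurable φ)
    (hφ1 : ∫⁻ x, φ x * φ x ∂m = 1) (hform : form β m W g φ ≠ 0)
    (h : Lp ℝ 2 (m.restrict {x | W x ≠ ⊤})) :
    inner ℝ h (hk.opLin (m.restrict {x | W x ≠ ⊤}) h) ≤ lam * ‖h‖ ^ 2 := by
  obtain ⟨F, hF0, hF, -⟩ := exists_lp_of_lintegral_mul_self
    (ν := m.restrict {x | W x ≠ ⊤}) hφ
    (((setLIntegral_le_lintegral _ _).trans_lt (hφ1.trans_lt ENNReal.one_lt_top)).ne)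
  rw [form_eq_ofReal_inner hM hW hk hF0 hF, Ne, ENNReal.ofReal_eq_zero, not_le] at hform
  -- The ground state makes the form positive somewhere, so its maximum is attained and is an
  -- eigenvalue, hence at most `lam`.
  obtain ⟨L, ⟨G, hG0, hG⟩, hL⟩ := hk.exists_max ⟨F, hform⟩
  have hLlam : L ≤ lam := hprincipal.2 ⟨_, isEigenfunction_indicator hM hW hk hG0 hG⟩
  exact (hL h).trans (mul_le_mul_of_nonneg_right hLlam (sq_nonneg _))

/-- Only the restriction of `f` to the domain enters the form, and its norm is at most `1`. Equality
makes the norm exactly `1`: then `f` vanishes off the domain and its restriction maximizes the form,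
so it is an eigenvector. -/
lemma form_le_of_compact (hM : IsModel β W g) (hW : IsTrap W)
    [IsFiniteMeasure (m.restrict {x | W x ≠ ⊤})] (hlam : 0 < lam)
    (hprincipal : IsPrincipalEigenvalue β m W g lam) (hφ : Measurable φ)
    (hφ1 : ∫⁻ x, φ x * φ x ∂m = 1) (hform : form β m W g φ ≠ 0)
    (hf : Measurable f) (hf1 : ∫⁻ x, f x * f x ∂m = 1) :
    form β m W g f ≤ ENNReal.ofReal lam ∧ (form β m W g f = ENNReal.ofReal lam →
      ∃ u : Space d → ℝ, IsEigenfunction β m W g lam u ∧ ∀ᵐ x ∂m, 0 ≤ u x ∧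
        f x = ENNReal.ofReal (u x)) := by
  have hD : MeasurableSet {x | W x ≠ ⊤} := hW.isClosed_domain.measurableSet
  obtain ⟨C, hk⟩ := hM.exists_isBoundedKernel
  have hb := inner_opLin_le hM hW hk hprincipal hφ hφ1 hform
  have hle : ∫⁻ x in {x | W x ≠ ⊤}, f x * f x ∂m ≤ 1 := (setLIntegral_le_lintegral _ _).trans hf1.le
  obtain ⟨F, hF0, hF, hFn⟩ := exists_lp_of_lintegral_mul_self
    (ν := m.restrict {x | W x ≠ ⊤}) hf (hle.trans_lt ENNReal.one_lt_top).ne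
  have hn : ‖F‖ ^ 2 ≤ 1 := by
    rwa [hFn, ENNReal.ofReal_le_one] at hle
  rw [form_eq_ofReal_inner hM hW hk hF0 hF]
  refine ⟨ENNReal.ofReal_le_ofReal ((hb F).trans ?_), fun heq => ?_⟩
  · nlinarith
  · have hpos := ENNReal.ofReal_pos.1 (heq ▸ ENNReal.ofReal_pos.2 hlam)
    rw [ENNReal.ofReal_eq_ofReal_iff hpos.le hlam.le] at heq
    have hn1 : ‖F‖ ^ 2 = 1 := by
      have := hb F
      rw [heq] at this
      nlinarith
    have hne : F ≠ 0 := by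
      rintro rfl
      simp at hn1
    refine ⟨_, isEigenfunction_indicator hM hW hk hne
      (eq_smul_of_isMax hk.isSymmetric_opLin hb (by rw [heq, hn1, mul_one])), ?_⟩
    have hcompl : ∫⁻ x in {x | W x ≠ ⊤}ᶜ, f x * f x ∂m = 0 := by
      have h1 := lintegral_add_compl (μ := m) (fun x => f x * f x) hD
      rw [hFn, hn1, ENNReal.ofReal_one, hf1] at h1
      exact (ENNReal.add_right_inj ENNReal.one_ne_top).1 (h1.trans (add_zero 1).symm)
    rw [lintegral_eq_zero_iff (show Measurable fun x => f x * f x from hf.mul hf)] at hcompl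
    have h1 := (ae_restrict_iff' hD).1 (hF0.and hF)
    have h2 := (ae_restrict_iff' hD.compl).1 hcompl
    filter_upwards [h1, h2] with x e1 e2
    by_cases hx : x ∈ {x | W x ≠ ⊤}
    · rw [Set.indicator_of_mem hx]
      exact e1 hx
    · rw [Set.indicator_of_notMem hx, ENNReal.ofReal_zero]
      exact ⟨le_rfl, by simpa using e2 hx⟩

end CompactDomain

/-! ### The principal eigenfunction -/

section Principal

variable {d : ℕ} {β : ℝ} {m : Measure (Space d)} {W : Space d → ℝ≥0∞}
  {g : Space d → Space d → ℝ} {lam : ℝ} {φ : Space d → ℝ} {f p : Space d → ℝ≥0∞}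

/-- Existence of the Brownian bridge follows from the spectral assumption: without a bridge the
default value of `bridge` is `0`, so `T = 0` has no positive eigenvalue. -/
lemma bridgeExists_of_isEigenfunction (hlam : 0 < lam)
    (hφ : IsEigenfunction β m W g lam φ) : BridgeExists d β := by
  by_contra hex
  refine hφ.ne_zero ?_
  have h0 : ∀ x y, opIntegrand β W g φ x y = 0 := fun x y => by
    simp [opIntegrand, bridgeWeight, bridge_eq_zero hex]
  filter_upwards [hφ.eigen] with x hx
  have := hx.2
  simp only [h0, integral_zero] at this
  exact (mul_eq_zero.1 this.symm).resolve_left hlam.ne'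

/-- A measurable version, with values in `[0, ∞]`, of a normalized nonnegative eigenfunction. -/
structure IsGroundState (β : ℝ) (m : Measure (Space d)) (W : Space d → ℝ≥0∞)
    (g : Space d → Space d → ℝ) (lam : ℝ) (p : Space d → ℝ≥0∞) : Prop where
  measurable : Measurable p
  eigen : ∀ᵐ x ∂m, opE β m W g p x = ENNReal.ofReal lam * p x
  lintegral_mul_self : ∫⁻ x, p x * p x ∂m = 1

lemma exists_isGroundState (hM : IsModel β W g) (hlam : 0 < lam) (hφ0 : ∀ x, 0 ≤ φ x)
    (hφ : IsEigenfunction β m W g lam φ) (hφ1 : ∫ x, φ x ^ 2 ∂m = 1) :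
    ∃ p : Space d → ℝ≥0∞, IsGroundState β m W g lam p ∧ ∀ᵐ x ∂m, p x = ENNReal.ofReal (φ x) := by
  have hae : ∀ᵐ x ∂m, ENNReal.ofReal (hφ.memLp.1.mk φ x) = ENNReal.ofReal (φ x) := by
    filter_upwards [hφ.memLp.1.ae_eq_mk] with x hx
    rw [← hx]
  refine ⟨fun x => ENNReal.ofReal (hφ.memLp.1.mk φ x),
    ⟨hφ.memLp.1.stronglyMeasurable_mk.measurable.ennreal_ofReal, ?_, ?_⟩, hae⟩
  · filter_upwards [hφ.eigen, hae] with x hx e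
    rw [e, ← ENNReal.ofReal_mul hlam.le, ← hx.2, ofReal_integral_eq_lintegral_ofReal hx.1
      (ae_of_all _ fun y => mul_nonneg (mul_nonneg (hφ0 y) ENNReal.toReal_nonneg)
        (hM.g_pos x y).le), opE]
    refine lintegral_congr_ae ?_
    filter_upwards [hae] with y hy
    rw [hy, opIntegrand_eq hM, kernReal, ENNReal.ofReal_mul ENNReal.toReal_nonneg,
      ENNReal.ofReal_toReal (hM.kern_ne_top _), mul_comm]
  · rw [← ENNReal.ofReal_one, ← hφ1, ofReal_integral_eq_lintegral_ofReal hφ.memLp.integrable_sq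
      (ae_of_all _ fun x => sq_nonneg _)]
    refine lintegral_congr_ae ?_
    filter_upwards [hae] with x hx
    rw [hx, pow_two, ENNReal.ofReal_mul (hφ0 x)]

lemma IsGroundState.form_eq (hp : IsGroundState β m W g lam p) :
    form β m W g p = ENNReal.ofReal lam := by
  have h1 : form β m W g p = ∫⁻ x, ENNReal.ofReal lam * (p x * p x) ∂m := by
    refine lintegral_congr_ae ?_
    filter_upwards [hp.eigen] with x hx
    rw [hx, mul_left_comm]
  rw [h1, lintegral_const_mul _ (show Measurable fun x => p x * p x from
    hp.measurable.mul hp.measurable), hp.lintegral_mul_self, mul_one]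

lemma IsGroundState.ae_ne_top (hp : IsGroundState β m W g lam p) : ∀ᵐ x ∂m, p x ≠ ⊤ :=
  ae_ne_top_of_lintegral_mul_self hp.measurable
    (by rw [hp.lintegral_mul_self]; exact ENNReal.one_ne_top)

variable [hβ : Fact (0 < β)]

/-- The largest eigenvalue bounds the quadratic form, and only the principal eigenfunction attains
the bound. -/
lemma form_le (hM : IsModel β W g) (hW : IsTrap W) (hm : IsAdmissible m) (hlam : 0 < lam)
    (hprincipal : IsPrincipalEigenvalue β m W g lam) (hφ0 : ∀ x, 0 ≤ φ x)
    (hp : IsGroundState β m W g lam p) (hpφ : ∀ᵐ x ∂m, p x = ENNReal.ofReal (φ x))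
    (hf : Measurable f) (hf1 : ∫⁻ x, f x * f x ∂m = 1) :
    form β m W g f ≤ ENNReal.ofReal lam ∧
      (form β m W g f = ENNReal.ofReal lam →
        ((∃ x, W x = ⊤) → ∀ u, IsEigenfunction β m W g lam u →
          ∃ c : ℝ, u =ᵐ[m] fun x => c * φ x) → f =ᵐ[m] p) := by
  have := hm.sigmaFinite
  by_cases hfin : ∃ x, W x = ⊤
  · have hcomp : IsCompact {x | W x ≠ ⊤} := by
      obtain ⟨x, hx⟩ := hfin
      refine (hW.domain.resolve_left fun h => ?_).1
      exact (h ▸ Set.mem_univ x : x ∈ {x | W x ≠ ⊤}) hx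
    have : IsFiniteMeasure (m.restrict {x | W x ≠ ⊤}) :=
      ⟨by rw [Measure.restrict_apply_univ]; exact hm.lt_top_of_isCompact hcomp⟩
    obtain ⟨h1, h2⟩ := form_le_of_compact hM hW hlam hprincipal hp.measurable
      hp.lintegral_mul_self (by rw [hp.form_eq]; exact (ENNReal.ofReal_pos.2 hlam).ne') hf hf1
    refine ⟨h1, fun heq hsimple => ?_⟩
    obtain ⟨u, hu, huf⟩ := h2 heq
    obtain ⟨c, hc⟩ := hsimple hfin u hu
    have hfp : ∀ᵐ x ∂m, f x = ENNReal.ofReal c * p x := by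
      filter_upwards [huf, hc, hpφ] with x e1 e2 e3
      rw [e1.2, e2, e3, ENNReal.ofReal_mul' (hφ0 x)]
    -- The scalar from simplicity may have either sign a priori; comparing norms fixes its positive
    -- part as `1`.
    have hc1 : ENNReal.ofReal c = 1 := by
      refine eq_one_of_mul_self_eq_one ?_
      have h3 : ∫⁻ x, f x * f x ∂m =
          ∫⁻ x, (ENNReal.ofReal c * ENNReal.ofReal c) * (p x * p x) ∂m := by
        refine lintegral_congr_ae ?_
        filter_upwards [hfp] with x hx
        rw [hx]
        ring
      rw [hf1, lintegral_const_mul _ (show Measurable fun x => p x * p x from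
        hp.measurable.mul hp.measurable), hp.lintegral_mul_self, mul_one] at h3
      exact h3.symm
    filter_upwards [hfp] with x hx
    rw [hx, hc1, one_mul]
  · push Not at hfin
    have hcont : Continuous W := by
      have := hW.continuousOn
      rw [show {x | W x ≠ ⊤} = Set.univ from Set.eq_univ_of_forall hfin] at this
      exact continuousOn_univ.1 this
    obtain ⟨h1, h2⟩ := schur_test hM (fun z => (hM.kern_ne_zero_iff z).2
      (bridgeWeight_pos hM.bridgeExists hcont hfin _ _).ne') hp.measurable hp.eigen
      ENNReal.ofReal_ne_top hp.lintegral_mul_self hf hf1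
    exact ⟨h1, fun heq _ => h2 heq⟩

lemma IsGroundState.ae_eq_zero (hM : IsModel β W g) (hW : IsTrap W) (hlam : 0 < lam)
    (hp : IsGroundState β m W g lam p) : ∀ᵐ x ∂m, W x = ⊤ → p x = 0 := by
  filter_upwards [hp.eigen] with x hx hxW
  have h0 : opE β m W g p x = 0 := by
    simp only [opE, kern_eq_zero hM hW (Or.inl hxW), mul_zero, lintegral_zero]
  rw [h0, eq_comm] at hx
  exact (mul_eq_zero.1 hx).resolve_left (ENNReal.ofReal_pos.2 hlam).ne'

/-- Under each bridge the prefactor at `z` equals the same prefactor at the endpoints of the path,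
so the mixture has a density over the unweighted mixture of bridges. -/
lemma mixture_eq_mix (hM : IsModel β W g) [SigmaFinite m] (hlam : 0 < lam) (hφ0 : ∀ x, 0 ≤ φ x)
    (hp : Measurable p) (hpφ : ∀ᵐ x ∂m, p x = ENNReal.ofReal (φ x)) :
    mixture β m W g lam φ = mix β m W g (ENNReal.ofReal lam) p := by
  have hex := hM.bridgeExists
  have := isMarkovKernel_bridgeKernel hex
  set w : Space d × Space d → ℝ≥0∞ := fun z =>
    (ENNReal.ofReal lam)⁻¹ * (p z.1 * p z.2) * ENNReal.ofReal (g z.1 z.2) with hw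
  have hwm : Measurable w :=
    (((hp.comp measurable_fst).mul (hp.comp measurable_snd)).const_mul _).mul
      hM.measurable_ofReal_g
  have hweight : Measurable (weight W : Path d β → ℝ≥0∞) := measurable_weight hM.measurable_W
  have hjoint : Measurable (Function.uncurry fun (z : Space d × Space d) (ω : Path d β) =>
      w z * weight W ω) := (hwm.comp measurable_fst).mul (hweight.comp measurable_snd)
  have hker : ∀ z, (bridgeKernel d β).withDensity (fun z ω => w z * weight W ω) z =
      w z • (bridge β z.1 z.2).withDensity (weight W) := fun z => by
    rw [Kernel.withDensity_apply _ hjoint, bridgeKernel_apply, ← withDensity_smul _ hweight]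
    rfl
  have h1 : mixture β m W g lam φ =
      (m.prod m).bind ((bridgeKernel d β).withDensity fun z ω => w z * weight W ω) := by
    rw [mixture]
    refine Measure.bind_congr_right ?_
    filter_upwards [Measure.quasiMeasurePreserving_fst.ae hpφ,
      Measure.quasiMeasurePreserving_snd.ae hpφ] with z e1 e2
    rw [hker z, hw]
    simp only
    rw [e1, e2, ENNReal.ofReal_mul (inv_nonneg.2 hlam.le), ENNReal.ofReal_inv_of_pos hlam,
      ENNReal.ofReal_mul (mul_nonneg (hφ0 _) (hφ0 _)), ENNReal.ofReal_mul (hφ0 _)]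
    simp only [mul_assoc]
  rw [h1]
  ext s hs
  have hd := hM.measurable_mix_density hp (ENNReal.ofReal lam)
  rw [Measure.bind_apply hs (Kernel.measurable _).aemeasurable, mix, withDensity_apply _ hs,
    ← lintegral_indicator hs, Measure.lintegral_bind (Kernel.measurable _).aemeasurable
      (hd.indicator hs).aemeasurable]
  refine lintegral_congr fun z => ?_
  rw [Kernel.withDensity_apply' _ hjoint, ← lintegral_indicator hs]
  refine lintegral_congr_ae ?_
  filter_upwards [ae_endpoints_eq hex z] with ω hω
  simp only [Set.indicator, hω, hw]

/-- The lower bound for the modified rate function and the case of equality. -/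
lemma neg_log_le_modifiedRate (hM : IsModel β W g) (hW : IsTrap W) (hm : IsAdmissible m)
    (hlam : 0 < lam) (hprincipal : IsPrincipalEigenvalue β m W g lam) (hφ0 : ∀ x, 0 ≤ φ x)
    (hp : IsGroundState β m W g lam p) (hpφ : ∀ᵐ x ∂m, p x = ENNReal.ofReal (φ x))
    (μ : Measure (Path d β)) [IsProbabilityMeasure μ] :
    ((-Real.log lam : ℝ) : EReal) ≤ modifiedRate m W g μ ∧
      (modifiedRate m W g μ = ((-Real.log lam : ℝ) : EReal) →
        ((∃ x, W x = ⊤) → ∀ u, IsEigenfunction β m W g lam u →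
          ∃ c : ℝ, u =ᵐ[m] fun x => c * φ x) → μ = mixture β m W g lam φ) := by
  have := hm.sigmaFinite
  by_cases htop : modifiedRate m W g μ = ⊤
  · rw [htop]
    exact ⟨le_top, fun h => absurd h.symm (EReal.coe_ne_top _)⟩
  obtain ⟨f, hf, hf1, hrate⟩ := rate_lower_bound hM htop
  obtain ⟨hle, heq⟩ := form_le hM hW hm hlam hprincipal hφ0 hp hpφ hf hf1
  have hft : form β m W g f ≠ ⊤ := ne_top_of_le_ne_top ENNReal.ofReal_ne_top hle
  obtain ⟨hf0, K, hK0, hK, hKeq⟩ := hrate hft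
  have hpos : 0 < (form β m W g f).toReal := ENNReal.toReal_pos hf0 hft
  have hlelam : (form β m W g f).toReal ≤ lam :=
    ENNReal.toReal_le_of_le_ofReal hlam.le hle
  have hlog := Real.log_le_log hpos hlelam
  refine ⟨le_trans (EReal.coe_le_coe_iff.2 (by linarith)) hK, fun h hsimple => ?_⟩
  -- From `K - log c ≤ -log lam`, `K ≥ 0` and `c ≤ lam`, both inequalities are equalities.
  rw [h, EReal.coe_le_coe_iff] at hK
  have hK00 : K = 0 := by linarith
  have hlogeq : Real.log (form β m W g f).toReal = Real.log lam := by linarith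
  have hform : form β m W g f = ENNReal.ofReal lam := by
    rw [← Real.log_injOn_pos hpos hlam hlogeq, ENNReal.ofReal_toReal hft]
  have hfp := heq hform hsimple
  have hfφ : ∀ᵐ x ∂m, f x = ENNReal.ofReal (φ x) := by
    filter_upwards [hfp, hpφ] with x e1 e2
    rw [e1, e2]
  rw [hKeq hK00, hform, mixture_eq_mix hM hlam hφ0 hf hfφ]

end Principal

/-! ### Upper bounds for the modified rate function -/

section UpperBound

variable {d : ℕ} {β : ℝ} {m : Measure (Space d)} {W : Space d → ℝ≥0∞}
  {g : Space d → Space d → ℝ} {lam : ℝ} {φ : Space d → ℝ} {f p : Space d → ℝ≥0∞}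

lemma opE_mono {f₁ f₂ : Space d → ℝ≥0∞} (h : ∀ x, f₁ x ≤ f₂ x) (x : Space d) :
    opE β m W g f₁ x ≤ opE β m W g f₂ x :=
  lintegral_mono fun y => mul_le_mul_left (h y) _

lemma form_mono {f₁ f₂ : Space d → ℝ≥0∞} (h : ∀ x, f₁ x ≤ f₂ x) :
    form β m W g f₁ ≤ form β m W g f₂ :=
  lintegral_mono fun x => mul_le_mul' (h x) (opE_mono h x)

lemma IsGroundState.integrable_sq (hp : IsGroundState β m W g lam p) :
    Integrable (fun x => (p x * p x).toReal) m :=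
  integrable_toReal_of_lintegral_ne_top
    (hp.measurable.mul hp.measurable : Measurable fun x => p x * p x).aemeasurable
    (by rw [hp.lintegral_mul_self]; exact ENNReal.one_ne_top)

lemma IsGroundState.integral_sq (hp : IsGroundState β m W g lam p) :
    ∫ x, (p x * p x).toReal ∂m = 1 := by
  rw [integral_toReal (show Measurable fun x => p x * p x from
    hp.measurable.mul hp.measurable).aemeasurable
    (hp.ae_ne_top.mono fun x hx => (ENNReal.mul_ne_top hx hx).lt_top), hp.lintegral_mul_self,
    ENNReal.toReal_one]

/-- The ratio of the operator applied to a truncation and the ground state. -/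
def truncRatio (β : ℝ) (m : Measure (Space d)) (W : Space d → ℝ≥0∞) (g : Space d → Space d → ℝ)
    (p : Space d → ℝ≥0∞) (B : Set (Space d)) (x : Space d) : ℝ :=
  (opE β m W g (B.indicator p) x / p x).toReal

/-- The density of the truncated entropy with respect to `m`. -/
def truncEntropy (β : ℝ) (m : Measure (Space d)) (W : Space d → ℝ≥0∞)
    (g : Space d → Space d → ℝ) (p : Space d → ℝ≥0∞) (B : Set (Space d)) : Space d → ℝ :=
  B.indicator fun x => (p x * p x).toReal *
    (truncRatio β m W g p B x * Real.log (truncRatio β m W g p B x))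

lemma opE_indicator_le (hp : IsGroundState β m W g lam p) (B : Set (Space d)) :
    ∀ᵐ x ∂m, opE β m W g (B.indicator p) x ≤ ENNReal.ofReal lam * p x := by
  filter_upwards [hp.eigen] with x hx
  rw [← hx]
  exact opE_mono (fun y => Set.indicator_le_self' (fun _ _ => zero_le) y) x

lemma truncRatio_mem (hlam : 0 < lam) (hp : IsGroundState β m W g lam p) (B : Set (Space d)) :
    ∀ᵐ x ∂m, truncRatio β m W g p B x ∈ Set.Icc 0 lam := by
  filter_upwards [opE_indicator_le hp B] with x hx
  exact ⟨ENNReal.toReal_nonneg, ENNReal.toReal_le_of_le_ofReal hlam.le (ENNReal.div_le_of_le_mul hx)⟩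

/-- The ratio stays in `[0, lam]`, where `t log t` is bounded. This gives an integrable majorant
that does not depend on the truncation set. -/
lemma exists_truncEntropy_le (hlam : 0 < lam) (hp : IsGroundState β m W g lam p) :
    ∃ M : ℝ, ∀ B : Set (Space d), ∀ᵐ x ∂m,
      ‖truncEntropy β m W g p B x‖ ≤ (p x * p x).toReal * M := by
  obtain ⟨M, hM⟩ := (isCompact_Icc (a := (0 : ℝ)) (b := lam)).exists_bound_of_continuousOn
    Real.continuous_mul_log.continuousOn
  refine ⟨M, fun B => ?_⟩
  filter_upwards [truncRatio_mem hlam hp B] with x hx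
  refine (norm_indicator_le_norm_self _ _).trans ?_
  rw [norm_mul, Real.norm_of_nonneg ENNReal.toReal_nonneg]
  exact mul_le_mul_of_nonneg_left (hM _ hx) ENNReal.toReal_nonneg

lemma measurable_truncEntropy (hM : IsModel β W g) [SFinite m] (hp : Measurable p)
    {B : Set (Space d)} (hB : MeasurableSet B) : Measurable (truncEntropy β m W g p B) := by
  have h1 : Measurable (truncRatio β m W g p B) :=
    ((hM.measurable_opE (hp.indicator hB)).div hp).ennreal_toReal
  exact ((hp.mul hp).ennreal_toReal.mul (h1.mul h1.log)).indicator hB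

lemma integrable_truncEntropy (hM : IsModel β W g) [SFinite m] (hlam : 0 < lam)
    (hp : IsGroundState β m W g lam p) {B : Set (Space d)} (hB : MeasurableSet B) :
    Integrable (truncEntropy β m W g p B) m := by
  obtain ⟨M, hM'⟩ := exists_truncEntropy_le hlam hp
  exact (hp.integrable_sq.mul_const M).mono'
    (measurable_truncEntropy hM hp.measurable hB).aestronglyMeasurable (hM' B)

/-! ### Exhaustion by balls -/

lemma eventually_mem_closedBall (x : Space d) :
    ∀ᶠ n : ℕ in atTop, x ∈ Metric.closedBall (0 : Space d) n := by
  obtain ⟨N, hN⟩ := exists_nat_ge ‖x‖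
  filter_upwards [eventually_ge_atTop N] with n hn
  rw [mem_closedBall_zero_iff]
  exact hN.trans (by exact_mod_cast hn)

lemma monotone_indicator_closedBall (p : Space d → ℝ≥0∞) (x : Space d) :
    Monotone fun n : ℕ => (Metric.closedBall (0 : Space d) n).indicator p x := fun i j hij =>
  Set.indicator_le_indicator_of_subset
    (Metric.closedBall_subset_closedBall (by exact_mod_cast hij)) (fun _ => zero_le) x

lemma eventually_indicator_closedBall (p : Space d → ℝ≥0∞) (x : Space d) :
    ∀ᶠ n : ℕ in atTop, (Metric.closedBall (0 : Space d) n).indicator p x = p x := by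
  filter_upwards [eventually_mem_closedBall x] with n hn
  exact Set.indicator_of_mem hn p

lemma tendsto_opE_indicator (hM : IsModel β W g) (hp : Measurable p) (x : Space d) :
    Tendsto (fun n : ℕ => opE β m W g ((Metric.closedBall (0 : Space d) n).indicator p) x) atTop
      (𝓝 (opE β m W g p x)) := by
  refine lintegral_tendsto_of_tendsto_of_monotone (fun n => ?_) (ae_of_all _ fun y => ?_)
    (ae_of_all _ fun y => ?_)
  · exact ((hp.indicator measurableSet_closedBall).mul
      (hM.measurable_kern.comp measurable_prodMk_left)).aemeasurable
  · exact fun i j hij => mul_le_mul_left (monotone_indicator_closedBall p y hij) _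
  · refine tendsto_const_nhds.congr' ?_
    filter_upwards [eventually_indicator_closedBall p y] with n hn
    rw [hn]

lemma tendsto_form_indicator (hM : IsModel β W g) [SFinite m]
    (hp : IsGroundState β m W g lam p) :
    Tendsto (fun n : ℕ => form β m W g ((Metric.closedBall (0 : Space d) n).indicator p)) atTop
      (𝓝 (ENNReal.ofReal lam)) := by
  rw [← hp.form_eq]
  refine lintegral_tendsto_of_tendsto_of_monotone (fun n => ?_) (ae_of_all _ fun y => ?_) ?_
  · have h := hp.measurable.indicator (measurableSet_closedBall (x := (0 : Space d)) (ε := n))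
    exact (h.mul (hM.measurable_opE h)).aemeasurable
  · exact fun i j hij => mul_le_mul' (monotone_indicator_closedBall p y hij)
      (opE_mono (fun z => monotone_indicator_closedBall p z hij) y)
  · filter_upwards [hp.ae_ne_top] with y hy
    refine (ENNReal.Tendsto.const_mul (tendsto_opE_indicator hM hp.measurable y)
      (Or.inr hy)).congr' ?_
    filter_upwards [eventually_indicator_closedBall p y] with n hn
    rw [hn]

lemma tendsto_integral_truncEntropy (hM : IsModel β W g) [SFinite m] (hlam : 0 < lam)
    (hp : IsGroundState β m W g lam p) :
    Tendsto (fun n : ℕ => ∫ x, truncEntropy β m W g p (Metric.closedBall (0 : Space d) n) x ∂m)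
      atTop (𝓝 (lam * Real.log lam)) := by
  obtain ⟨M, hMb⟩ := exists_truncEntropy_le hlam hp
  have hlim : ∫ x, (p x * p x).toReal * (lam * Real.log lam) ∂m = lam * Real.log lam := by
    rw [integral_mul_const, hp.integral_sq, one_mul]
  rw [← hlim]
  refine tendsto_integral_of_dominated_convergence (fun x => (p x * p x).toReal * M)
    (fun n => (measurable_truncEntropy hM hp.measurable
      measurableSet_closedBall).aestronglyMeasurable)
    (hp.integrable_sq.mul_const M) (fun n => hMb _) ?_
  filter_upwards [hp.eigen, hp.ae_ne_top] with x hx hxt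
  have hev : ∀ᶠ n : ℕ in atTop, (p x * p x).toReal *
      (truncRatio β m W g p (Metric.closedBall (0 : Space d) n) x *
        Real.log (truncRatio β m W g p (Metric.closedBall (0 : Space d) n) x)) =
      truncEntropy β m W g p (Metric.closedBall (0 : Space d) n) x := by
    filter_upwards [eventually_mem_closedBall x] with n hn
    rw [truncEntropy, Set.indicator_of_mem hn]
  refine Tendsto.congr' hev ?_
  -- At zeros of `p` the prefactor vanishes; elsewhere the eigenvalue equation makes the ratio tend
  -- to `lam`.
  by_cases h0 : p x = 0
  · simp [h0]
  have hratio : Tendsto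
      (fun n : ℕ => truncRatio β m W g p (Metric.closedBall (0 : Space d) n) x) atTop (𝓝 lam) := by
    have h1 := ENNReal.Tendsto.div_const (b := p x)
      (tendsto_opE_indicator (m := m) hM hp.measurable x) (Or.inr h0)
    rw [hx, ENNReal.mul_div_cancel_right h0 hxt] at h1
    have h2 := (ENNReal.tendsto_toReal ENNReal.ofReal_ne_top).comp h1
    rwa [ENNReal.toReal_ofReal hlam.le] at h2
  exact ((Real.continuous_mul_log.tendsto lam).comp hratio).const_mul _

/-! ### Mixtures of bridges -/

variable [hβ : Fact (0 < β)]

/-- The logarithm of the density of the endpoint law is bounded below in the mean if the mixture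
charges a set of finite measure only. -/
lemma negInt_llr_mix (hM : IsModel β W g) [SigmaFinite m] (hf : Measurable f)
    (hftop : ∀ᵐ x ∂m, f x ≠ ⊤) {c : ℝ≥0∞} (hc : form β m W g f = c) (hc0 : c ≠ 0) (hctop : c ≠ ⊤)
    {S : Set (Space d)} (hS : MeasurableSet S) (hmS : m S ≠ ⊤) (hfS : ∀ᵐ x ∂m, x ∉ S → f x = 0) :
    NegInt (endpointLaw (mix β m W g c f)) (llr (endpointLaw (mix β m W g c f))
      ((endpointLaw (mix β m W g c f)).fst.prod m)) := by
  have : IsProbabilityMeasure (mix β m W g c f) := by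
    have := hM.isProbabilityMeasure_mix (m := m) hf (hc ▸ hc0) (hc ▸ hctop)
    rwa [hc] at this
  have hqp := isProbabilityMeasure_endpointLaw (mix β m W g c f)
  refine negInt_llr (hM.rnDeriv_endpointLaw_mix hf hftop hc hc0 hctop).1
    (S := Set.univ ×ˢ S) (MeasurableSet.univ.prod hS) ?_ ?_
  · have h1 : ∀ᵐ z ∂(endpointLaw (mix β m W g c f)), z.2 ∉ S → f z.2 = 0 := by
      have h2 := Measure.quasiMeasurePreserving_snd (μ := m) (ν := m) |>.ae hfS
      rw [hM.endpointLaw_mix hf]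
      exact (withDensity_absolutelyContinuous _ _).ae_le h2
    rw [← mem_ae_iff]
    filter_upwards [h1, hM.ae_endpointLaw_mix hf hftop hc hc0 hctop] with z h2 h3
    exact ⟨trivial, by_contra fun h => h3.1.2.1.1 (h2 h)⟩
  · rw [Measure.prod_prod]
    exact ENNReal.mul_ne_top (measure_ne_top _ _) hmS

/-- For the ground state the ratio `opE p / p` is constantly `lam` almost everywhere under the
marginal. -/
lemma modifiedRate_mix_groundState_le (hM : IsModel β W g) [SigmaFinite m] (hlam : 0 < lam)
    (hp : IsGroundState β m W g lam p)
    (hneg : NegInt (endpointLaw (mix β m W g (ENNReal.ofReal lam) p))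
      (llr (endpointLaw (mix β m W g (ENNReal.ofReal lam) p))
        ((endpointLaw (mix β m W g (ENNReal.ofReal lam) p)).fst.prod m))) :
    modifiedRate m W g (mix β m W g (ENNReal.ofReal lam) p) ≤ ((-Real.log lam : ℝ) : EReal) := by
  have h0 : ENNReal.ofReal lam ≠ 0 := (ENNReal.ofReal_pos.2 hlam).ne'
  have hprob : IsProbabilityMeasure (mix β m W g (ENNReal.ofReal lam) p) := by
    have := hM.isProbabilityMeasure_mix (m := m) hp.measurable (by rwa [hp.form_eq])
      (by rw [hp.form_eq]; exact ENNReal.ofReal_ne_top)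
    rwa [hp.form_eq] at this
  have hqp := isProbabilityMeasure_endpointLaw (mix β m W g (ENNReal.ofReal lam) p)
  have hlog : ∀ᵐ x ∂(endpointLaw (mix β m W g (ENNReal.ofReal lam) p)).fst,
      Real.log (opE β m W g p x / p x).toReal = Real.log lam := by
    rw [hM.fst_endpointLaw_mix hp.measurable, ae_withDensity_iff
      (show Measurable fun x => (ENNReal.ofReal lam)⁻¹ * (p x * opE β m W g p x) from
        (hp.measurable.mul (hM.measurable_opE hp.measurable)).const_mul _)]
    filter_upwards [hp.eigen, hp.ae_ne_top] with x h1 h2 h3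
    rw [h1, ENNReal.mul_div_cancel_right (left_ne_zero_of_mul (right_ne_zero_of_mul h3)) h2,
      ENNReal.toReal_ofReal hlam.le]
  have h := rate_mix_le hM hp.measurable hp.ae_ne_top hp.form_eq h0 ENNReal.ofReal_ne_top hneg
    ((integrable_const (Real.log lam)).congr (hlog.mono fun x hx => hx.symm))
  rwa [integral_congr_ae hlog, integral_const, probReal_univ, one_smul] at h

/-- Finiteness of `m B` supplies the integrability of the negative part. The marginal has density
`c⁻¹ f · opE f`, which is `p²` times the ratio over `c` on `B`, so `log (opE f / f)` becomes `t log
t`. -/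
lemma modifiedRate_mix_indicator_le (hM : IsModel β W g) [SigmaFinite m] (hlam : 0 < lam)
    (hp : IsGroundState β m W g lam p) {B : Set (Space d)} (hB : MeasurableSet B) (hmB : m B ≠ ⊤)
    (hc0 : form β m W g (B.indicator p) ≠ 0) :
    modifiedRate m W g (mix β m W g (form β m W g (B.indicator p)) (B.indicator p)) ≤
      ((-((form β m W g (B.indicator p)).toReal⁻¹ * ∫ x, truncEntropy β m W g p B x ∂m) : ℝ) :
        EReal) := by
  have hf : Measurable (B.indicator p) := hp.measurable.indicator hB
  have hle : ∀ x, B.indicator p x ≤ p x := fun y => Set.indicator_le_self' (fun _ _ => zero_le) y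
  have hctop : form β m W g (B.indicator p) ≠ ⊤ := by
    refine ne_top_of_le_ne_top ?_ (form_mono hle)
    rw [hp.form_eq]
    exact ENNReal.ofReal_ne_top
  have hftop : ∀ᵐ x ∂m, B.indicator p x ≠ ⊤ :=
    hp.ae_ne_top.mono fun x hx => ne_top_of_le_ne_top hx (hle x)
  have hop := hM.measurable_opE (m := m) hf
  have hneg := negInt_llr_mix hM hf hftop rfl hc0 hctop hB hmB
    (ae_of_all _ fun x hx => Set.indicator_of_notMem hx p)
  have hdm : Measurable fun x => (form β m W g (B.indicator p))⁻¹ *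
      (B.indicator p x * opE β m W g (B.indicator p) x) := (hf.mul hop).const_mul _
  have hopt : ∀ᵐ x ∂m, opE β m W g (B.indicator p) x ≠ ⊤ := by
    filter_upwards [opE_indicator_le hp B, hp.ae_ne_top] with x h1 h2
    exact ne_top_of_le_ne_top (ENNReal.mul_ne_top ENNReal.ofReal_ne_top h2) h1
  have hdt : ∀ᵐ x ∂m, (form β m W g (B.indicator p))⁻¹ *
      (B.indicator p x * opE β m W g (B.indicator p) x) < ⊤ := by
    filter_upwards [hopt, hftop] with x h1 h2
    exact (ENNReal.mul_ne_top (ENNReal.inv_ne_top.2 hc0) (ENNReal.mul_ne_top h2 h1)).lt_top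
  have hdens : ∀ᵐ x ∂m, ((form β m W g (B.indicator p))⁻¹ *
      (B.indicator p x * opE β m W g (B.indicator p) x)).toReal •
        Real.log (opE β m W g (B.indicator p) x / B.indicator p x).toReal =
      (form β m W g (B.indicator p)).toReal⁻¹ * truncEntropy β m W g p B x := by
    refine ae_of_all _ fun x => ?_
    rw [truncEntropy]
    by_cases hx : x ∈ B
    · rw [Set.indicator_of_mem hx, Set.indicator_of_mem hx, truncRatio, smul_eq_mul]
      simp only [ENNReal.toReal_mul, ENNReal.toReal_inv, ENNReal.toReal_div]
      by_cases h0 : (p x).toReal = 0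
      · simp [h0]
      · field_simp
    · rw [Set.indicator_of_notMem hx, Set.indicator_of_notMem hx]
      simp
  have hlog : Integrable (fun x => Real.log
      (opE β m W g (B.indicator p) x / B.indicator p x).toReal)
      (endpointLaw (mix β m W g (form β m W g (B.indicator p)) (B.indicator p))).fst := by
    rw [hM.fst_endpointLaw_mix hf, integrable_withDensity_iff_integrable_smul' hdm hdt]
    exact ((integrable_truncEntropy hM hlam hp hB).const_mul _).congr
      (hdens.mono fun x hx => hx.symm)
  have h := rate_mix_le hM hf hftop rfl hc0 hctop hneg hlog
  rwa [hM.fst_endpointLaw_mix hf, integral_withDensity_eq_integral_toReal_smul hdm hdt,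
    integral_congr_ae hdens, integral_const_mul] at h

/-- The infimum of the modified rate function is at most `-log lam`. -/
lemma iInf_modifiedRate_le (hM : IsModel β W g) (hm : IsAdmissible m) (hlam : 0 < lam)
    (hp : IsGroundState β m W g lam p) :
    (⨅ (μ : Measure (Path d β)) (_ : IsProbabilityMeasure μ), modifiedRate m W g μ) ≤
      ((-Real.log lam : ℝ) : EReal) := by
  have := hm.sigmaFinite
  have h0 : ENNReal.ofReal lam ≠ 0 := (ENNReal.ofReal_pos.2 hlam).ne'
  have hform := tendsto_form_indicator hM hp
  have hc : Tendsto (fun n : ℕ =>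
      (form β m W g ((Metric.closedBall (0 : Space d) n).indicator p)).toReal) atTop (𝓝 lam) := by
    have := (ENNReal.tendsto_toReal ENNReal.ofReal_ne_top).comp hform
    rwa [ENNReal.toReal_ofReal hlam.le] at this
  -- The normalizations tend to `lam` and the truncated entropies to `lam log lam`, so the bounds on
  -- the rates tend to `-log lam`.
  have hlim := ((hc.inv₀ hlam.ne').mul (tendsto_integral_truncEntropy hM hlam hp)).neg
  rw [inv_mul_cancel_left₀ hlam.ne'] at hlim
  refine ge_of_tendsto ((continuous_coe_real_ereal.tendsto _).comp hlim) ?_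
  filter_upwards [hform.eventually_ne h0] with n hn
  have hnt : form β m W g ((Metric.closedBall (0 : Space d) n).indicator p) ≠ ⊤ := by
    refine ne_top_of_le_ne_top ?_
      (form_mono (fun y => Set.indicator_le_self' (fun _ _ => zero_le) y))
    rw [hp.form_eq]
    exact ENNReal.ofReal_ne_top
  exact (iInf₂_le _ (hM.isProbabilityMeasure_mix (hp.measurable.indicator
    measurableSet_closedBall) hn hnt)).trans
    (modifiedRate_mix_indicator_le hM hlam hp measurableSet_closedBall
      (hm.lt_top_of_isCompact (isCompact_closedBall _ _)).ne hn)

lemma isProbabilityMeasure_mixture (hM : IsModel β W g) [SigmaFinite m] (hlam : 0 < lam)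
    (hφ0 : ∀ x, 0 ≤ φ x) (hp : IsGroundState β m W g lam p)
    (hpφ : ∀ᵐ x ∂m, p x = ENNReal.ofReal (φ x)) :
    IsProbabilityMeasure (mixture β m W g lam φ) := by
  rw [mixture_eq_mix hM hlam hφ0 hp.measurable hpφ, ← hp.form_eq]
  refine hM.isProbabilityMeasure_mix hp.measurable ?_ ?_ <;> rw [hp.form_eq]
  · exact (ENNReal.ofReal_pos.2 hlam).ne'
  · exact ENNReal.ofReal_ne_top

/-- The mixture attains the value `-log lam`. -/
lemma modifiedRate_mixture_le (hM : IsModel β W g) (hW : IsTrap W) (hm : IsAdmissible m)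
    (hlam : 0 < lam) (hφ0 : ∀ x, 0 ≤ φ x) (hp : IsGroundState β m W g lam p)
    (hpφ : ∀ᵐ x ∂m, p x = ENNReal.ofReal (φ x))
    (hfin : m {x | W x ≠ ⊤} = ⊤ → ∃ h : ℝ, relEntropy (endpointLaw (mixture β m W g lam φ))
      ((endpointLaw (mixture β m W g lam φ)).fst.prod m) = (h : EReal)) :
    modifiedRate m W g (mixture β m W g lam φ) ≤ ((-Real.log lam : ℝ) : EReal) := by
  have := hm.sigmaFinite
  rw [mixture_eq_mix hM hlam hφ0 hp.measurable hpφ] at hfin ⊢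
  refine modifiedRate_mix_groundState_le hM hlam hp ?_
  -- On a domain of finite mass integrability of the negative part is automatic, as `p` vanishes off
  -- the domain; otherwise it is read off from finiteness of the entropy.
  by_cases hD : m {x | W x ≠ ⊤} = ⊤
  · obtain ⟨h, hh⟩ := hfin hD
    rw [relEntropy] at hh
    split_ifs at hh
    · exact negInt_of_extIntegral_eq_coe hh
    · exact absurd hh (EReal.coe_ne_top h).symm
  · refine negInt_llr_mix hM hp.measurable hp.ae_ne_top hp.form_eq
      (ENNReal.ofReal_pos.2 hlam).ne' ENNReal.ofReal_ne_top hW.isClosed_domain.measurableSet hD ?_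
    filter_upwards [hp.ae_eq_zero hM hW hlam] with x hx hxD
    exact hx (not_not.1 hxD)

end UpperBound

end BridgeLDP

end

theorem corollary3p1 {d : ℕ} {β : ℝ} [Fact (0 < β)]
    (W : BridgeLDP.Space d → ℝ≥0∞) (hW : BridgeLDP.IsTrap W)
    (m : Measure (BridgeLDP.Space d)) (hm : BridgeLDP.IsAdmissible m)
    (g : BridgeLDP.Space d → BridgeLDP.Space d → ℝ)
    (hg_cont : Continuous (Function.uncurry g))
    (hg_bdd : ∃ C : ℝ, ∀ x y, g x y ≤ C)
    (hg_pos : ∀ x y, 0 < g x y)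
    (hg_symm : ∀ x y, g x y = g y x)
    (lam : ℝ) (hlam : 0 < lam)
    (hprincipal : BridgeLDP.IsPrincipalEigenvalue β m W g lam)
    (φ : BridgeLDP.Space d → ℝ) (hφ_nonneg : ∀ x, 0 ≤ φ x)
    (hφ_eigen : BridgeLDP.IsEigenfunction β m W g lam φ)
    (hφ_norm : ∫ x, φ x ^ 2 ∂m = 1) :
    -- the infimum of the modified rate function
    (⨅ (μ : Measure (BridgeLDP.Path d β)) (_ : IsProbabilityMeasure μ),
        BridgeLDP.modifiedRate m W g μ) = ((-Real.log lam : ℝ) : EReal) ∧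
    -- the mixture is a probability measure, and it is the unique minimizer
    IsProbabilityMeasure (BridgeLDP.mixture β m W g lam φ) ∧
    ((m {x | W x ≠ ⊤} = ⊤ → ∃ h : ℝ,
        BridgeLDP.relEntropy (BridgeLDP.endpointLaw (BridgeLDP.mixture β m W g lam φ))
          ((BridgeLDP.endpointLaw (BridgeLDP.mixture β m W g lam φ)).fst.prod m) = (h : EReal)) →
      BridgeLDP.IsMinimizer m W g (BridgeLDP.mixture β m W g lam φ)) ∧
    (((∃ x, W x = ⊤) → ∀ f, BridgeLDP.IsEigenfunction β m W g lam f →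
        ∃ c : ℝ, f =ᵐ[m] fun x => c * φ x) →
      ∀ μ : Measure (BridgeLDP.Path d β), BridgeLDP.IsMinimizer m W g μ →
        μ = BridgeLDP.mixture β m W g lam φ) := by
  have hM : BridgeLDP.IsModel β W g :=
    ⟨BridgeLDP.bridgeExists_of_isEigenfunction hlam hφ_eigen, hW.measurable, hg_cont.measurable,
      hg_pos, hg_symm, hg_bdd⟩
  have := hm.sigmaFinite
  obtain ⟨p, hp, hpφ⟩ := BridgeLDP.exists_isGroundState hM hlam hφ_nonneg hφ_eigen hφ_norm
  have hlower := BridgeLDP.neg_log_le_modifiedRate hM hW hm hlam hprincipal hφ_nonneg hp hpφ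
  have hinf : (⨅ (μ : Measure (BridgeLDP.Path d β)) (_ : IsProbabilityMeasure μ),
      BridgeLDP.modifiedRate m W g μ) = ((-Real.log lam : ℝ) : EReal) :=
    le_antisymm (BridgeLDP.iInf_modifiedRate_le hM hm hlam hp)
      (le_iInf₂ fun μ _ => (hlower μ).1)
  have hprob := BridgeLDP.isProbabilityMeasure_mixture hM hlam hφ_nonneg hp hpφ
  refine ⟨hinf, hprob, fun hfin => ⟨hprob, fun ν _ => ?_⟩, fun hsimple μ hμ => ?_⟩
  · exact (BridgeLDP.modifiedRate_mixture_le hM hW hm hlam hφ_nonneg hp hpφ hfin).trans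
      (hlower ν).1
  · have := hμ.1
    refine (hlower μ).2 (le_antisymm ?_ (hlower μ).1) hsimple
    rw [← hinf]
    exact le_iInf₂ fun ν hν => hμ.2 ν hν
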